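/- **Proposition 1.3.** All curves lie in the complex projective plane. For two curves that are both smooth at a point $p$, their contact order at $p$ is their intersection number there. Consider ordered pairs $(\mathcal C_1,\mathcal C_2)$, where $\mathcal C_1$ is an irreducible cubic with a double point and $\mathcal C_2$ is a nodal cubic (irreducible, with an ordinary double point), of one of the following two kinds: (a) there are points $P'$ and $P_1$, at each of which both cubics are smooth, such that $\mathcal C_1$ and $\mathcal C_2$ have contact order $2$ at $P'$ (ordinary tangency), contact order $7$ at $P_1$, and the common tangent line at $P'$ contains $P_1$; (b) there is a point $P$, at which both cubics are smooth, such that $\mathcal C_1$ and $\mathcal C_2$ have contact order $9$ at $P$, and $P$ is an inflection point of $\mathcal C_2$. Up to projective transformation there are exactly two such pairs, one of each kind: any two pairs of kind (a) are projectively equivalent (by one transformation carrying first cubic to first cubic and second to second), likewise any two pairs of kind (b), a pair of kind (a) is not projectively equivalent to a pair of kind (b), and both kinds occur. Namely: (1) There is a pair of kind (a) consisting of two nodal cubics $\mathcal C^{(1)}_1,\mathcal C^{(1)}_2$ such that $\mathcal C^{(1)}_1\cap\mathcal C^{(1)}_2=\{P_1,P'\}$ with $P_1\neq P'$, where $P_1$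 and $P'$ are singular points of $\mathcal C^{(1)}_1\cup\mathcal C^{(1)}_2$ of type $\mathbb A_{13}$ and $\mathbb A_3$ respectively, and the common tangent line at $P'$ contains $P_1$. There is exactly one irreducible conic that has intersection number six at $P_1$ with both cubics, and the pencil generated by the two cubics contains the reducible curve whose components are the common tangent line at $P'$ and this conic. (2) There is a pair of kind (b) consisting of two nodal cubics $\mathcal C^{(2)}_1,\mathcal C^{(2)}_2$ such that $\mathcal C^{(2)}_1\cap\mathcal C^{(2)}_2=\{P\}$, where $P$ is a singular point of $\mathcal C^{(2)}_1\cup\mathcal C^{(2)}_2$ of type $\mathbb A_{17}$ and an inflection point of both cubics. The pencil generated by the two cubics contains the triple line supported on the common tangent line at $P$. Here a plane curve has a singularity of type $\mathbb A_n$ at a point if in suitable local analytic coordinates centered at the point its equation is $y^2-x^{n+1}=0$. -/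

import Mathlib

open scoped Topology

noncomputable section

namespace PlaneCubics

/-- The complex projective plane. -/
abbrev Plane : Type := Projectivization ℂ (Fin 3 → ℂ)

/-- Polynomials in three variables; a plane curve is given by a nonzero homogeneous one,
taken up to a nonzero scalar. -/
abbrev Form : Type := MvPolynomial (Fin 3) ℂ

/-- The point `p` lies on the curve `F = 0`. For homogeneous `F` this does not depend on the
representative of `p`. -/
def OnCurve (F : Form) (p : Plane) : Prop :=
  MvPolynomial.eval p.rep F = 0

/-- The point `p` is a singular point of the curve `F = 0`. -/
def IsSingularPoint (F : Form) (p : Plane) : Prop :=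
  OnCurve F p ∧ ∀ i, MvPolynomial.eval p.rep (MvPolynomial.pderiv i F) = 0

/-- The point `p` is a smooth point of the curve `F = 0`. -/
def IsSmoothPoint (F : Form) (p : Plane) : Prop :=
  OnCurve F p ∧ ∃ i, MvPolynomial.eval p.rep (MvPolynomial.pderiv i F) ≠ 0

/-- The Hessian matrix of `F` at (a representative of) `p`. -/
def hessian (F : Form) (p : Plane) : Matrix (Fin 3) (Fin 3) ℂ :=
  Matrix.of fun i j =>
    MvPolynomial.eval p.rep (MvPolynomial.pderiv i (MvPolynomial.pderiv j F))

/-- The point `p` is a node (ordinary double point) of the curve `F = 0`: it is a singular point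
and the quadratic part of a local equation is nondegenerate. At a singular point the Hessian of the
homogeneous equation kills the vector representing `p`, and the form that it induces on the
two-dimensional quotient is (twice) the quadratic part of the local equation, so nondegeneracy
means that the Hessian has rank two. -/
def IsNode (F : Form) (p : Plane) : Prop :=
  IsSingularPoint F p ∧ (hessian F p).rank = 2

/-- An irreducible plane cubic. -/
def IsIrreducibleCubic (F : Form) : Prop :=
  F.IsHomogeneous 3 ∧ Irreducible F

/-- An irreducible plane cubic with a singular point (which is then a double point). -/
def IsSingularCubic (F : Form) : Prop :=
  IsIrreducibleCubic F ∧ ∃ p, IsSingularPoint F p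

/-- A nodal plane cubic. -/
def IsNodalCubic (F : Form) : Prop :=
  IsIrreducibleCubic F ∧ ∃ p, IsNode F p

/-- An irreducible (that is, smooth) conic. -/
def IsIrreducibleConic (F : Form) : Prop :=
  F.IsHomogeneous 2 ∧ Irreducible F

/-- The equation of the tangent line to `F = 0` at a smooth point `p`. -/
def tangentForm (F : Form) (p : Plane) : Form :=
  ∑ i, MvPolynomial.C (MvPolynomial.eval p.rep (MvPolynomial.pderiv i F)) * MvPolynomial.X i

/-- `L = 0` is the tangent line to `F = 0` at the smooth point `p`. -/
def IsTangentLine (L F : Form) (p : Plane) : Prop :=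
  IsSmoothPoint F p ∧ ∃ c : ℂ, c ≠ 0 ∧ L = MvPolynomial.C c * tangentForm F p

/-- The curves `F = 0` and `G = 0` are both smooth at `p` and have contact order (intersection
number) `n` there: `n` is the order of vanishing of `G` along an analytic local parametrization
`γ` of `F = 0` at `p`. -/
def HasContactOrder (F G : Form) (p : Plane) (n : ℕ∞) : Prop :=
  IsSmoothPoint F p ∧ IsSmoothPoint G p ∧
    ∃ γ : ℂ → Fin 3 → ℂ, AnalyticAt ℂ γ 0 ∧ γ 0 = p.rep ∧
      LinearIndependent ℂ ![γ 0, deriv γ 0] ∧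
      (∀ᶠ t in 𝓝 (0 : ℂ), MvPolynomial.eval (γ t) F = 0) ∧
      analyticOrderAt (fun t => MvPolynomial.eval (γ t) G) 0 = n

/-- The point `p` is an inflection point of `F = 0`: a smooth point at which the tangent line
has contact order at least three with the curve. -/
def IsInflection (F : Form) (p : Plane) : Prop :=
  ∃ n : ℕ∞, 3 ≤ n ∧ HasContactOrder F (tangentForm F p) p n

/-- The curve `F = 0` has a singularity of type `A_n` at `p`: in an affine chart centered at `p`
(with coordinates `w` along the vectors `a`, `b`) there are local analytic coordinates `x`, `y` at
`p` in which the equation of the curve is `y ^ 2 - x ^ (n + 1) = 0`. -/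
def IsTypeA (n : ℕ) (F : Form) (p : Plane) : Prop :=
  ∃ a b : Fin 3 → ℂ, LinearIndependent ℂ ![p.rep, a, b] ∧
    ∃ x y : ℂ × ℂ → ℂ, AnalyticAt ℂ x 0 ∧ AnalyticAt ℂ y 0 ∧ x 0 = 0 ∧ y 0 = 0 ∧
      LinearIndependent ℂ ![fderiv ℂ x 0, fderiv ℂ y 0] ∧
      ∀ᶠ w in 𝓝 (0 : ℂ × ℂ),
        MvPolynomial.eval (p.rep + w.1 • a + w.2 • b) F = y w ^ 2 - x w ^ (n + 1)

/-- The curve `H = 0` belongs to the pencil generated by `F = 0` and `G = 0`. -/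
def InPencil (F G H : Form) : Prop :=
  H ≠ 0 ∧ ∃ a b : ℂ, H = MvPolynomial.C a * F + MvPolynomial.C b * G

/-- The linear change of coordinates given by the matrix `A`. -/
def substitute (A : Matrix (Fin 3) (Fin 3) ℂ) (F : Form) : Form :=
  MvPolynomial.bind₁ (fun i => ∑ j, MvPolynomial.C (A i j) * MvPolynomial.X j) F

/-- The ordered pairs of curves `(F, G)` and `(F', G')` are projectively equivalent. -/
def ProjEquivPairs (F G F' G' : Form) : Prop :=
  ∃ A : Matrix.GeneralLinearGroup (Fin 3) ℂ, ∃ c d : ℂ, c ≠ 0 ∧ d ≠ 0 ∧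
    substitute (A : Matrix (Fin 3) (Fin 3) ℂ) F = MvPolynomial.C c * F' ∧
    substitute (A : Matrix (Fin 3) (Fin 3) ℂ) G = MvPolynomial.C d * G'

/-- The first type of pair: `C₁` is an irreducible cubic with a double point and `C₂` is a nodal
cubic; at `P'` both are smooth with ordinary tangency (contact order two), the tangent line there
contains `P₁`, and at `P₁` both are smooth with contact order seven. -/
def MatchesA (C₁ C₂ : Form) (P₁ P' : Plane) : Prop :=
  IsSingularCubic C₁ ∧ IsNodalCubic C₂ ∧
    HasContactOrder C₁ C₂ P' 2 ∧ HasContactOrder C₁ C₂ P₁ 7 ∧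
    OnCurve (tangentForm C₂ P') P₁

/-- The second type of pair: `C₁` is an irreducible cubic with a double point and `C₂` is a nodal
cubic; they have contact order nine at `P`, an inflection point of `C₂`. -/
def MatchesB (C₁ C₂ : Form) (P : Plane) : Prop :=
  IsSingularCubic C₁ ∧ IsNodalCubic C₂ ∧ HasContactOrder C₁ C₂ P 9 ∧ IsInflection C₂ P

/-- The asserted properties of the first pair: nodal cubics meeting exactly in `P₁` and `P'`, where
their union has types `A₁₃` and `A₃`; the common tangent line `L` at `P'` contains `P₁`; there
is exactly one irreducible conic `Q` that has intersection number six at `P₁` with both cubics,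
and `L + Q` belongs to the pencil generated by the cubics. -/
def FirstPair (C₁ C₂ : Form) (P₁ P' : Plane) : Prop :=
  IsNodalCubic C₁ ∧ IsNodalCubic C₂ ∧ P₁ ≠ P' ∧
    {p | OnCurve C₁ p ∧ OnCurve C₂ p} = ({P₁, P'} : Set Plane) ∧
    IsTypeA 13 (C₁ * C₂) P₁ ∧ IsTypeA 3 (C₁ * C₂) P' ∧
    ∃ L Q : Form,
      IsTangentLine L C₁ P' ∧ IsTangentLine L C₂ P' ∧ OnCurve L P₁ ∧
      IsIrreducibleConic Q ∧ HasContactOrder C₁ Q P₁ 6 ∧ HasContactOrder C₂ Q P₁ 6 ∧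
      (∀ Q' : Form, IsIrreducibleConic Q' → HasContactOrder C₁ Q' P₁ 6 →
        HasContactOrder C₂ Q' P₁ 6 → ∃ c : ℂ, Q' = MvPolynomial.C c * Q) ∧
      InPencil C₁ C₂ (L * Q)

/-- The asserted properties of the second pair: nodal cubics meeting only in `P`, where their union
has type `A₁₇`; `P` is an inflection point of both, and the pencil generated by the cubics
contains the triple of the common tangent line at `P`. -/
def SecondPair (C₁ C₂ : Form) (P : Plane) : Prop :=
  IsNodalCubic C₁ ∧ IsNodalCubic C₂ ∧
    {p | OnCurve C₁ p ∧ OnCurve C₂ p} = ({P} : Set Plane) ∧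
    IsTypeA 17 (C₁ * C₂) P ∧ IsInflection C₁ P ∧ IsInflection C₂ P ∧
    ∃ L : Form, IsTangentLine L C₁ P ∧ IsTangentLine L C₂ P ∧ InPencil C₁ C₂ (L ^ 3)

end PlaneCubics

end

open scoped Topology

namespace PlaneCubics

open MvPolynomial

/-! ### Linear substitutions -/

/-! Everything happens on the parameter line of the first cubic. An irreducible singular cubic is
linearly equivalent to `nodalForm` or `cuspForm` (`IsSingularCubic.linearlyEquivalent`), and each of
these is parametrized by polynomials of degree at most three. A second cubic pulls back to a
polynomial of degree at most nine whose root multiplicities are the contact orders. The group law on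
the smooth locus appears as one linear relation between coefficients: if the pullback has degree
nine, its roots have product 1 in the nodal case and sum 0 in the cuspidal case. Three collinear
points obey the same rule.

For kind (a), let `t` and `s` be the parameters of the points of contact order two and seven. On a
cusp, 2t + 7s = 0 and 2t + s = 0 force s = t, which is absurd. On a node, t²s⁷ = 1 and t²s = 1 give
s⁶ = 1. The cubic has automorphisms multiplying parameters by cube roots of unity, so s = 1 or s =
-1 may be assumed. For kind (b) the inflection passes from the second cubic to the first because
their contact is high; on a node this gives t³ = 1, hence t = 1 after scaling. On a cusp the
relation gives t = 0, and the second cubic is then smooth, a contradiction.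

Once the pullback is known up to a scalar, the second cubic lies in a pencil spanned by the nodal
cubic and an explicit reducible cubic with the same pullback (`exists_pencil_of_restriction`). Being
singular and irreducible leaves few members. For (b) exactly one remains. For (a) with s = 1, t =
-1, the only candidate is singular at the tangency point and is excluded
(`not_meetsNodalTwice_flex`). For s = -1, t² = -1, one candidate is excluded for the same reason and
exactly one survives (`tangent_pencil_singular`).

Existence is a computation with the surviving pairs. The types of the singularities follow by
completing the square in a product of two smooth germs (`isTypeA_mul_mk`). The two kinds are told
apart by the number of common points. -/

/-- The chain rule for derivations and polynomial expressions. -/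
theorem derivation_aeval {S : Type*} [CommRing S] [Algebra ℂ S] (D : Derivation ℂ S S)
    (f : Fin 3 → S) (F : Form) :
    D (aeval f F) = ∑ i, aeval f (pderiv i F) * D (f i) := by
  induction F using MvPolynomial.induction_on with
  | C a => simp
  | add p q hp hq => simp [hp, hq, add_mul, Finset.sum_add_distrib]
  | mul_X p j hp =>
    simp only [map_mul, aeval_X, Derivation.leibniz, hp, smul_eq_mul, pderiv_X, map_add]
    have : ∀ i, (aeval f) ((Pi.single i 1 : Fin 3 → Form) j) = if j = i then 1 else 0 := by
      intro i
      by_cases h : j = i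
      · subst h; simp
      · simp [h]
    simp only [this, Fin.sum_univ_three]
    fin_cases j <;> simp <;> ring

theorem substitute_eq_aeval (A : Matrix (Fin 3) (Fin 3) ℂ) (F : Form) :
    substitute A F = aeval (fun i => ∑ j, C (A i j) * X j : Fin 3 → Form) F := rfl

@[simp] theorem eval_substitute (A : Matrix (Fin 3) (Fin 3) ℂ) (F : Form) (v : Fin 3 → ℂ) :
    eval v (substitute A F) = eval (A.mulVec v) F := by
  rw [substitute, ← aeval_eq_eval, ← aeval_eq_eval, aeval_bind₁]
  congr 2
  ext i
  simp [Matrix.mulVec, dotProduct]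

/-- Over the infinite field ℂ a form is determined by its values, so identities between substituted
forms reduce to identities between matrix-vector products. The same device is used throughout. -/
theorem substitute_substitute (A B : Matrix (Fin 3) (Fin 3) ℂ) (F : Form) :
    substitute A (substitute B F) = substitute (B * A) F :=
  MvPolynomial.funext fun v => by simp

@[simp] theorem substitute_one (F : Form) : substitute 1 F = F :=
  MvPolynomial.funext fun v => by simp

@[simp] theorem substitute_mul (A : Matrix (Fin 3) (Fin 3) ℂ) (F G : Form) :
    substitute A (F * G) = substitute A F * substitute A G := by simp [substitute]

theorem eval_pderiv_substitute (A : Matrix (Fin 3) (Fin 3) ℂ) (F : Form) (v : Fin 3 → ℂ)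
    (i : Fin 3) :
    eval v (pderiv i (substitute A F)) = ∑ j, eval (A.mulVec v) (pderiv j F) * A j i := by
  rw [substitute_eq_aeval, derivation_aeval, map_sum]
  refine Finset.sum_congr rfl fun j _ => ?_
  rw [← substitute_eq_aeval, map_mul, eval_substitute]
  congr 1
  fin_cases i <;> simp [Fin.sum_univ_three, pderiv_X]

theorem isHomogeneous_substitute (A : Matrix (Fin 3) (Fin 3) ℂ) {F : Form} {n : ℕ}
    (hF : F.IsHomogeneous n) : (substitute A F).IsHomogeneous n := by
  have := hF.aeval (n := 1) (fun i => ∑ j, C (A i j) * X j : Fin 3 → Form) fun i =>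
    IsHomogeneous.sum _ _ _ fun j _ => isHomogeneous_C_mul_X _ _
  simpa [substitute_eq_aeval] using this

theorem sum_exponents_of_isHomogeneous {F : Form} {n : ℕ} (hF : F.IsHomogeneous n)
    {d : Fin 3 →₀ ℕ} (hd : d ∈ F.support) : ∑ i, d i = n := by
  have := hF (mem_support_iff.mp hd)
  rw [Finsupp.weight_apply, Finsupp.sum_fintype _ _ (by simp)] at this
  simpa using this

theorem eval_smul_of_isHomogeneous {F : Form} {n : ℕ} (hF : F.IsHomogeneous n) (c : ℂ)
    (v : Fin 3 → ℂ) : eval (c • v) F = c ^ n * eval v F := by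
  have hv : ∀ G : Form, eval (c • v) G = ∑ d ∈ G.support, coeff d G * ∏ i, (c • v) i ^ d i :=
    fun G => eval_eq' _ _
  rw [hv, eval_eq', Finset.mul_sum]
  refine Finset.sum_congr rfl fun d hd => ?_
  simp only [Pi.smul_apply, smul_eq_mul, mul_pow, Finset.prod_mul_distrib,
    Finset.prod_pow_eq_pow_sum]
  rw [sum_exponents_of_isHomogeneous hF hd]
  ring

/-- Linear substitution by an invertible matrix, as an isomorphism. -/
noncomputable def substituteEquiv (A : Matrix.GeneralLinearGroup (Fin 3) ℂ) : Form ≃* Form where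
  toFun := substitute (A : Matrix (Fin 3) (Fin 3) ℂ)
  invFun := substitute ((A⁻¹ : Matrix.GeneralLinearGroup (Fin 3) ℂ) : Matrix (Fin 3) (Fin 3) ℂ)
  left_inv F := by rw [substitute_substitute, ← Units.val_mul]; simp
  right_inv F := by rw [substitute_substitute, ← Units.val_mul]; simp
  map_mul' F G := by simp

theorem irreducible_substitute (A : Matrix.GeneralLinearGroup (Fin 3) ℂ) {F : Form} :
    Irreducible (substitute (A : Matrix (Fin 3) (Fin 3) ℂ) F) ↔ Irreducible F :=
  MulEquiv.irreducible_iff (substituteEquiv A)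

theorem IsIrreducibleCubic.substitute {F : Form} (hF : IsIrreducibleCubic F)
    (A : Matrix.GeneralLinearGroup (Fin 3) ℂ) :
    IsIrreducibleCubic (substitute (A : Matrix (Fin 3) (Fin 3) ℂ) F) :=
  ⟨isHomogeneous_substitute _ hF.1, (irreducible_substitute A).2 hF.2⟩

/-- A unit does not vanish at the origin, whereas forms of positive degree do. This is the
reducibility test behind every appeal to irreducibility below. -/
theorem not_irreducible_mul {F G : Form} (hF : eval 0 F = 0) (hG : eval 0 G = 0) :
    ¬ Irreducible (F * G) := by
  intro h
  rcases h.isUnit_or_isUnit rfl with h | h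
  · exact (h.map (eval (0 : Fin 3 → ℂ))).ne_zero hF
  · exact (h.map (eval (0 : Fin 3 → ℂ))).ne_zero hG

/-- The form of degree three with the given coefficients. -/
noncomputable def cubicForm (a : ℕ → ℕ → ℂ) : Form :=
  C (a 3 0) * X 0 ^ 3 + C (a 2 1) * X 0 ^ 2 * X 1 + C (a 1 2) * X 0 * X 1 ^ 2 +
    C (a 0 3) * X 1 ^ 3 + C (a 2 0) * X 0 ^ 2 * X 2 + C (a 1 1) * X 0 * X 1 * X 2 +
    C (a 0 2) * X 1 ^ 2 * X 2 + C (a 1 0) * X 0 * X 2 ^ 2 + C (a 0 1) * X 1 * X 2 ^ 2 +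
    C (a 0 0) * X 2 ^ 3

/-- The form of degree two with the given coefficients. -/
noncomputable def quadraticForm (a : ℕ → ℕ → ℂ) : Form :=
  C (a 2 0) * X 0 ^ 2 + C (a 1 1) * X 0 * X 1 + C (a 0 2) * X 1 ^ 2 + C (a 1 0) * X 0 * X 2 +
    C (a 0 1) * X 1 * X 2 + C (a 0 0) * X 2 ^ 2

/-- The image of an additive `Φ` is closed under sums, so it suffices to reach the monomials.
Degrees two and three share this argument. -/
theorem exists_form_of_isHomogeneous {n : ℕ} (Φ : (ℕ → ℕ → ℂ) → Form)
    (h0 : Φ 0 = 0) (hadd : ∀ a b, Φ (a + b) = Φ a + Φ b)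
    (hmon : ∀ (d : Fin 3 →₀ ℕ) (c : ℂ), d 0 + d 1 + d 2 = n → ∃ a, monomial d c = Φ a)
    {F : Form} (hF : F.IsHomogeneous n) : ∃ a, F = Φ a := by
  rw [F.as_sum]
  refine Finset.sum_induction _ (fun G : Form => ∃ a, G = Φ a) ?_ ⟨0, h0.symm⟩ ?_
  · rintro _ _ ⟨a, rfl⟩ ⟨b, rfl⟩
    exact ⟨a + b, (hadd a b).symm⟩
  · intro d hd
    refine hmon d _ ?_
    rw [← sum_exponents_of_isHomogeneous hF hd, Fin.sum_univ_three]

theorem exists_cubicForm {F : Form} (hF : F.IsHomogeneous 3) : ∃ a, F = cubicForm a := by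
  refine exists_form_of_isHomogeneous cubicForm (by simp [cubicForm])
    (fun a b => by simp only [cubicForm, Pi.add_apply, map_add]; ring) (fun d c hd => ?_) hF
  -- The entry `a i j` belongs to the monomial with exponents i and j in the first two variables;
  -- the degree fixes the third exponent.
  refine ⟨fun i j => if d 0 = i ∧ d 1 = j then c else 0, MvPolynomial.funext fun v => ?_⟩
  rw [eval_monomial, Finsupp.prod_fintype _ _ (by simp)]
  have h2 : d 2 = 3 - d 0 - d 1 := by omega
  have hle : d 0 + d 1 ≤ 3 := by omega
  rw [Fin.prod_univ_three, h2]
  generalize d 0 = i at *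
  generalize d 1 = j at *
  have hi : i ≤ 3 := by omega
  have hj : j ≤ 3 := by omega
  interval_cases i <;> interval_cases j <;> first | omega | (simp [cubicForm]; try ring)

theorem exists_quadraticForm {F : Form} (hF : F.IsHomogeneous 2) :
    ∃ a, F = quadraticForm a := by
  refine exists_form_of_isHomogeneous quadraticForm (by simp [quadraticForm])
    (fun a b => by simp only [quadraticForm, Pi.add_apply, map_add]; ring) (fun d c hd => ?_) hF
  refine ⟨fun i j => if d 0 = i ∧ d 1 = j then c else 0, MvPolynomial.funext fun v => ?_⟩
  rw [eval_monomial, Finsupp.prod_fintype _ _ (by simp)]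
  have h2 : d 2 = 2 - d 0 - d 1 := by omega
  have hle : d 0 + d 1 ≤ 2 := by omega
  rw [Fin.prod_univ_three, h2]
  generalize d 0 = i at *
  generalize d 1 = j at *
  have hi : i ≤ 2 := by omega
  have hj : j ≤ 2 := by omega
  interval_cases i <;> interval_cases j <;> first | omega | (simp [quadraticForm]; try ring)

/-! ### Arcs and contact orders -/

/-- The form `F` vanishes at the vector `v`, its gradient does not. -/
def IsSmoothVector (F : Form) (v : Fin 3 → ℂ) : Prop :=
  eval v F = 0 ∧ ∃ i, eval v (pderiv i F) ≠ 0

/-- An analytic arc on the cone `F = 0` that is immersed in the projective plane. -/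
def IsArc (F : Form) (γ : ℂ → Fin 3 → ℂ) : Prop :=
  AnalyticAt ℂ γ 0 ∧ LinearIndependent ℂ ![γ 0, deriv γ 0] ∧
    ∀ᶠ t in 𝓝 (0 : ℂ), eval (γ t) F = 0

/-- The gradient of the substituted form is the old gradient, as a row vector, times `A`, and an
invertible matrix kills no nonzero row. -/
theorem IsSmoothVector.substitute {F : Form} {A : Matrix (Fin 3) (Fin 3) ℂ} (hA : IsUnit A)
    {v : Fin 3 → ℂ} (h : IsSmoothVector F (A.mulVec v)) :
    IsSmoothVector (substitute A F) v := by
  refine ⟨by simpa using h.1, ?_⟩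
  by_contra! hc
  obtain ⟨i, hi⟩ := h.2
  have : Matrix.vecMul (fun j => eval (A.mulVec v) (pderiv j F)) A = 0 := by
    ext k
    simpa [eval_pderiv_substitute, Matrix.vecMul, dotProduct] using hc k
  have h0 := Matrix.vecMul_injective_iff_isUnit.2 hA (this.trans (Matrix.zero_vecMul A).symm)
  exact hi (congrFun h0 i)

theorem not_isSmoothVector_substitute {F : Form} {A : Matrix (Fin 3) (Fin 3) ℂ}
    {v : Fin 3 → ℂ} (h : ∀ i, eval (A.mulVec v) (pderiv i F) = 0) (i : Fin 3) :
    eval v (pderiv i (substitute A F)) = 0 := by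
  simp [eval_pderiv_substitute, h]

theorem IsSmoothVector.smul {F : Form} {n : ℕ} (hF : F.IsHomogeneous n) {v : Fin 3 → ℂ} {c : ℂ}
    (hc : c ≠ 0) (h : IsSmoothVector F v) : IsSmoothVector F (c • v) := by
  obtain ⟨h0, i, hi⟩ := h
  refine ⟨by simp [eval_smul_of_isHomogeneous hF, h0], i, ?_⟩
  rw [eval_smul_of_isHomogeneous hF.pderiv]
  exact mul_ne_zero (pow_ne_zero _ hc) hi

theorem linearIndependent_pair_map {A : Matrix (Fin 3) (Fin 3) ℂ} (hA : IsUnit A)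
    {v w : Fin 3 → ℂ} (h : LinearIndependent ℂ ![v, w]) :
    LinearIndependent ℂ ![A.mulVec v, A.mulVec w] := by
  have := h.map' A.mulVecLin (LinearMap.ker_eq_bot.2 (Matrix.mulVec_injective_iff_isUnit.2 hA))
  have e : A.mulVecLin ∘ ![v, w] = ![A.mulVec v, A.mulVec w] := by
    ext i : 1
    fin_cases i <;> rfl
  rwa [e] at this

theorem hasDerivAt_mulVec (A : Matrix (Fin 3) (Fin 3) ℂ) {γ : ℂ → Fin 3 → ℂ} {t : ℂ}
    {w : Fin 3 → ℂ} (h : HasDerivAt γ w t) :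
    HasDerivAt (fun s => A.mulVec (γ s)) (A.mulVec w) t :=
  (LinearMap.toContinuousLinearMap A.mulVecLin).hasFDerivAt.comp_hasDerivAt t h

theorem analyticAt_mulVec (A : Matrix (Fin 3) (Fin 3) ℂ) {γ : ℂ → Fin 3 → ℂ} {t : ℂ}
    (h : AnalyticAt ℂ γ t) : AnalyticAt ℂ (fun s => A.mulVec (γ s)) t :=
  ((LinearMap.toContinuousLinearMap A.mulVecLin).analyticAt _).comp h

theorem IsArc.substitute {F : Form} {γ : ℂ → Fin 3 → ℂ} (h : IsArc F γ)
    {A B : Matrix (Fin 3) (Fin 3) ℂ} (hAB : A * B = 1) :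
    IsArc (substitute A F) fun t => B.mulVec (γ t) := by
  have hB : IsUnit B := IsUnit.of_mul_eq_one_right A hAB
  refine ⟨analyticAt_mulVec B h.1, ?_, ?_⟩
  · rw [(hasDerivAt_mulVec B h.1.differentiableAt.hasDerivAt).deriv]
    exact linearIndependent_pair_map hB h.2.1
  · filter_upwards [h.2.2] with t ht
    simpa [hAB] using ht

theorem linearIndependent_pair_smul {v w : Fin 3 → ℂ} {c : ℂ} (hc : c ≠ 0)
    (h : LinearIndependent ℂ ![v, w]) : LinearIndependent ℂ ![c • v, c • w] := by
  rw [LinearIndependent.pair_iff] at h ⊢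
  intro s t hst
  have := h (s * c) (t * c) (by simpa only [mul_smul] using hst)
  simpa [hc] using this

theorem IsArc.smul {F : Form} {n : ℕ} (hF : F.IsHomogeneous n) {γ : ℂ → Fin 3 → ℂ}
    (h : IsArc F γ) {c : ℂ} (hc : c ≠ 0) : IsArc F (c • γ) := by
  refine ⟨h.1.const_smul, ?_, ?_⟩
  · rw [(h.1.differentiableAt.hasDerivAt.const_smul c).deriv]
    exact linearIndependent_pair_smul hc h.2.1
  · filter_upwards [h.2.2] with t ht
    simp [eval_smul_of_isHomogeneous hF, ht]

theorem hasContactOrder_iff {F G : Form} {p : Plane} {n : ℕ∞} :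
    HasContactOrder F G p n ↔ IsSmoothVector F p.rep ∧ IsSmoothVector G p.rep ∧
      ∃ γ, IsArc F γ ∧ γ 0 = p.rep ∧ analyticOrderAt (fun t => eval (γ t) G) 0 = n :=
  ⟨fun ⟨h1, h2, γ, a, b, c, d, e⟩ => ⟨h1, h2, γ, ⟨a, c, d⟩, b, e⟩,
    fun ⟨h1, h2, γ, ⟨a, c, d⟩, b, e⟩ => ⟨h1, h2, γ, a, b, c, d, e⟩⟩

/-- The transported data are stated at the vector `γ 0`, not at a point of the plane: the chosen
representative of the transformed point would differ from it by an uncontrolled scalar. -/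
theorem HasContactOrder.exists_arc_substitute {F G : Form} {p : Plane} {n : ℕ∞}
    (h : HasContactOrder F G p n) (A : Matrix.GeneralLinearGroup (Fin 3) ℂ) :
    ∃ γ, IsArc (substitute (A : Matrix (Fin 3) (Fin 3) ℂ) F) γ ∧
      (A : Matrix (Fin 3) (Fin 3) ℂ).mulVec (γ 0) = p.rep ∧
      IsSmoothVector (substitute (A : Matrix (Fin 3) (Fin 3) ℂ) F) (γ 0) ∧
      IsSmoothVector (substitute (A : Matrix (Fin 3) (Fin 3) ℂ) G) (γ 0) ∧
      analyticOrderAt (fun t => eval (γ t) (substitute (A : Matrix (Fin 3) (Fin 3) ℂ) G)) 0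
        = n := by
  obtain ⟨h1, h2, γ, hγ, h0, ho⟩ := hasContactOrder_iff.1 h
  have hAB : (A : Matrix (Fin 3) (Fin 3) ℂ) *
      ((A⁻¹ : Matrix.GeneralLinearGroup (Fin 3) ℂ) : Matrix (Fin 3) (Fin 3) ℂ) = 1 := by
    rw [← Units.val_mul]; simp
  have key : ∀ w, (A : Matrix (Fin 3) (Fin 3) ℂ).mulVec
      (((A⁻¹ : Matrix.GeneralLinearGroup (Fin 3) ℂ) : Matrix (Fin 3) (Fin 3) ℂ).mulVec w) = w := by
    intro w; rw [Matrix.mulVec_mulVec, hAB, Matrix.one_mulVec]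
  refine ⟨_, hγ.substitute hAB, by simp only [key, h0], ?_, ?_, ?_⟩
  · exact IsSmoothVector.substitute A.isUnit (by simpa only [key, h0] using h1)
  · exact IsSmoothVector.substitute A.isUnit (by simpa only [key, h0] using h2)
  · simpa only [eval_substitute, key] using ho

theorem analyticAt_eval {γ : ℂ → Fin 3 → ℂ} {t : ℂ} (h : AnalyticAt ℂ γ t) (F : Form) :
    AnalyticAt ℂ (fun s => eval (γ s) F) t := by
  have h' : ∀ i, AnalyticAt ℂ (fun s => γ s i) t := fun i => (analyticAt_pi_iff.1 h) i
  simpa [aeval_eq_eval] using AnalyticAt.aeval_mvPolynomial h' F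

/-- The chosen representative of the point is a multiple of `v`. Multiplying the arc by that scalar
only multiplies the value of `G` by a nonzero constant, so the order can be read off at `v`. -/
theorem hasContactOrder_mk {F G : Form} {d e n : ℕ} (hF : F.IsHomogeneous d)
    (hG : G.IsHomogeneous e) {v : Fin 3 → ℂ} (hv : v ≠ 0) (hFv : IsSmoothVector F v)
    (hGv : IsSmoothVector G v) {γ : ℂ → Fin 3 → ℂ} (hγ : IsArc F γ) (h0 : γ 0 = v) {g : ℂ → ℂ}
    (hg' : Differentiable ℂ g) (hg0 : g 0 ≠ 0)
    (hGγ : ∀ t, eval (γ t) G = t ^ n * g t) :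
    HasContactOrder F G (Projectivization.mk ℂ v hv) n := by
  obtain ⟨a, ha⟩ := Projectivization.exists_smul_eq_mk_rep ℂ v hv
  have ha' : (a : ℂ) • v = (Projectivization.mk ℂ v hv).rep := ha
  refine hasContactOrder_iff.2 ⟨ha' ▸ hFv.smul hF a.ne_zero, ha' ▸ hGv.smul hG a.ne_zero,
    (a : ℂ) • γ, hγ.smul hF a.ne_zero, by simpa [h0] using ha', ?_⟩
  have han : AnalyticAt ℂ (fun t => eval (((a : ℂ) • γ) t) G) 0 :=
    analyticAt_eval (hγ.smul hF a.ne_zero).1 G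
  rw [han.analyticOrderAt_eq_natCast]
  refine ⟨fun t => (a : ℂ) ^ e * g t, ((hg'.const_mul _).analyticAt 0),
    mul_ne_zero (pow_ne_zero _ a.ne_zero) hg0, Filter.Eventually.of_forall fun t => ?_⟩
  simp only [Pi.smul_apply, eval_smul_of_isHomogeneous hG, hGγ, sub_zero, smul_eq_mul]
  ring

/-! ### Order of contact along a polynomial parametrization -/

open Polynomial in
-- For a nonzero polynomial the analytic order at a point is the root multiplicity there.
theorem pow_dvd_of_le_analyticOrderAt {P : ℂ[X]} {a : ℂ} {n : ℕ}
    (h : n ≤ analyticOrderAt (fun t => P.eval t) a) : (Polynomial.X - Polynomial.C a) ^ n ∣ P := by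
  by_cases hP : P = 0
  · simp [hP]
  obtain ⟨Q, hQ, hQa⟩ := Polynomial.exists_eq_pow_rootMultiplicity_mul_and_not_dvd P hP a
  rw [Polynomial.dvd_iff_isRoot, Polynomial.IsRoot] at hQa
  have hdiff : ∀ R : ℂ[X], AnalyticAt ℂ (fun t => R.eval t) a :=
    fun R => R.differentiable.analyticAt a
  have ho : analyticOrderAt (fun t => P.eval t) a = P.rootMultiplicity a := by
    rw [(hdiff P).analyticOrderAt_eq_natCast]
    refine ⟨fun t => Q.eval t, hdiff Q, hQa, Filter.Eventually.of_forall fun t => ?_⟩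
    conv_lhs => rw [hQ]
    simp
  rw [ho] at h
  exact (Polynomial.le_rootMultiplicity_iff hP).1 (by exact_mod_cast h)

theorem eval_aeval_polynomial (φ : Fin 3 → Polynomial ℂ) (G : Form) (t : ℂ) :
    (aeval φ G).eval t = eval (fun i => (φ i).eval t) G := by
  rw [← Polynomial.coe_evalRingHom, MvPolynomial.map_aeval]
  simp [MvPolynomial.eval₂_eq', MvPolynomial.eval_eq']

open Polynomial in
/-- An arc that runs, up to a factor, along a polynomially parametrized curve has with any other
curve the contact order given by the parametrization. -/
theorem analyticOrderAt_eval_arc {G : Form} {n : ℕ} (hG : G.IsHomogeneous n) (φ : Fin 3 → ℂ[X])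
    {γ : ℂ → Fin 3 → ℂ} {μ τ : ℂ → ℂ} (hμ : AnalyticAt ℂ μ 0) (hτ : AnalyticAt ℂ τ 0)
    (hμ0 : μ 0 ≠ 0) (hγ : LinearIndependent ℂ ![γ 0, deriv γ 0])
    (h : ∀ᶠ t in 𝓝 (0 : ℂ), γ t = μ t • fun i => (φ i).eval (τ t)) :
    analyticOrderAt (fun t => eval (γ t) G) 0 =
      analyticOrderAt (fun t => (aeval φ G).eval t) (τ 0) := by
  -- If `τ` were stationary, the velocity of `γ` would be proportional to `γ 0`, against immersion.
  -- So `τ` is a local coordinate change and preserves orders, while the power of `μ` is a unit.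
  have hτ' : deriv τ 0 ≠ 0 := by
    intro h0
    have hd : HasDerivAt (fun t => μ t • fun i => (φ i).eval (τ t))
        (μ 0 • (0 : Fin 3 → ℂ) + deriv μ 0 • fun i => (φ i).eval (τ 0)) 0 := by
      refine hμ.differentiableAt.hasDerivAt.smul (hasDerivAt_pi.2 fun i => ?_)
      have := ((φ i).hasDerivAt (τ 0)).comp 0 hτ.differentiableAt.hasDerivAt
      rw [h0, mul_zero] at this
      exact this
    have hγ' : deriv γ 0 = deriv μ 0 • fun i => (φ i).eval (τ 0) := by
      rw [Filter.EventuallyEq.deriv_eq h, hd.deriv]; simp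
    rw [LinearIndependent.pair_iff] at hγ
    have := hγ (deriv μ 0) (-μ 0) (by
      rw [hγ', h.self_of_nhds, smul_smul, smul_smul, ← add_smul]; ring_nf; simp)
    exact hμ0 (neg_eq_zero.1 this.2)
  have hPa : AnalyticAt ℂ (fun t => (aeval φ G).eval t) (τ 0) :=
    (aeval φ G).differentiable.analyticAt _
  have hcongr : (fun t => eval (γ t) G) =ᶠ[𝓝 0]
      (μ ^ n) * ((fun t => (aeval φ G).eval t) ∘ τ) := by
    filter_upwards [h] with t ht
    rw [ht, eval_smul_of_isHomogeneous hG]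
    simp [eval_aeval_polynomial]
  rw [analyticOrderAt_congr hcongr, analyticOrderAt_mul (hμ.pow n) (hPa.comp hτ),
    analyticOrderAt_comp_of_deriv_ne_zero hτ hτ', ((hμ.pow n).analyticOrderAt_eq_zero).2, zero_add]
  exact pow_ne_zero _ hμ0

/-! ### Normal forms of singular cubics -/

/-- The nodal cubic `x y z = x ^ 3 - y ^ 3`. -/
noncomputable def nodalForm : Form := X 0 * X 1 * X 2 - X 0 ^ 3 + X 1 ^ 3

/-- The cuspidal cubic `x ^ 2 z = y ^ 3`. -/
noncomputable def cuspForm : Form := X 0 ^ 2 * X 2 - X 1 ^ 3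

theorem mulVec_three (a b c d e f g h i : ℂ) (v : Fin 3 → ℂ) :
    (!![a, b, c; d, e, f; g, h, i]).mulVec v =
      ![a * v 0 + b * v 1 + c * v 2, d * v 0 + e * v 1 + f * v 2, g * v 0 + h * v 1 + i * v 2] := by
  ext j
  fin_cases j <;> simp [Matrix.mulVec, dotProduct, Fin.sum_univ_three]

/-- The second form arises from the first by an invertible linear substitution. -/
def LinearlyEquivalent (F G : Form) : Prop :=
  ∃ A : Matrix.GeneralLinearGroup (Fin 3) ℂ, substitute (A : Matrix (Fin 3) (Fin 3) ℂ) F = G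

theorem LinearlyEquivalent.trans {F G H : Form} (h₁ : LinearlyEquivalent F G)
    (h₂ : LinearlyEquivalent G H) : LinearlyEquivalent F H := by
  obtain ⟨A, rfl⟩ := h₁
  obtain ⟨B, rfl⟩ := h₂
  exact ⟨A * B, by rw [substitute_substitute, Units.val_mul]⟩

theorem LinearlyEquivalent.refl (F : Form) : LinearlyEquivalent F F := ⟨1, by simp⟩

theorem LinearlyEquivalent.of_det {F G : Form} (A : Matrix (Fin 3) (Fin 3) ℂ) (hA : A.det ≠ 0)
    (h : ∀ v, eval (A.mulVec v) F = eval v G) : LinearlyEquivalent F G :=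
  ⟨Matrix.GeneralLinearGroup.mkOfDetNeZero A hA, MvPolynomial.funext fun v => by
    simpa using h v⟩

theorem LinearlyEquivalent.isIrreducibleCubic {F G : Form} (h : LinearlyEquivalent F G)
    (hF : IsIrreducibleCubic F) : IsIrreducibleCubic G := by
  obtain ⟨A, rfl⟩ := h
  exact hF.substitute A

theorem exists_mulVec_eq {v : Fin 3 → ℂ} (hv : v ≠ 0) :
    ∃ A : Matrix (Fin 3) (Fin 3) ℂ, A.det ≠ 0 ∧ A.mulVec ![0, 0, 1] = v := by
  obtain ⟨i, hi⟩ := Function.ne_iff.1 hv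
  fin_cases i
  · refine ⟨!![0, 0, v 0; 0, 1, v 1; 1, 0, v 2], by simpa [Matrix.det_fin_three] using hi, ?_⟩
    rw [mulVec_three]; ext j; fin_cases j <;> simp
  · refine ⟨!![1, 0, v 0; 0, 0, v 1; 0, 1, v 2], by simpa [Matrix.det_fin_three] using hi, ?_⟩
    rw [mulVec_three]; ext j; fin_cases j <;> simp
  · refine ⟨!![1, 0, v 0; 0, 1, v 1; 0, 0, v 2], by simpa [Matrix.det_fin_three] using hi, ?_⟩
    rw [mulVec_three]; ext j; fin_cases j <;> simp

theorem exists_cubic_root (a b c : ℂ) {d : ℂ} (hd : d ≠ 0) :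
    ∃ y : ℂ, a + b * y + c * y ^ 2 + d * y ^ 3 = 0 := by
  have := IsAlgClosed.exists_root (Polynomial.C d * Polynomial.X ^ 3 + Polynomial.C c *
    Polynomial.X ^ 2 + Polynomial.C b * Polynomial.X + Polynomial.C a)
    (by rw [Polynomial.degree_cubic hd]; decide)
  obtain ⟨y, hy⟩ := this
  refine ⟨y, ?_⟩
  simp only [Polynomial.IsRoot, Polynomial.eval_add, Polynomial.eval_mul, Polynomial.eval_C,
    Polynomial.eval_pow, Polynomial.eval_X] at hy
  linear_combination hy

theorem exists_quadratic_root (a b : ℂ) {c : ℂ} (hc : c ≠ 0) :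
    ∃ y : ℂ, a + b * y + c * y ^ 2 = 0 := by
  have := IsAlgClosed.exists_root (Polynomial.C c *
    Polynomial.X ^ 2 + Polynomial.C b * Polynomial.X + Polynomial.C a)
    (by rw [Polynomial.degree_quadratic hc]; decide)
  obtain ⟨y, hy⟩ := this
  refine ⟨y, ?_⟩
  simp only [Polynomial.IsRoot, Polynomial.eval_add, Polynomial.eval_mul, Polynomial.eval_C,
    Polynomial.eval_pow, Polynomial.eval_X] at hy
  linear_combination hy

/-- Once the singular point is at (0, 0, 1), the gradient there consists of the coefficients of xz²,
yz² and, up to the factor 3, z³. -/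
theorem IsSingularCubic.exists_cubicForm {D : Form} (h : IsSingularCubic D) :
    ∃ a, LinearlyEquivalent D (cubicForm a) ∧ a 0 0 = 0 ∧ a 1 0 = 0 ∧ a 0 1 = 0 := by
  obtain ⟨hD, p, hp0, hp⟩ := h
  obtain ⟨A, hA, hAp⟩ := exists_mulVec_eq p.rep_nonzero
  obtain ⟨a, ha⟩ := PlaneCubics.exists_cubicForm (isHomogeneous_substitute A hD.1)
  have hg : ∀ i, eval ![0, 0, 1] (pderiv i (cubicForm a)) = 0 := fun i => by
    rw [← ha]
    exact not_isSmoothVector_substitute (by rwa [hAp]) i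
  refine ⟨a, ⟨Matrix.GeneralLinearGroup.mkOfDetNeZero A hA, ha⟩, ?_, ?_, ?_⟩
  · simpa [cubicForm, pderiv_X] using hg 2
  · simpa [cubicForm, pderiv_X] using hg 0
  · simpa [cubicForm, pderiv_X] using hg 1

/-- The quadratic part at the double point splits over ℂ, so one tangent direction can be moved to x
= 0. The quadratic part cannot vanish: the cubic would be a binary form in x and y, which has a
linear factor. -/
theorem IsSingularCubic.exists_root_at_infinity {D : Form} (h : IsSingularCubic D) :
    ∃ q r e f g k : ℂ, (q ≠ 0 ∨ r ≠ 0) ∧ LinearlyEquivalent D (X 2 * X 0 * (C q * X 0 + C r * X 1)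
      + C e * X 0 ^ 3 + C f * X 0 ^ 2 * X 1 + C g * X 0 * X 1 ^ 2 + C k * X 1 ^ 3) := by
  obtain ⟨a, haD, h00, h10, h01⟩ := h.exists_cubicForm
  have hirr : ∀ G : Form, LinearlyEquivalent (cubicForm a) (X 0 * G) → eval 0 G = 0 → False :=
    fun G hG hG0 => not_irreducible_mul (by simp) hG0
      ((haD.trans hG).isIrreducibleCubic h.1).2
  by_cases h02 : a 0 2 = 0
  · by_cases hq : a 2 0 ≠ 0 ∨ a 1 1 ≠ 0
    · refine ⟨a 2 0, a 1 1, a 3 0, a 2 1, a 1 2, a 0 3, hq, ?_⟩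
      convert haD using 1
      rw [cubicForm, h00, h10, h01, h02]
      simp only [map_zero]; ring
    push Not at hq
    exfalso
    by_cases h03 : a 0 3 = 0
    · refine hirr (C (a 3 0) * X 0 ^ 2 + C (a 2 1) * X 0 * X 1 + C (a 1 2) * X 1 ^ 2) ?_ (by simp)
      convert LinearlyEquivalent.refl _ using 1
      rw [cubicForm, h00, h10, h01, h02, h03, hq.1, hq.2]
      simp only [map_zero]; ring
    · obtain ⟨y, hy⟩ := exists_cubic_root (a 3 0) (a 2 1) (a 1 2) h03
      refine hirr (C (a 2 1 + 2 * a 1 2 * y + 3 * a 0 3 * y ^ 2) * X 1 ^ 2 +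
        C (a 1 2 + 3 * a 0 3 * y) * X 0 * X 1 + C (a 0 3) * X 0 ^ 2) ?_ (by simp)
      refine .of_det !![0, 1, 0; 1, y, 0; 0, 0, 1] (by simp [Matrix.det_fin_three]) fun v => ?_
      rw [mulVec_three]
      simp [cubicForm, h00, h10, h01, h02, hq.1, hq.2]
      linear_combination v 1 ^ 3 * hy
  -- The substitution (x, y) ↦ (y, x + ηy), with η the root found here, turns the coefficient of y²
  -- in the quadratic part into the vanishing value at η.
  · obtain ⟨y, hy⟩ := exists_quadratic_root (a 2 0) (a 1 1) h02
    refine ⟨a 0 2, a 1 1 + 2 * a 0 2 * y, a 0 3, a 1 2 + 3 * a 0 3 * y,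
      a 2 1 + 2 * a 1 2 * y + 3 * a 0 3 * y ^ 2, a 3 0 + a 2 1 * y + a 1 2 * y ^ 2 + a 0 3 * y ^ 3,
      Or.inl h02, haD.trans ?_⟩
    refine .of_det !![0, 1, 0; 1, y, 0; 0, 0, 1] (by simp [Matrix.det_fin_three]) fun v => ?_
    rw [mulVec_three]
    simp [cubicForm, h00, h10, h01]
    linear_combination v 1 ^ 2 * v 2 * hy

theorem exists_cube_root (a : ℂ) : ∃ b : ℂ, b ^ 3 = a :=
  IsAlgClosed.exists_pow_nat_eq a (by norm_num)

/-- Here the two tangents at the double point are distinct. They become the lines x = 0 and y = 0, a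
shift of z absorbs the mixed cubic terms, and irreducibility keeps the two pure cubes, which are
normalized by scaling. -/
theorem exists_nodalForm {D : Form} (hD : IsIrreducibleCubic D) {q r e f g k : ℂ} (hr : r ≠ 0)
    (h : LinearlyEquivalent D (X 2 * X 0 * (C q * X 0 + C r * X 1)
      + C e * X 0 ^ 3 + C f * X 0 ^ 2 * X 1 + C g * X 0 * X 1 ^ 2 + C k * X 1 ^ 3)) :
    LinearlyEquivalent D nodalForm := by
  have h₁ : ∃ e f g k : ℂ, LinearlyEquivalent D (X 0 * X 1 * X 2
      + C e * X 0 ^ 3 + C f * X 0 ^ 2 * X 1 + C g * X 0 * X 1 ^ 2 + C k * X 1 ^ 3) := by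
    refine ⟨e - f * q / r + g * q ^ 2 / r ^ 2 - k * q ^ 3 / r ^ 3,
      f / r - 2 * g * q / r ^ 2 + 3 * k * q ^ 2 / r ^ 3, g / r ^ 2 - 3 * k * q / r ^ 3, k / r ^ 3,
      h.trans (.of_det !![1, 0, 0; -q / r, 1 / r, 0; 0, 0, 1]
        (by simp [Matrix.det_fin_three, hr]) fun v => ?_)⟩
    rw [mulVec_three]
    simp
    field_simp
    ring
  clear h
  obtain ⟨e, f, g, k, h⟩ := h₁
  have h₂ : LinearlyEquivalent D (X 0 * X 1 * X 2 + C e * X 0 ^ 3 + C k * X 1 ^ 3) := by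
    refine h.trans (.of_det !![1, 0, 0; 0, 1, 0; -f, -g, 1]
        (by simp [Matrix.det_fin_three]) fun v => ?_)
    rw [mulVec_three]
    simp
    ring
  have hirr := (h₂.isIrreducibleCubic hD).2
  have he : e ≠ 0 := by
    rintro rfl
    refine not_irreducible_mul (F := X 1) (G := X 0 * X 2 + C k * X 1 ^ 2) (by simp) (by simp) ?_
    convert hirr using 1
    simp only [map_zero]; ring
  have hk : k ≠ 0 := by
    rintro rfl
    refine not_irreducible_mul (F := X 0) (G := X 1 * X 2 + C e * X 0 ^ 2) (by simp) (by simp) ?_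
    convert hirr using 1
    simp only [map_zero]; ring
  -- Chosen so that eα³ = -1 and kβ³ = 1; scaling z by 1/(αβ) keeps the coefficient of xyz equal to
  -- 1.
  obtain ⟨α, hα⟩ := exists_cube_root (-1 / e)
  obtain ⟨β, hβ⟩ := exists_cube_root (1 / k)
  have hα0 : α ≠ 0 := by
    rintro rfl
    rw [zero_pow three_ne_zero] at hα
    exact div_ne_zero (by norm_num) he hα.symm
  have hβ0 : β ≠ 0 := by
    rintro rfl
    rw [zero_pow three_ne_zero] at hβ
    exact div_ne_zero (by norm_num) hk hβ.symm
  refine h₂.trans (.of_det !![α, 0, 0; 0, β, 0; 0, 0, 1 / (α * β)]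
        (by simp [Matrix.det_fin_three, hα0, hβ0]) fun v => ?_)
  rw [mulVec_three]
  simp [nodalForm]
  rw [mul_pow, mul_pow, hα, hβ]
  field_simp
  ring

/-- Here the tangents at the double point coincide. Completing the cube in y removes xy², and a
shift of z absorbs the other two terms divisible by x². -/
theorem exists_cuspForm {D : Form} (hD : IsIrreducibleCubic D) {q e f g k : ℂ} (hq : q ≠ 0)
    (h : LinearlyEquivalent D (X 2 * X 0 * (C q * X 0 + C 0 * X 1)
      + C e * X 0 ^ 3 + C f * X 0 ^ 2 * X 1 + C g * X 0 * X 1 ^ 2 + C k * X 1 ^ 3)) :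
    LinearlyEquivalent D cuspForm := by
  have hk : k ≠ 0 := by
    rintro rfl
    refine not_irreducible_mul (F := X 0) (G := C q * X 0 * X 2 + C e * X 0 ^ 2 +
      C f * X 0 * X 1 + C g * X 1 ^ 2) (by simp) (by simp) ?_
    convert (h.isIrreducibleCubic hD).2 using 1
    simp only [map_zero]; ring
  obtain ⟨β, hβ⟩ := exists_cube_root (-1 / k)
  have hβ0 : β ≠ 0 := by
    rintro rfl
    rw [zero_pow three_ne_zero] at hβ
    exact div_ne_zero (by norm_num) hk hβ.symm
  have h₂ : ∃ e f : ℂ,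
      LinearlyEquivalent D (X 0 ^ 2 * X 2 + C e * X 0 ^ 3 + C f * X 0 ^ 2 * X 1 - X 1 ^ 3) := by
    refine ⟨e - f * (g / (3 * k)) + g * (g / (3 * k)) ^ 2 - k * (g / (3 * k)) ^ 3,
      f * β - 2 * g * (g / (3 * k)) * β + 3 * k * (g / (3 * k)) ^ 2 * β,
      h.trans (.of_det !![1, 0, 0; -g / (3 * k), β, 0; 0, 0, 1 / q]
        (by simp [Matrix.det_fin_three, hq, hβ0]) fun v => ?_)⟩
    have hβ' : k * β ^ 3 = -1 := by rw [hβ]; field_simp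
    have hg : g = 3 * k * (g / (3 * k)) := by field_simp
    have hg' : -g / (3 * k) = -(g / (3 * k)) := by ring
    rw [mulVec_three, hg']
    generalize g / (3 * k) = u at *
    subst hg
    simp
    field_simp
    linear_combination v 1 ^ 3 * hβ'
  obtain ⟨e, f, h₂⟩ := h₂
  refine h₂.trans (.of_det !![1, 0, 0; 0, 1, 0; -e, -f, 1]
        (by simp [Matrix.det_fin_three]) fun v => ?_)
  rw [mulVec_three]
  simp [cuspForm]
  ring

theorem IsSingularCubic.linearlyEquivalent {D : Form} (h : IsSingularCubic D) :
    LinearlyEquivalent D nodalForm ∨ LinearlyEquivalent D cuspForm := by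
  obtain ⟨q, r, e, f, g, k, hqr, hD⟩ := h.exists_root_at_infinity
  by_cases hr : r = 0
  · subst hr
    exact Or.inr (exists_cuspForm h.1 (by simpa using hqr) hD)
  · exact Or.inl (exists_nodalForm h.1 hr hD)

/-! ### Parametrizations of the normal forms -/

/-- The parametrization `(t ^ 2, t, t ^ 3 - 1)` of the nodal cubic. -/
noncomputable def nodalParam : Fin 3 → Polynomial ℂ :=
  ![Polynomial.X ^ 2, Polynomial.X, Polynomial.X ^ 3 - 1]

/-- The parametrization `(1, t, t ^ 3)` of the cuspidal cubic. -/
noncomputable def cuspParam : Fin 3 → Polynomial ℂ := ![1, Polynomial.X, Polynomial.X ^ 3]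

/-- The values of a polynomial parametrization. -/
noncomputable def paramAt (φ : Fin 3 → Polynomial ℂ) (t : ℂ) : Fin 3 → ℂ := fun i => (φ i).eval t

theorem nodalParam_apply (t : ℂ) : paramAt nodalParam t = ![t ^ 2, t, t ^ 3 - 1] := by
  ext i; fin_cases i <;> simp [nodalParam, paramAt]

theorem cuspParam_apply (t : ℂ) : paramAt cuspParam t = ![1, t, t ^ 3] := by
  ext i; fin_cases i <;> simp [cuspParam, paramAt]

theorem eval_aeval_param (φ : Fin 3 → Polynomial ℂ) (G : Form) (t : ℂ) :
    (aeval φ G).eval t = eval (paramAt φ t) G := eval_aeval_polynomial φ G t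

/-- An arc through a point of a parametrized curve, seen on the parameter line: it starts at a
multiple of the point with parameter `t`, and the contact order with any other curve is the order
of vanishing at `t` of the equation of that curve. -/
def HasParameter (φ : Fin 3 → Polynomial ℂ) (γ : ℂ → Fin 3 → ℂ) (t : ℂ) : Prop :=
  (∃ c : ℂ, c ≠ 0 ∧ γ 0 = c • paramAt φ t) ∧
    ∀ (G : Form) (n : ℕ), G.IsHomogeneous n →
      analyticOrderAt (fun s => eval (γ s) G) 0 = analyticOrderAt (fun s => (aeval φ G).eval s) t

theorem IsArc.hasParameter {F : Form} {φ : Fin 3 → Polynomial ℂ} {γ : ℂ → Fin 3 → ℂ}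
    (h : IsArc F γ) {μ τ : ℂ → ℂ} (hμ : AnalyticAt ℂ μ 0) (hτ : AnalyticAt ℂ τ 0)
    (hμ0 : μ 0 ≠ 0) (hγ : ∀ᶠ t in 𝓝 (0 : ℂ), γ t = μ t • paramAt φ (τ t)) :
    HasParameter φ γ (τ 0) :=
  ⟨⟨μ 0, hμ0, hγ.self_of_nhds⟩, fun _ _ hG => analyticOrderAt_eval_arc hG φ hμ hτ hμ0 h.2.1 hγ⟩

theorem IsArc.analyticAt_apply {F : Form} {γ : ℂ → Fin 3 → ℂ} (h : IsArc F γ) (i : Fin 3) :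
    AnalyticAt ℂ (fun t => γ t i) 0 := (analyticAt_pi_iff.1 h.1) i

theorem eventually_apply_ne_zero {γ : ℂ → Fin 3 → ℂ} {i : Fin 3}
    (h : AnalyticAt ℂ (fun t => γ t i) 0) (h0 : γ 0 i ≠ 0) : ∀ᶠ t in 𝓝 (0 : ℂ), γ t i ≠ 0 :=
  h.continuousAt.eventually_ne h0

/-- On this cubic xy = 0 only at the node, so at a smooth point the parameter is x / y and the
scalar factor is y² / x. -/
theorem IsArc.exists_nodalParam {γ : ℂ → Fin 3 → ℂ} (h : IsArc nodalForm γ)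
    (hs : IsSmoothVector nodalForm (γ 0)) : ∃ t, t ≠ 0 ∧ HasParameter nodalParam γ t := by
  have hxy : γ 0 0 ≠ 0 ∧ γ 0 1 ≠ 0 := by
    obtain ⟨h0, i, hi⟩ := hs
    simp only [nodalForm, map_add, map_sub, map_mul, map_pow, eval_X] at h0
    constructor <;> intro hz
    · have : γ 0 1 = 0 := by simpa [hz] using h0
      fin_cases i <;> simp [nodalForm, pderiv_X, hz, this] at hi
    · have : γ 0 0 = 0 := by simpa [hz] using h0
      fin_cases i <;> simp [nodalForm, pderiv_X, hz, this] at hi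
  have a0 := h.analyticAt_apply 0
  have a1 := h.analyticAt_apply 1
  have hτ : AnalyticAt ℂ (fun t => γ t 0 / γ t 1) 0 := a0.div a1 hxy.2
  have hμ : AnalyticAt ℂ (fun t => γ t 1 ^ 2 / γ t 0) 0 := (a1.pow 2).div a0 hxy.1
  refine ⟨_, div_ne_zero hxy.1 hxy.2, h.hasParameter hμ hτ
    (div_ne_zero (pow_ne_zero _ hxy.2) hxy.1) ?_⟩
  filter_upwards [h.2.2, eventually_apply_ne_zero a0 hxy.1, eventually_apply_ne_zero a1 hxy.2]
    with t ht h0 h1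
  simp only [nodalForm, map_add, map_sub, map_mul, map_pow, eval_X] at ht
  rw [nodalParam_apply]
  ext i
  fin_cases i
  · simp; field_simp
  · simp; field_simp
  · simp; field_simp; linear_combination ht

/-- On this cubic x = 0 only at the cusp; elsewhere the parameter is y / x and the scalar factor is
x. -/
theorem IsArc.exists_cuspParam {γ : ℂ → Fin 3 → ℂ} (h : IsArc cuspForm γ)
    (hs : IsSmoothVector cuspForm (γ 0)) : ∃ t, HasParameter cuspParam γ t := by
  have hx : γ 0 0 ≠ 0 := by
    obtain ⟨h0, i, hi⟩ := hs
    simp only [cuspForm, map_sub, map_mul, map_pow, eval_X] at h0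
    intro hz
    have : γ 0 1 = 0 := by simpa [hz] using h0
    fin_cases i <;> simp [cuspForm, pderiv_X, hz, this] at hi
  have a0 := h.analyticAt_apply 0
  have a1 := h.analyticAt_apply 1
  have hτ : AnalyticAt ℂ (fun t => γ t 1 / γ t 0) 0 := a1.div a0 hx
  refine ⟨_, h.hasParameter a0 hτ hx ?_⟩
  filter_upwards [h.2.2, eventually_apply_ne_zero a0 hx] with t ht h0
  simp only [cuspForm, map_sub, map_mul, map_pow, eval_X] at ht
  rw [cuspParam_apply]
  ext i
  fin_cases i
  · simp
  · simp; field_simp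
  · simp; field_simp; linear_combination ht

theorem HasParameter.pow_dvd {φ : Fin 3 → Polynomial ℂ} {γ : ℂ → Fin 3 → ℂ} {t : ℂ}
    (h : HasParameter φ γ t) {G : Form} {d n : ℕ} (hG : G.IsHomogeneous d)
    (hn : analyticOrderAt (fun s => eval (γ s) G) 0 = n) :
    (Polynomial.X - Polynomial.C t) ^ n ∣ aeval φ G :=
  pow_dvd_of_le_analyticOrderAt (by rw [← h.2 G d hG, hn])

theorem HasParameter.aeval_ne_zero {φ : Fin 3 → Polynomial ℂ} {γ : ℂ → Fin 3 → ℂ} {t : ℂ}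
    (h : HasParameter φ γ t) {G : Form} {d n : ℕ} (hG : G.IsHomogeneous d)
    (hn : analyticOrderAt (fun s => eval (γ s) G) 0 = n) : aeval φ G ≠ 0 := by
  intro h0
  have := h.2 G d hG
  rw [hn, h0] at this
  have h' : analyticOrderAt (fun s => Polynomial.eval s (0 : Polynomial ℂ)) t = ⊤ := by
    rw [analyticOrderAt_eq_top]; simp
  rw [h'] at this
  exact ENat.natCast_ne_top n this

/-! ### Cubics along the parametrizations -/

theorem aeval_nodalParam_cubicForm (a : ℕ → ℕ → ℂ) :
    aeval nodalParam (cubicForm a) = Polynomial.C (a 0 0) * Polynomial.X ^ 9 +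
      Polynomial.C (a 1 0) * Polynomial.X ^ 8 + Polynomial.C (a 2 0 + a 0 1) * Polynomial.X ^ 7 +
      Polynomial.C (a 3 0 + a 1 1 - 3 * a 0 0) * Polynomial.X ^ 6 +
      Polynomial.C (a 2 1 + a 0 2 - 2 * a 1 0) * Polynomial.X ^ 5 +
      Polynomial.C (a 1 2 - a 2 0 - 2 * a 0 1) * Polynomial.X ^ 4 +
      Polynomial.C (a 0 3 - a 1 1 + 3 * a 0 0) * Polynomial.X ^ 3 +
      Polynomial.C (a 1 0 - a 0 2) * Polynomial.X ^ 2 +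
      Polynomial.C (a 0 1) * Polynomial.X + Polynomial.C (-a 0 0) := by
  simp only [cubicForm, map_add, map_mul, map_pow, aeval_C, aeval_X, nodalParam,
    Polynomial.algebraMap_eq, map_sub, map_neg]
  simp only [Matrix.cons_val, map_ofNat]
  ring

theorem aeval_cuspParam_cubicForm (a : ℕ → ℕ → ℂ) :
    aeval cuspParam (cubicForm a) = Polynomial.C (a 0 0) * Polynomial.X ^ 9 +
      Polynomial.C (a 0 1) * Polynomial.X ^ 7 + Polynomial.C (a 1 0) * Polynomial.X ^ 6 +
      Polynomial.C (a 0 2) * Polynomial.X ^ 5 + Polynomial.C (a 1 1) * Polynomial.X ^ 4 +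
      Polynomial.C (a 0 3 + a 2 0) * Polynomial.X ^ 3 + Polynomial.C (a 1 2) * Polynomial.X ^ 2 +
      Polynomial.C (a 2 1) * Polynomial.X + Polynomial.C (a 3 0) := by
  simp only [cubicForm, map_add, map_mul, map_pow, aeval_C, aeval_X, cuspParam,
    Polynomial.algebraMap_eq]
  simp only [Matrix.cons_val]
  ring

/-- The multiplicative group law: when the pullback has degree nine, its nine roots have product 1.
-/
theorem coeff_aeval_nodalParam {G : Form} (hG : G.IsHomogeneous 3) :
    (aeval nodalParam G).natDegree ≤ 9 ∧
      (aeval nodalParam G).coeff 0 = -(aeval nodalParam G).coeff 9 := by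
  obtain ⟨a, rfl⟩ := exists_cubicForm hG
  rw [aeval_nodalParam_cubicForm]
  constructor
  · compute_degree
  · simp only [Polynomial.coeff_add, Polynomial.coeff_C_mul, Polynomial.coeff_X_pow,
      Polynomial.coeff_X, Polynomial.coeff_C]
    norm_num

/-- The additive group law: when the pullback has degree nine, its nine roots have sum 0. -/
theorem coeff_aeval_cuspParam {G : Form} (hG : G.IsHomogeneous 3) :
    (aeval cuspParam G).natDegree ≤ 9 ∧ (aeval cuspParam G).coeff 8 = 0 := by
  obtain ⟨a, rfl⟩ := exists_cubicForm hG
  rw [aeval_cuspParam_cubicForm]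
  constructor
  · compute_degree
  · simp only [Polynomial.coeff_add, Polynomial.coeff_C_mul, Polynomial.coeff_X_pow,
      Polynomial.coeff_X, Polynomial.coeff_C]
    norm_num

theorem exists_eq_mul_nodalForm {G : Form} (hG : G.IsHomogeneous 3)
    (h : aeval nodalParam G = 0) : ∃ c, G = C c * nodalForm := by
  obtain ⟨a, rfl⟩ := exists_cubicForm hG
  rw [aeval_nodalParam_cubicForm] at h
  have hc : ∀ n, _ := fun n => congrArg (fun P => Polynomial.coeff P n) h
  have h9 := hc 9
  have h8 := hc 8
  have h7 := hc 7
  have h6 := hc 6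
  have h5 := hc 5
  have h4 := hc 4
  have h3 := hc 3
  have h2 := hc 2
  have h1 := hc 1
  clear hc h
  simp only [Polynomial.coeff_add, Polynomial.coeff_C_mul, Polynomial.coeff_X_pow,
    Polynomial.coeff_X, Polynomial.coeff_C] at h1 h2 h3 h4 h5 h6 h7 h8 h9
  norm_num at h1 h2 h3 h4 h5 h6 h7 h8 h9
  have e02 : a 0 2 = 0 := by linear_combination h8 - h2
  have e20 : a 2 0 = 0 := by linear_combination h7 - h1
  have e12 : a 1 2 = 0 := by linear_combination h4 + e20 + 2 * h1
  have e21 : a 2 1 = 0 := by linear_combination h5 - e02 + 2 * h8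
  have e30 : a 3 0 = -a 1 1 := by linear_combination h6 + 3 * h9
  have e03 : a 0 3 = a 1 1 := by linear_combination h3 - 3 * h9
  refine ⟨a 1 1, ?_⟩
  rw [cubicForm, nodalForm, h1, e02, e20, e12, e21, e30, e03, h9, h8]
  simp only [map_zero, map_neg]
  ring

theorem exists_eq_mul_cuspForm {G : Form} (hG : G.IsHomogeneous 3)
    (h : aeval cuspParam G = 0) : ∃ c, G = C c * cuspForm := by
  obtain ⟨a, rfl⟩ := exists_cubicForm hG
  rw [aeval_cuspParam_cubicForm] at h
  have hc : ∀ n, _ := fun n => congrArg (fun P => Polynomial.coeff P n) h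
  have h9 := hc 9
  have h7 := hc 7
  have h6 := hc 6
  have h5 := hc 5
  have h4 := hc 4
  have h3 := hc 3
  have h2 := hc 2
  have h1 := hc 1
  have h0 := hc 0
  clear hc h
  simp only [Polynomial.coeff_add, Polynomial.coeff_C_mul, Polynomial.coeff_X_pow,
    Polynomial.coeff_X, Polynomial.coeff_C] at h0 h1 h2 h3 h4 h5 h6 h7 h9
  norm_num at h0 h1 h2 h3 h4 h5 h6 h7 h9
  have e03 : a 0 3 = -a 2 0 := by linear_combination h3
  refine ⟨a 2 0, ?_⟩
  rw [cubicForm, cuspForm, e03, h0, h1, h2, h4, h5, h6, h7, h9]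
  simp only [map_zero, map_neg]
  ring

/-- Applied with `M` of degree nine: contact orders adding up to nine determine the pullback up to a
scalar. -/
theorem exists_eq_C_mul_of_monic_dvd {M P : Polynomial ℂ} (hM : M.Monic) (h : M ∣ P) (hP : P ≠ 0)
    (hd : P.natDegree ≤ M.natDegree) : ∃ k : ℂ, k ≠ 0 ∧ P = Polynomial.C k * M := by
  obtain ⟨Q, rfl⟩ := h
  have hQ : Q ≠ 0 := right_ne_zero_of_mul hP
  rw [hM.natDegree_mul' hQ] at hd
  have hQ0 : Q.natDegree = 0 := by omega
  rw [Polynomial.eq_C_of_natDegree_eq_zero hQ0] at hQ ⊢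
  exact ⟨Q.coeff 0, by simpa using hQ, mul_comm _ _⟩

/-! ### Tangent lines and second order contact -/

/-- The linear form given by the gradient of `F` at `v`. -/
noncomputable def gradientForm (F : Form) (v : Fin 3 → ℂ) : Form :=
  ∑ i, C (eval v (pderiv i F)) * X i

theorem tangentForm_eq (F : Form) (p : Plane) : tangentForm F p = gradientForm F p.rep := rfl

theorem eval_gradientForm (F : Form) (v w : Fin 3 → ℂ) :
    eval w (gradientForm F v) = ∑ i, eval v (pderiv i F) * w i := by
  simp [gradientForm]

theorem pderiv_gradientForm (F : Form) (v : Fin 3 → ℂ) (i : Fin 3) :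
    pderiv i (gradientForm F v) = C (eval v (pderiv i F)) := by
  fin_cases i <;> simp [gradientForm, Fin.sum_univ_three, pderiv_X]

theorem isHomogeneous_gradientForm (F : Form) (v : Fin 3 → ℂ) :
    (gradientForm F v).IsHomogeneous 1 :=
  IsHomogeneous.sum _ _ _ fun _ _ => isHomogeneous_C_mul_X _ _

theorem substitute_gradientForm (A : Matrix (Fin 3) (Fin 3) ℂ) (F : Form) (v : Fin 3 → ℂ) :
    substitute A (gradientForm F (A.mulVec v)) = gradientForm (substitute A F) v := by
  refine MvPolynomial.funext fun w => ?_
  simp only [eval_substitute, eval_gradientForm, eval_pderiv_substitute, Fin.sum_univ_three,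
    Matrix.mulVec, dotProduct]
  ring

theorem sum_eval_pderiv_mul {F : Form} {n : ℕ} (hF : F.IsHomogeneous n) (v : Fin 3 → ℂ) :
    ∑ i, eval v (pderiv i F) * v i = n * eval v F := by
  have := congrArg (eval v) hF.sum_X_mul_pderiv
  simpa [mul_comm] using this

theorem pderiv_comm (i j : Fin 3) (F : Form) : pderiv i (pderiv j F) = pderiv j (pderiv i F) := by
  induction F using MvPolynomial.induction_on with
  | C a => simp
  | add p q hp hq => simp [hp, hq]
  | mul_X p k hp =>
    have hX : ∀ i : Fin 3, ∃ c : ℂ, pderiv i (X k : Form) = C c := fun i => by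
      rw [pderiv_X, Pi.single_apply]
      split_ifs
      exacts [⟨1, by simp⟩, ⟨0, by simp⟩]
    obtain ⟨c, hc⟩ := hX i
    obtain ⟨d, hd⟩ := hX j
    simp only [pderiv_mul, map_add, hc, hd, pderiv_C, hp]
    ring

theorem hasDerivAt_eval {γ : ℂ → Fin 3 → ℂ} {w : Fin 3 → ℂ} {t : ℂ} (h : HasDerivAt γ w t)
    (F : Form) :
    HasDerivAt (fun s => eval (γ s) F) (∑ i, eval (γ t) (pderiv i F) * w i) t := by
  induction F using MvPolynomial.induction_on with
  | C a => simpa using hasDerivAt_const t a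
  | add p q hp hq =>
    simp only [map_add, add_mul, Finset.sum_add_distrib]
    exact hp.fun_add hq
  | mul_X p j hp =>
    simp only [map_mul, eval_X]
    refine (hp.fun_mul (hasDerivAt_pi.1 h j)).congr_deriv ?_
    simp only [Fin.sum_univ_three, pderiv_mul, map_add, map_mul, eval_X]
    fin_cases j <;> simp [pderiv_X] <;> ring

theorem second_order_of_le_analyticOrderAt {γ : ℂ → Fin 3 → ℂ} (h : AnalyticAt ℂ γ 0) {F : Form}
    (ho : 3 ≤ analyticOrderAt (fun s => eval (γ s) F) 0) :
    ∑ i, eval (γ 0) (pderiv i F) * deriv γ 0 i = 0 ∧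
      ∑ i, ((∑ j, eval (γ 0) (pderiv j (pderiv i F)) * deriv γ 0 j) * deriv γ 0 i +
        eval (γ 0) (pderiv i F) * deriv (deriv γ) 0 i) = 0 := by
  have hd := (natCast_le_analyticOrderAt_iff_iteratedDeriv_eq_zero (n := 3)
    (analyticAt_eval h F)).1 (by exact_mod_cast ho)
  have h1 := hd 1 (by norm_num)
  have h2 := hd 2 (by norm_num)
  have hev : deriv (fun s => eval (γ s) F) =ᶠ[𝓝 0]
      fun s => ∑ i, eval (γ s) (pderiv i F) * deriv γ s i := by
    filter_upwards [h.eventually_analyticAt] with s hs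
    exact (hasDerivAt_eval hs.differentiableAt.hasDerivAt F).deriv
  constructor
  · rw [iteratedDeriv_one] at h1
    exact hev.self_of_nhds.symm.trans h1
  · rw [iteratedDeriv_succ, iteratedDeriv_one, hev.deriv_eq] at h2
    have key : ∀ i, HasDerivAt (fun s => eval (γ s) (pderiv i F) * deriv γ s i)
        ((∑ j, eval (γ 0) (pderiv j (pderiv i F)) * deriv γ 0 j) * deriv γ 0 i +
          eval (γ 0) (pderiv i F) * deriv (deriv γ) 0 i) 0 := fun i =>
      (hasDerivAt_eval h.differentiableAt.hasDerivAt (pderiv i F)).fun_mul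
        (hasDerivAt_pi.1 h.deriv.differentiableAt.hasDerivAt i)
    exact (HasDerivAt.fun_sum fun i _ => key i).deriv.symm.trans h2

/-- At an inflection point of the cubic `G`, the tangent line has contact of order at least three
with every arc that has such a contact with `G`. -/
theorem gradient_apply_of_inflection {G : Form} (hG : G.IsHomogeneous 3) {γ δ : ℂ → Fin 3 → ℂ}
    (hγ : IsArc G γ) (hs : IsSmoothVector G (γ 0))
    (hi : 3 ≤ analyticOrderAt (fun s => eval (γ s) (gradientForm G (γ 0))) 0)
    (hδ : AnalyticAt ℂ δ 0) (h0 : δ 0 = γ 0)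
    (ho : 3 ≤ analyticOrderAt (fun s => eval (δ s) G) 0) :
    ∑ i, eval (γ 0) (pderiv i G) * δ 0 i = 0 ∧
      ∑ i, eval (γ 0) (pderiv i G) * deriv δ 0 i = 0 ∧
        ∑ i, eval (γ 0) (pderiv i G) * deriv (deriv δ) 0 i = 0 := by
  have hv : ∑ i, eval (γ 0) (pderiv i G) * γ 0 i = 0 := by
    rw [sum_eval_pderiv_mul hG, hs.1, mul_zero]
  have hGγ : 3 ≤ analyticOrderAt (fun s => eval (γ s) G) 0 := by
    rw [analyticOrderAt_eq_top.2 hγ.2.2]; exact le_top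
  obtain ⟨a1, a2⟩ := second_order_of_le_analyticOrderAt hγ.1 hGγ
  obtain ⟨-, b2⟩ := second_order_of_le_analyticOrderAt hγ.1 hi
  obtain ⟨c1, c2⟩ := second_order_of_le_analyticOrderAt hδ ho
  rw [h0] at c1 c2 ⊢
  refine ⟨hv, c1, ?_⟩
  -- Euler's relation for the partial derivatives: the Hessian of the cubic sends `γ 0` to twice the
  -- gradient.
  have e1 : ∀ i, ∑ j, eval (γ 0) (pderiv j (pderiv i G)) * γ 0 j = 2 * eval (γ 0) (pderiv i G) :=
    fun i => by simpa using sum_eval_pderiv_mul (hG.pderiv (i := i)) (γ 0)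
  have hli := LinearIndependent.pair_iff.1 hγ.2.1
  obtain ⟨k, hk⟩ := hs.2
  simp only [pderiv_gradientForm, pderiv_C, map_zero, zero_mul, Finset.sum_const_zero,
    zero_add, eval_C] at b2
  -- The gradient annihilates `γ 0` and both velocities, so these three vectors are dependent and
  -- the velocity of `δ` is a combination of `γ 0` and the velocity of `γ`.
  have hdet : (Matrix.of ![γ 0, deriv γ 0, deriv δ 0]).det = 0 := by
    refine Matrix.exists_mulVec_eq_zero_iff.1
      ⟨fun i => eval (γ 0) (pderiv i G), fun h => hk (congrFun h k), ?_⟩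
    ext i
    fin_cases i
    · simpa [Matrix.mulVec, dotProduct, mul_comm] using hv
    · simpa [Matrix.mulVec, dotProduct, mul_comm] using a1
    · simpa [Matrix.mulVec, dotProduct, mul_comm] using c1
  obtain ⟨c, hc, hc0⟩ := Matrix.exists_vecMul_eq_zero_iff.2 hdet
  have hcomb : ∀ i, c 0 * γ 0 i + c 1 * deriv γ 0 i + c 2 * deriv δ 0 i = 0 := fun i => by
    simpa [Matrix.vecMul, dotProduct, Fin.sum_univ_three] using congrFun hc0 i
  have hc2 : c 2 ≠ 0 := by
    intro h2
    obtain ⟨x, y⟩ := hli (c 0) (c 1) (by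
      ext i; simpa [h2] using hcomb i)
    apply hc
    ext i
    fin_cases i
    exacts [x, y, h2]
  have hδ' : ∀ i, deriv δ 0 i = (-c 0 / c 2) * γ 0 i + (-c 1 / c 2) * deriv γ 0 i := fun i => by
    field_simp
    linear_combination hcomb i
  generalize -c 0 / c 2 = α at hδ'
  generalize -c 1 / c 2 = β at hδ'
  generalize deriv δ 0 = w' at *
  have s01 := congrArg (eval (γ 0)) (pderiv_comm 1 0 G)
  have s02 := congrArg (eval (γ 0)) (pderiv_comm 2 0 G)
  have s12 := congrArg (eval (γ 0)) (pderiv_comm 2 1 G)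
  have q0 := e1 0
  have q1 := e1 1
  have q2 := e1 2
  simp only [Fin.sum_univ_three, hδ'] at *
  rw [s01, s02, s12] at *
  -- Expanded in this combination, the Hessian form on the velocity of `δ` is β² times that on the
  -- velocity of `γ`, plus terms that vanish by Euler. The inflection condition makes the latter
  -- zero, so the second-order equation for `δ` leaves only the gradient term.
  linear_combination c2 - β ^ 2 * a2 + β ^ 2 * b2 - α * (α * γ 0 0 + 2 * β * deriv γ 0 0) * q0
    - α * (α * γ 0 1 + 2 * β * deriv γ 0 1) * q1 - α * (α * γ 0 2 + 2 * β * deriv γ 0 2) * q2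
    - 2 * α ^ 2 * hv - 4 * α * β * a1

/-! ### Points of contact on a singular cubic -/

theorem mulVec_mulVec_inv (A : Matrix.GeneralLinearGroup (Fin 3) ℂ) (w : Fin 3 → ℂ) :
    (A : Matrix (Fin 3) (Fin 3) ℂ).mulVec
      (((A⁻¹ : Matrix.GeneralLinearGroup (Fin 3) ℂ) : Matrix (Fin 3) (Fin 3) ℂ).mulVec w) = w := by
  rw [Matrix.mulVec_mulVec, ← Units.val_mul]; simp

theorem eq_of_mulVec_eq (A : Matrix.GeneralLinearGroup (Fin 3) ℂ) {v w : Fin 3 → ℂ}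
    (h : (A : Matrix (Fin 3) (Fin 3) ℂ).mulVec v = (A : Matrix (Fin 3) (Fin 3) ℂ).mulVec w) :
    v = w :=
  Matrix.mulVec_injective_iff_isUnit.2 A.isUnit h

/-- The gradient of `F` vanishes at some nonzero vector. -/
def HasSingularVector (F : Form) : Prop := ∃ v ≠ 0, ∀ i, eval v (pderiv i F) = 0

theorem HasSingularVector.substitute {F : Form} (h : HasSingularVector F)
    (A : Matrix.GeneralLinearGroup (Fin 3) ℂ) :
    HasSingularVector (substitute (A : Matrix (Fin 3) (Fin 3) ℂ) F) := by
  obtain ⟨v, hv, h⟩ := h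
  refine ⟨((A⁻¹ : Matrix.GeneralLinearGroup (Fin 3) ℂ) : Matrix (Fin 3) (Fin 3) ℂ).mulVec v, ?_,
    not_isSmoothVector_substitute (by rwa [mulVec_mulVec_inv])⟩
  intro h0
  have := mulVec_mulVec_inv A v
  rw [h0, Matrix.mulVec_zero] at this
  exact hv this.symm

theorem IsNodalCubic.hasSingularVector {F : Form} (h : IsNodalCubic F) : HasSingularVector F := by
  obtain ⟨-, p, hp, -⟩ := h
  exact ⟨p.rep, p.rep_nonzero, hp.2⟩

theorem aeval_param_derivative (φ : Fin 3 → Polynomial ℂ) (G : Form) (t : ℂ) :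
    (aeval φ G).derivative.eval t =
      ∑ i, eval (paramAt φ t) (pderiv i G) * (φ i).derivative.eval t := by
  have := derivation_aeval (Polynomial.derivative' (R := ℂ)) φ G
  simp only [Polynomial.derivative'_apply] at this
  rw [this, Polynomial.eval_finsetSum]
  simp only [Polynomial.eval_mul, eval_aeval_param]

theorem eval_eq_zero_of_sq_dvd {P : Polynomial ℂ} {t : ℂ}
    (h : (Polynomial.X - Polynomial.C t) ^ 2 ∣ P) : P.eval t = 0 ∧ P.derivative.eval t = 0 := by
  obtain ⟨Q, rfl⟩ := h
  simp [Polynomial.derivative_mul, Polynomial.derivative_pow]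

theorem HasParameter.ne {φ : Fin 3 → Polynomial ℂ} {γ δ : ℂ → Fin 3 → ℂ} {s t : ℂ}
    (h : HasParameter φ γ s) (h' : HasParameter φ δ t) {G : Form} {d : ℕ}
    (hG : G.IsHomogeneous d)
    (hn : analyticOrderAt (fun s => eval (γ s) G) 0 ≠ analyticOrderAt (fun s => eval (δ s) G) 0) :
    s ≠ t := by
  rintro rfl
  rw [h.2 G d hG, h'.2 G d hG] at hn
  exact hn rfl

/-- A linear form `l` vanishing doubly at parameter `t` and simply at `s`. -/
theorem nodal_tangent_relation {l : Fin 3 → ℂ} {s t : ℂ} (hl : ∃ i, l i ≠ 0) (hst : s ≠ t)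
    (h0 : ∑ i, l i * paramAt nodalParam t i = 0)
    (h1 : ∑ i, l i * (nodalParam i).derivative.eval t = 0)
    (h2 : ∑ i, l i * paramAt nodalParam s i = 0) : t ^ 2 * s = 1 := by
  rw [nodalParam_apply] at h0 h2
  simp [Fin.sum_univ_three, nodalParam] at h0 h1 h2
  -- The left side is what remains of the value at `s` after subtracting the first-order Taylor
  -- polynomial at `t`.
  have h3 : (s - t) ^ 2 * (l 2 * (2 * t + s) + l 0) = 0 := by
    linear_combination h2 - h0 - (s - t) * h1
  have h4 : l 2 * (2 * t + s) + l 0 = 0 :=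
    (mul_eq_zero.1 h3).resolve_left (pow_ne_zero _ (sub_ne_zero.2 hst))
  have h5 : l 2 * (t ^ 2 * s - 1) = 0 := by linear_combination h0 - t * h1 + t ^ 2 * h4
  rcases mul_eq_zero.1 h5 with h | h
  · exfalso
    have l0 : l 0 = 0 := by linear_combination h4 - (2 * t + s) * h
    have l1 : l 1 = 0 := by linear_combination h1 - 2 * t * l0 - 3 * t ^ 2 * h
    obtain ⟨i, hi⟩ := hl
    fin_cases i
    exacts [hi l0, hi l1, hi h]
  · linear_combination h

/-- The pullback of a line has no square term on the cuspidal cubic, so the roots t, t, s sum to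
zero. -/
theorem cusp_tangent_relation {l : Fin 3 → ℂ} {s t : ℂ} (hl : ∃ i, l i ≠ 0) (hst : s ≠ t)
    (h0 : ∑ i, l i * paramAt cuspParam t i = 0)
    (h1 : ∑ i, l i * (cuspParam i).derivative.eval t = 0)
    (h2 : ∑ i, l i * paramAt cuspParam s i = 0) : 2 * t + s = 0 := by
  rw [cuspParam_apply] at h0 h2
  simp [Fin.sum_univ_three, cuspParam] at h0 h1 h2
  have h3 : (s - t) ^ 2 * (l 2 * (2 * t + s)) = 0 := by
    linear_combination h2 - h0 - (s - t) * h1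
  have h4 : l 2 * (2 * t + s) = 0 :=
    (mul_eq_zero.1 h3).resolve_left (pow_ne_zero _ (sub_ne_zero.2 hst))
  rcases mul_eq_zero.1 h4 with h | h
  · exfalso
    have l1 : l 1 = 0 := by linear_combination h1 - 3 * t ^ 2 * h
    have l0 : l 0 = 0 := by linear_combination h0 - t * l1 - t ^ 3 * h
    obtain ⟨i, hi⟩ := hl
    fin_cases i
    exacts [hi l0, hi l1, hi h]
  · exact h

/-- The gradient of `G` at a point of contact with a parametrized curve annihilates the tangent
vector. -/
theorem gradient_tangent_eq_zero {φ : Fin 3 → Polynomial ℂ} {G : Form} {d : ℕ}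
    (hG : G.IsHomogeneous d) {t : ℂ} (h : (Polynomial.X - Polynomial.C t) ^ 2 ∣ aeval φ G) :
    ∑ i, eval (paramAt φ t) (pderiv i G) * paramAt φ t i = 0 ∧
      ∑ i, eval (paramAt φ t) (pderiv i G) * (φ i).derivative.eval t = 0 := by
  obtain ⟨h0, h1⟩ := eval_eq_zero_of_sq_dvd h
  rw [aeval_param_derivative] at h1
  rw [eval_aeval_param] at h0
  exact ⟨by rw [sum_eval_pderiv_mul hG, h0, mul_zero], h1⟩

theorem isCoprime_pow_sub {s t : ℂ} (h : s ≠ t) (m n : ℕ) :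
    IsCoprime ((Polynomial.X - Polynomial.C s) ^ m) ((Polynomial.X - Polynomial.C t) ^ n) :=
  (Polynomial.isCoprime_X_sub_C_of_isUnit_sub (sub_ne_zero.2 h).isUnit).pow

theorem IsSmoothVector.of_smul {F : Form} {n : ℕ} (hF : F.IsHomogeneous n) {v : Fin 3 → ℂ} {c : ℂ}
    (hc : c ≠ 0) (h : IsSmoothVector F (c • v)) : IsSmoothVector F v := by
  have := h.smul hF (inv_ne_zero hc)
  rwa [smul_smul, inv_mul_cancel₀ hc, one_smul] at this

/-- The cubic `G` meets the nodal cubic in the smooth points with parameters `t` (twice) and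
`s` (seven times). -/
def MeetsNodalTwice (G : Form) (t s : ℂ) : Prop :=
  IsIrreducibleCubic G ∧ HasSingularVector G ∧ IsSmoothVector G (paramAt nodalParam t) ∧
    ∃ k : ℂ, k ≠ 0 ∧ ∀ u, eval (paramAt nodalParam u) G = k * ((u - t) ^ 2 * (u - s) ^ 7)

/-- The part of kind (a) common to node and cusp. The powers at the distinct parameters are coprime
and their degrees 2 + 7 exhaust the degree of the pullback. -/
theorem contact_data {φ : Fin 3 → Polynomial ℂ} {G : Form} (hG : G.IsHomogeneous 3)
    {γ δ : ℂ → Fin 3 → ℂ} {t s : ℂ} (ht : HasParameter φ γ t) (hs : HasParameter φ δ s)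
    (hdeg : (aeval φ G).natDegree ≤ 9)
    (hγ : analyticOrderAt (fun s => eval (γ s) G) 0 = 2)
    (hδ : analyticOrderAt (fun s => eval (δ s) G) 0 = 7)
    (hsm : IsSmoothVector G (γ 0)) (hl : ∑ i, eval (γ 0) (pderiv i G) * δ 0 i = 0) :
    s ≠ t ∧ IsSmoothVector G (paramAt φ t) ∧
      ∑ i, eval (paramAt φ t) (pderiv i G) * paramAt φ t i = 0 ∧
      ∑ i, eval (paramAt φ t) (pderiv i G) * (φ i).derivative.eval t = 0 ∧
      ∑ i, eval (paramAt φ t) (pderiv i G) * paramAt φ s i = 0 ∧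
      ∃ k : ℂ, k ≠ 0 ∧ aeval φ G = Polynomial.C k *
        ((Polynomial.X - Polynomial.C t) ^ 2 * (Polynomial.X - Polynomial.C s) ^ 7) := by
  have hst : s ≠ t := hs.ne ht hG (by rw [hγ, hδ]; decide)
  have d2 := ht.pow_dvd (n := 2) hG hγ
  have d7 := hs.pow_dvd (n := 7) hG hδ
  obtain ⟨g0, g1⟩ := gradient_tangent_eq_zero hG d2
  obtain ⟨⟨c, hc, hcγ⟩, -⟩ := ht
  obtain ⟨⟨e, he, heδ⟩, -⟩ := id hs
  refine ⟨hst, IsSmoothVector.of_smul hG hc (by rwa [← hcγ]), g0, g1, ?_, ?_⟩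
  · simp only [hcγ, heδ, eval_smul_of_isHomogeneous hG.pderiv, Pi.smul_apply, smul_eq_mul] at hl
    have : (c ^ (3 - 1) * e) * ∑ i, eval (paramAt φ t) (pderiv i G) * paramAt φ s i = 0 := by
      rw [← hl, Finset.mul_sum]
      exact Finset.sum_congr rfl fun i _ => by ring
    exact (mul_eq_zero.1 this).resolve_left (mul_ne_zero (pow_ne_zero _ hc) he)
  · have hM : ((Polynomial.X - Polynomial.C t) ^ 2 *
        (Polynomial.X - Polynomial.C s) ^ 7).Monic :=
      ((Polynomial.monic_X_sub_C t).pow 2).mul ((Polynomial.monic_X_sub_C s).pow 7)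
    have hMd : ((Polynomial.X - Polynomial.C t) ^ 2 *
        (Polynomial.X - Polynomial.C s) ^ 7).natDegree = 9 := by
      rw [((Polynomial.monic_X_sub_C t).pow 2).natDegree_mul ((Polynomial.monic_X_sub_C s).pow 7)]
      simp
    exact exists_eq_C_mul_of_monic_dvd hM ((isCoprime_pow_sub hst.symm 2 7).mul_dvd d2 d7)
      (hs.aeval_ne_zero (n := 7) hG hδ) (by rwa [hMd])

theorem coeff_nine_and_eight (s t : ℂ) :
    ((Polynomial.X - Polynomial.C t) ^ 2 * (Polynomial.X - Polynomial.C s) ^ 7).coeff 9 = 1 ∧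
    ((Polynomial.X - Polynomial.C t) ^ 2 * (Polynomial.X - Polynomial.C s) ^ 7).coeff 8 =
      -(2 * t + 7 * s) ∧
    ((Polynomial.X - Polynomial.C t) ^ 2 * (Polynomial.X - Polynomial.C s) ^ 7).coeff 0 =
      -(t ^ 2 * s ^ 7) := by
  have m2 := (Polynomial.monic_X_sub_C t).pow 2
  have m7 := (Polynomial.monic_X_sub_C s).pow 7
  have hMd : ((Polynomial.X - Polynomial.C t) ^ 2 *
        (Polynomial.X - Polynomial.C s) ^ 7).natDegree = 9 := by
      rw [m2.natDegree_mul m7]; simp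
  refine ⟨?_, ?_, ?_⟩
  · have := (m2.mul m7).coeff_natDegree
    rwa [hMd] at this
  · have := m2.nextCoeff_mul m7
    rw [Polynomial.nextCoeff_of_natDegree_pos (by omega), hMd,
      (Polynomial.monic_X_sub_C t).nextCoeff_pow, (Polynomial.monic_X_sub_C s).nextCoeff_pow,
      Polynomial.nextCoeff_X_sub_C, Polynomial.nextCoeff_X_sub_C] at this
    rw [this]
    simp
    ring
  · rw [Polynomial.coeff_zero_eq_eval_zero]
    simp
    ring

theorem MatchesA.exists_parameters {D₁ D₂ : Form} {P₁ P' : Plane} (h : MatchesA D₁ D₂ P₁ P') :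
    ∃ (A : Matrix.GeneralLinearGroup (Fin 3) ℂ) (t s : ℂ),
      substitute (A : Matrix (Fin 3) (Fin 3) ℂ) D₁ = nodalForm ∧
      MeetsNodalTwice (substitute (A : Matrix (Fin 3) (Fin 3) ℂ) D₂) t s ∧
      s ≠ t ∧ t ^ 2 * s = 1 ∧ s ^ 6 = 1 := by
  obtain ⟨h1, h2, h2', h7, hl⟩ := h
  have hA : ∃ A : Matrix.GeneralLinearGroup (Fin 3) ℂ,
      substitute (A : Matrix (Fin 3) (Fin 3) ℂ) D₁ = nodalForm ∨
      substitute (A : Matrix (Fin 3) (Fin 3) ℂ) D₁ = cuspForm := by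
    rcases h1.linearlyEquivalent with ⟨A, hA⟩ | ⟨A, hA⟩
    exacts [⟨A, Or.inl hA⟩, ⟨A, Or.inr hA⟩]
  obtain ⟨A, hA⟩ := hA
  refine ⟨A, ?_⟩
  obtain ⟨γ, hγ, γ0, γs, γs', γo⟩ := h2'.exists_arc_substitute A
  obtain ⟨δ, hδ, δ0, δs, -, δo⟩ := h7.exists_arc_substitute A
  have hG := h2.1.substitute A
  have hl' : ∑ i, eval (γ 0) (pderiv i (substitute (A : Matrix (Fin 3) (Fin 3) ℂ) D₂)) * δ 0 i
      = 0 := by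
    rw [← eval_gradientForm, ← substitute_gradientForm, eval_substitute, γ0, δ0]
    exact hl
  have hsing := h2.hasSingularVector.substitute A
  generalize substitute (A : Matrix (Fin 3) (Fin 3) ℂ) D₂ = G at *
  rcases hA with hA | hA
  · rw [hA] at hγ hδ γs δs ⊢
    obtain ⟨t, -, ht⟩ := hγ.exists_nodalParam γs
    obtain ⟨s, -, hs⟩ := hδ.exists_nodalParam δs
    obtain ⟨hdeg, hcoeff⟩ := coeff_aeval_nodalParam hG.1
    obtain ⟨hst, hsm, l0, l1, l2, k, hk, hP⟩ := contact_data hG.1 ht hs hdeg γo δo γs' hl'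
    have r1 := nodal_tangent_relation hsm.2 hst l0 l1 l2
    obtain ⟨c9, -, c0⟩ := coeff_nine_and_eight s t
    refine ⟨t, s, rfl, ⟨hG, hsing, hsm, k, hk, fun u => ?_⟩, hst, r1, ?_⟩
    · rw [← eval_aeval_param, hP]; simp
    · rw [hP, Polynomial.coeff_C_mul, Polynomial.coeff_C_mul, c9, c0] at hcoeff
      -- The product relation is t²s⁷ = 1; divided by the tangent relation t²s = 1 it leaves s⁶ = 1.
      have h' : k * (t ^ 2 * s ^ 7 - 1) = 0 := by linear_combination -hcoeff
      have h'' := (mul_eq_zero.1 h').resolve_left hk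
      linear_combination h'' - s ^ 6 * r1
  · exfalso
    rw [hA] at hγ hδ γs δs
    obtain ⟨t, ht⟩ := hγ.exists_cuspParam γs
    obtain ⟨s, hs⟩ := hδ.exists_cuspParam δs
    obtain ⟨hdeg, hcoeff⟩ := coeff_aeval_cuspParam hG.1
    obtain ⟨hst, hsm, l0, l1, l2, k, hk, hP⟩ := contact_data hG.1 ht hs hdeg γo δo γs' hl'
    have r1 := cusp_tangent_relation hsm.2 hst l0 l1 l2
    obtain ⟨-, c8, -⟩ := coeff_nine_and_eight s t
    rw [hP, Polynomial.coeff_C_mul, c8] at hcoeff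
    have h'' := (mul_eq_zero.1 hcoeff).resolve_left hk
    -- The difference of 2t + 7s = 0 and 2t + s = 0.
    have s0 : 6 * s = 0 := by linear_combination -h'' - r1
    have s0' : s = 0 := by simpa using s0
    apply hst
    subst s0'
    have : 2 * t = 0 := by linear_combination r1
    simpa [eq_comm] using this

/-- The cubic `G` meets the nodal cubic only in the smooth point with parameter `t`. -/
def MeetsNodalOnce (G : Form) (t : ℂ) : Prop :=
  IsIrreducibleCubic G ∧ HasSingularVector G ∧
    ∃ k : ℂ, k ≠ 0 ∧ ∀ u, eval (paramAt nodalParam u) G = k * (u - t) ^ 9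

theorem contact_nine {φ : Fin 3 → Polynomial ℂ} {G : Form} (hG : G.IsHomogeneous 3)
    {γ : ℂ → Fin 3 → ℂ} {t : ℂ} (ht : HasParameter φ γ t) (hdeg : (aeval φ G).natDegree ≤ 9)
    (hγ : analyticOrderAt (fun s => eval (γ s) G) 0 = 9) :
    ∃ k : ℂ, k ≠ 0 ∧ aeval φ G = Polynomial.C k * (Polynomial.X - Polynomial.C t) ^ 9 := by
  refine exists_eq_C_mul_of_monic_dvd ((Polynomial.monic_X_sub_C t).pow 9)
    (ht.pow_dvd (n := 9) hG hγ) (ht.aeval_ne_zero (n := 9) hG hγ) ?_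
  simpa using hdeg

/-- A parameter value where some nonzero linear form vanishes to third order. -/
theorem nodal_flex_relation {l : Fin 3 → ℂ} {t : ℂ} (hl : ∃ i, l i ≠ 0)
    (h0 : ∑ i, l i * paramAt nodalParam t i = 0)
    (h1 : ∑ i, l i * (nodalParam i).derivative.eval t = 0)
    (h2 : ∑ i, l i * (nodalParam i).derivative.derivative.eval t = 0) : t ^ 3 = 1 := by
  rw [nodalParam_apply] at h0
  simp [Fin.sum_univ_three, nodalParam] at h0 h1 h2
  have l0 : l 0 = -3 * t * l 2 := by linear_combination h2 / 2
  have l1 : l 1 = 3 * t ^ 2 * l 2 := by linear_combination h1 - 2 * t * l0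
  have h5 : l 2 * (t ^ 3 - 1) = 0 := by linear_combination h0 - t ^ 2 * l0 - t * l1
  rcases mul_eq_zero.1 h5 with h | h
  · exfalso
    rw [h, mul_zero] at l0 l1
    obtain ⟨i, hi⟩ := hl
    fin_cases i
    exacts [hi l0, hi l1, hi h]
  · linear_combination h

theorem hasDerivAt_paramAt (φ : Fin 3 → Polynomial ℂ) (c t s : ℂ) :
    HasDerivAt (fun s => c • paramAt φ (t + s))
      (c • paramAt (fun i => (φ i).derivative) (t + s)) s := by
  refine HasDerivAt.const_smul c (hasDerivAt_pi.2 fun i => ?_)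
  exact ((φ i).hasDerivAt (t + s)).comp_const_add t s

theorem analyticAt_paramAt (φ : Fin 3 → Polynomial ℂ) (c t : ℂ) :
    AnalyticAt ℂ (fun s => c • paramAt φ (t + s)) 0 :=
  Differentiable.analyticAt (fun s => (hasDerivAt_paramAt φ c t s).differentiableAt) 0

theorem MatchesB.exists_parameter {D₁ D₂ : Form} {P : Plane} (h : MatchesB D₁ D₂ P) :
    ∃ (A : Matrix.GeneralLinearGroup (Fin 3) ℂ) (t : ℂ),
      substitute (A : Matrix (Fin 3) (Fin 3) ℂ) D₁ = nodalForm ∧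
      MeetsNodalOnce (substitute (A : Matrix (Fin 3) (Fin 3) ℂ) D₂) t ∧ t ^ 3 = 1 := by
  obtain ⟨h1, h2, h9, n, hn, hi⟩ := h
  have hA : ∃ A : Matrix.GeneralLinearGroup (Fin 3) ℂ,
      substitute (A : Matrix (Fin 3) (Fin 3) ℂ) D₁ = nodalForm ∨
      substitute (A : Matrix (Fin 3) (Fin 3) ℂ) D₁ = cuspForm := by
    rcases h1.linearlyEquivalent with ⟨A, hA⟩ | ⟨A, hA⟩
    exacts [⟨A, Or.inl hA⟩, ⟨A, Or.inr hA⟩]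
  obtain ⟨A, hA⟩ := hA
  refine ⟨A, ?_⟩
  obtain ⟨γ, hγ, γ0, γs, γs', γo⟩ := h9.exists_arc_substitute A
  obtain ⟨δ, hδ, δ0, δs, -, δo⟩ := hi.exists_arc_substitute A
  have h0 : γ 0 = δ 0 := eq_of_mulVec_eq A (γ0.trans δ0.symm)
  rw [tangentForm_eq, ← δ0, substitute_gradientForm] at δo
  have hG := h2.1.substitute A
  have hsing := h2.hasSingularVector.substitute A
  generalize substitute (A : Matrix (Fin 3) (Fin 3) ℂ) D₂ = G at *
  rcases hA with hA | hA
  · rw [hA] at hγ γs ⊢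
    obtain ⟨t, -, ht⟩ := hγ.exists_nodalParam γs
    obtain ⟨hdeg, hcoeff⟩ := coeff_aeval_nodalParam hG.1
    obtain ⟨k, hk, hP⟩ := contact_nine hG.1 ht hdeg γo
    refine ⟨t, rfl, ⟨hG, hsing, k, hk, fun u => ?_⟩, ?_⟩
    · rw [← eval_aeval_param, hP]; simp
    obtain ⟨⟨c, hc, hcγ⟩, -⟩ := ht
    -- The arc on the nodal cubic has contact nine with `G`, in particular at least three, so the
    -- inflection of `G` is inherited by the nodal cubic.
    have hord : 3 ≤ analyticOrderAt
        (fun s => eval ((fun s => c • paramAt nodalParam (t + s)) s) G) 0 := by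
      have := (natCast_le_analyticOrderAt (n := 3)
        (analyticAt_eval (analyticAt_paramAt nodalParam c t) G)).2
        ⟨fun s => c ^ 3 * k * s ^ 6, by fun_prop, Filter.Eventually.of_forall fun s => by
          simp only [eval_smul_of_isHomogeneous hG.1, ← eval_aeval_param, hP]
          simp
          ring⟩
      exact_mod_cast this
    obtain ⟨l0, l1, l2⟩ := gradient_apply_of_inflection hG.1 hδ δs (by rw [δo]; exact hn)
      (analyticAt_paramAt nodalParam c t) (by simpa [hcγ] using h0) hord
    have d1 : deriv (fun s => c • paramAt nodalParam (t + s)) =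
        fun s => c • paramAt (fun i => (nodalParam i).derivative) (t + s) :=
      funext fun s => (hasDerivAt_paramAt _ _ _ _).deriv
    rw [d1] at l1 l2
    rw [(hasDerivAt_paramAt _ _ _ _).deriv] at l2
    have hcancel : ∀ f : Fin 3 → ℂ, ∑ i, eval (δ 0) (pderiv i G) * (c • f) i = 0 →
        ∑ i, eval (δ 0) (pderiv i G) * f i = 0 := by
      intro f hf
      have : c * ∑ i, eval (δ 0) (pderiv i G) * f i = 0 := by
        refine Eq.trans ?_ hf
        rw [Finset.mul_sum]
        exact Finset.sum_congr rfl fun i _ => by simp; ring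
      exact (mul_eq_zero.1 this).resolve_left hc
    simp only [add_zero] at l0 l1 l2
    exact nodal_flex_relation δs.2 (hcancel _ l0) (hcancel _ l1) (hcancel _ l2)
  · exfalso
    rw [hA] at hγ γs
    obtain ⟨t, ht⟩ := hγ.exists_cuspParam γs
    obtain ⟨hdeg, hcoeff⟩ := coeff_aeval_cuspParam hG.1
    obtain ⟨k, hk, hP⟩ := contact_nine hG.1 ht hdeg γo
    -- The sum relation 9t = 0 puts the contact at the flex of the cuspidal cubic, where z pulls
    -- back to the cube of the parameter. Hence `G` is in the pencil of `cuspForm` and z³, whose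
    -- members with both coefficients nonzero are smooth.
    have hc8 : ((Polynomial.X - Polynomial.C t) ^ 9).coeff 8 = -(9 * t) := by
      have := (Polynomial.monic_X_sub_C t).nextCoeff_pow 9
      rw [Polynomial.nextCoeff_of_natDegree_pos (by simp), Polynomial.nextCoeff_X_sub_C] at this
      simpa using this
    rw [hP, Polynomial.coeff_C_mul, hc8] at hcoeff
    have ht0 : t = 0 := by simpa [hk] using hcoeff
    have hz : (C k * X 2 ^ 3 : Form).IsHomogeneous 3 := (isHomogeneous_X_pow 2 3).C_mul k
    obtain ⟨c, hc⟩ := exists_eq_mul_cuspForm (hG.1.sub hz) (by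
      rw [map_sub, hP, ht0]
      simp [cuspParam, Polynomial.algebraMap_eq, ← pow_mul])
    have hGc : G = C c * cuspForm + C k * X 2 ^ 3 := by rw [← hc]; ring
    have hc0 : c ≠ 0 := by
      rintro rfl
      refine not_irreducible_mul (F := X 2) (G := C k * X 2 ^ 2) (by simp) (by simp) ?_
      convert hG.2 using 1
      rw [hGc, map_zero]; ring
    obtain ⟨v, hv, hgrad⟩ := hsing
    have g0 := hgrad 0
    have g1 := hgrad 1
    have g2 := hgrad 2
    simp [hGc, cuspForm, pderiv_X, hc0] at g0 g1 g2
    have v0 : v 0 = 0 := by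
      rcases g0 with h | h
      · simpa [h, hc0] using g2
      · exact h
    have v2 : v 2 = 0 := by simpa [v0, hk] using g2
    exact hv (by ext i; fin_cases i <;> simp [v0, g1, v2])

/-! ### The two pairs -/

/-- The first cubic of the pair with contact orders two and seven. -/
noncomputable def tangentCubic₁ : Form := C 2 * X 0 ^ 2 * X 1 - X 1 ^ 2 * X 2 - X 0 ^ 2 * X 2

/-- The line in the pencil of the pair with contact orders two and seven. -/
noncomputable def tangentLine : Form := X 0 + X 2

/-- The conic in the pencil of the pair with contact orders two and seven. -/
noncomputable def osculatingConic : Form := X 2 ^ 2 + C 2 * X 1 * X 2 - C 4 * X 0 ^ 2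

/-- The second cubic of the pair with contact orders two and seven. -/
noncomputable def tangentCubic₂ : Form := tangentCubic₁ - C 4 * (tangentLine * osculatingConic)

/-- The first cubic of the pair with contact order nine. -/
noncomputable def flexCubic₁ : Form := X 0 ^ 2 * X 2 - C 2 * X 1 ^ 3 - C 9 * X 1 ^ 2 * X 2

/-- The second cubic of the pair with contact order nine. -/
noncomputable def flexCubic₂ : Form := flexCubic₁ + C 27 * X 2 ^ 3

theorem paramAt_smul_nodal (w t : ℂ) (hw : w ^ 3 = 1) :
    (!![w ^ 2, 0, 0; 0, w, 0; 0, 0, 1]).mulVec (paramAt nodalParam t) =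
      paramAt nodalParam (w * t) := by
  rw [mulVec_three, nodalParam_apply, nodalParam_apply]
  ext i
  fin_cases i
  · simp; ring
  · simp
  · simp [mul_pow, hw]

theorem substitute_nodalForm_of_cube_eq_one {w : ℂ} (hw : w ^ 3 = 1) :
    substitute !![w ^ 2, 0, 0; 0, w, 0; 0, 0, 1] nodalForm = nodalForm := by
  refine MvPolynomial.funext fun v => ?_
  rw [eval_substitute, mulVec_three]
  simp [nodalForm]
  linear_combination (v 0 * v 1 * v 2 + v 1 ^ 3 - v 0 ^ 3 * (w ^ 3 + 1)) * hw

/-- The diagonal automorphism of the nodal cubic that multiplies parameters by `w`. -/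
noncomputable def nodalScaling (w : ℂ) (hw : w ^ 3 = 1) : Matrix.GeneralLinearGroup (Fin 3) ℂ :=
  Matrix.GeneralLinearGroup.mkOfDetNeZero !![w ^ 2, 0, 0; 0, w, 0; 0, 0, 1] (by
    simp [Matrix.det_fin_three]
    rintro rfl
    simp at hw)

theorem coe_nodalScaling (w : ℂ) (hw : w ^ 3 = 1) :
    (nodalScaling w hw : Matrix (Fin 3) (Fin 3) ℂ) = !![w ^ 2, 0, 0; 0, w, 0; 0, 0, 1] := rfl

/-- The total degree nine is divisible by three, so rescaling parameters by a cube root of unity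
does not even change the constant `k`. -/
theorem MeetsNodalTwice.scale {G : Form} {t s w : ℂ} (hw : w ^ 3 = 1)
    (h : MeetsNodalTwice G (w * t) (w * s)) :
    MeetsNodalTwice (substitute (nodalScaling w hw : Matrix (Fin 3) (Fin 3) ℂ) G) t s := by
  obtain ⟨h1, h2, h3, k, hk, h4⟩ := h
  refine ⟨h1.substitute _, h2.substitute _, ?_, k, hk, fun u => ?_⟩
  · refine IsSmoothVector.substitute (nodalScaling w hw).isUnit ?_
    rwa [coe_nodalScaling, paramAt_smul_nodal w t hw]
  · rw [eval_substitute, coe_nodalScaling, paramAt_smul_nodal w u hw, h4]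
    linear_combination (k * (u - t) ^ 2 * (u - s) ^ 7 * (w ^ 6 + w ^ 3 + 1)) * hw

theorem MeetsNodalOnce.scale {G : Form} {t w : ℂ} (hw : w ^ 3 = 1)
    (h : MeetsNodalOnce G (w * t)) :
    MeetsNodalOnce (substitute (nodalScaling w hw : Matrix (Fin 3) (Fin 3) ℂ) G) t := by
  obtain ⟨h1, h2, k, hk, h4⟩ := h
  refine ⟨h1.substitute _, h2.substitute _, k, hk, fun u => ?_⟩
  rw [eval_substitute, coe_nodalScaling, paramAt_smul_nodal w u hw, h4]
  linear_combination (k * (u - t) ^ 9 * (w ^ 6 + w ^ 3 + 1)) * hw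

/-- A cubic with the same restriction to the nodal cubic as `R` lies in the pencil of `R` and the
nodal cubic. -/
theorem exists_pencil_of_restriction {G R : Form} (hG : G.IsHomogeneous 3)
    (hR : R.IsHomogeneous 3)
    (h : ∀ u, eval (paramAt nodalParam u) G = eval (paramAt nodalParam u) R) :
    ∃ c, G = C c * nodalForm + R := by
  obtain ⟨c, hc⟩ := exists_eq_mul_nodalForm (hG.sub hR) (Polynomial.funext fun u => by
    rw [eval_aeval_param, map_sub, h, sub_self, Polynomial.eval_zero])
  exact ⟨c, by rw [← hc]; ring⟩

theorem isHomogeneous_linear (a b c : ℂ) :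
    (C a * X 0 + C b * X 1 + C c * X 2 : Form).IsHomogeneous 1 :=
  ((isHomogeneous_C_mul_X a 0).add (isHomogeneous_C_mul_X b 1)).add (isHomogeneous_C_mul_X c 2)

/-! ### Contact of order nine -/

/-- The flex tangent -3x + 3y + z pulls back to (u - 1)³, so `G` lies in the pencil of the nodal
cubic and the triple flex tangent. Only one other irreducible member is singular. -/
theorem MeetsNodalOnce.projEquiv {G : Form} (h : MeetsNodalOnce G 1) :
    ∃ B : Matrix.GeneralLinearGroup (Fin 3) ℂ, ∃ c d : ℂ, c ≠ 0 ∧ d ≠ 0 ∧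
      substitute (B : Matrix (Fin 3) (Fin 3) ℂ) nodalForm = C c * flexCubic₁ ∧
      substitute (B : Matrix (Fin 3) (Fin 3) ℂ) G = C d * flexCubic₂ := by
  obtain ⟨h1, h2, k, hk, h4⟩ := h
  obtain ⟨c, hc⟩ := exists_pencil_of_restriction
    (R := C k * (C (-3) * X 0 + C 3 * X 1 + C 1 * X 2) ^ 3) h1.1
    (((isHomogeneous_linear _ _ _).pow 3).C_mul k) fun u => by
      rw [h4, nodalParam_apply]
      simp only [map_add, map_mul, map_pow, eval_C, eval_X, Matrix.cons_val]
      ring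
  have hc0 : c ≠ 0 := by
    rintro rfl
    refine not_irreducible_mul (F := (C (-3) * X 0 + C 3 * X 1 + C 1 * X 2))
      (G := C k * (C (-3) * X 0 + C 3 * X 1 + C 1 * X 2) ^ 2) (by simp) (by simp) ?_
    convert h1.2 using 1
    rw [hc, map_zero]; ring
  -- These coordinates turn the flex tangent into three times the last coordinate; the factor 27 in
  -- `m` below is the cube of that 3.
  let B := Matrix.GeneralLinearGroup.mkOfDetNeZero
    (!![1 / 36, 1 / 12, 0; 1 / 36, -1 / 12, 0; 0, 1 / 2, 3] : Matrix (Fin 3) (Fin 3) ℂ) (by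
      simp [Matrix.det_fin_three]; norm_num)
  have hB : (B : Matrix (Fin 3) (Fin 3) ℂ) =
    !![1 / 36, 1 / 12, 0; 1 / 36, -1 / 12, 0; 0, 1 / 2, 3] := rfl
  have hN : substitute (B : Matrix (Fin 3) (Fin 3) ℂ) nodalForm = C (1 / 432) * flexCubic₁ := by
    refine MvPolynomial.funext fun v => ?_
    rw [eval_substitute, hB, mulVec_three]
    simp [nodalForm, flexCubic₁]
    ring
  obtain ⟨m, hm, hm0⟩ : ∃ m : ℂ, substitute (B : Matrix (Fin 3) (Fin 3) ℂ) G =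
      C (c / 432) * (flexCubic₁ + C m * X 2 ^ 3) ∧ m ≠ 0 := by
    refine ⟨27 * 432 * k / c, MvPolynomial.funext fun v => ?_,
      div_ne_zero (mul_ne_zero (by norm_num) hk) hc0⟩
    rw [eval_substitute, hB, mulVec_three, hc]
    simp [nodalForm, flexCubic₁]
    field_simp
    ring
  have hc1 : c / 432 ≠ 0 := div_ne_zero hc0 (by norm_num)
  have hm27 : m = 27 := by
    obtain ⟨v, hv, hg⟩ := h2.substitute B
    rw [hm] at hg
    have g0 := hg 0
    have g1 := hg 1
    have g2 := hg 2
    simp [flexCubic₁, pderiv_X, hc0] at g0 g1 g2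
    ring_nf at g0 g1 g2
    by_contra hne
    have v2 : v 2 ≠ 0 := by
      intro v2
      have v1 : v 1 = 0 := by simpa [v2] using g1
      have v0 : v 0 = 0 := by simpa [v2, v1] using g2
      exact hv (by ext i; fin_cases i <;> simp [v0, v1, v2])
    have v0 : v 0 = 0 := by simpa [v2] using g0
    -- The singular vector lies over one of two points: v 1 = 0 would force m = 0, the first cubic
    -- itself, and v 1 = -3 v 2 forces m = 27.
    have g1' : v 1 * (v 1 + 3 * v 2) = 0 := by linear_combination -g1 / 6
    rcases mul_eq_zero.1 g1' with v1 | v1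
    · simp [v0, v1, v2, hm0] at g2
    · have v1' : v 1 = -3 * v 2 := by linear_combination v1
      rw [v0, v1'] at g2
      have : (m - 27) * v 2 ^ 2 = 0 := by linear_combination g2 / 3
      rcases mul_eq_zero.1 this with h | h
      · exact hne (by linear_combination h)
      · exact v2 (by simpa using h)
  refine ⟨B, 1 / 432, c / 432, by norm_num, hc1, hN, ?_⟩
  rw [hm, hm27, flexCubic₂]

theorem MatchesB.projEquivPairs {D₁ D₂ : Form} {P : Plane} (h : MatchesB D₁ D₂ P) :
    ProjEquivPairs D₁ D₂ flexCubic₁ flexCubic₂ := by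
  obtain ⟨A, t, hA, hG, ht⟩ := h.exists_parameter
  obtain ⟨B, c, d, hc, hd, hB, hB'⟩ := (MeetsNodalOnce.scale (t := 1) ht (by simpa using hG)).projEquiv
  refine ⟨A * nodalScaling t ht * B, c, d, hc, hd, ?_, ?_⟩
  · rw [Units.val_mul, Units.val_mul, ← substitute_substitute, ← substitute_substitute, hA,
      coe_nodalScaling, substitute_nodalForm_of_cube_eq_one ht, hB]
  · rw [Units.val_mul, Units.val_mul, ← substitute_substitute, ← substitute_substitute, hB']

/-! ### Contact of orders two and seven -/

/-- With L the tangent at parameter -1 and M the flex tangent at 1, the product LM² pulls back to (u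
+ 1)²(u - 1)⁷. The only singular irreducible member of its pencil with the nodal cubic, other than
that cubic, is singular at the tangency point, where `G` must be smooth. -/
theorem not_meetsNodalTwice_flex {G : Form} (h : MeetsNodalTwice G (-1) 1) : False := by
  obtain ⟨h1, ⟨v, hv, hg⟩, h3, k, hk, h4⟩ := h
  obtain ⟨c, hc⟩ := exists_pencil_of_restriction
    (R := C k * ((C 1 * X 0 + C (-1) * X 1 + C 1 * X 2) *
      (C (-3) * X 0 + C 3 * X 1 + C 1 * X 2) ^ 2)) h1.1
    (((isHomogeneous_linear _ _ _).mul ((isHomogeneous_linear _ _ _).pow 2)).C_mul k) fun u => by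
      rw [h4, nodalParam_apply]
      simp only [map_add, map_mul, map_pow, eval_C, eval_X, Matrix.cons_val]
      ring
  have hc0 : c ≠ 0 := by
    rintro rfl
    refine not_irreducible_mul (F := (C 1 * X 0 + C (-1) * X 1 + C 1 * X 2))
      (G := C k * (C (-3) * X 0 + C 3 * X 1 + C 1 * X 2) ^ 2) (by simp) (by simp) ?_
    convert h1.2 using 1
    rw [hc, map_zero]; ring
  obtain ⟨-, i, hi⟩ := h3
  have g0 := hg 0
  have g1 := hg 1
  have g2 := hg 2
  simp [hc, nodalForm, pderiv_X] at g0 g1 g2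
  have e1 : (v 0 + v 1) * (v 2 - 3 * (v 0 - v 1)) = 0 := by
    have : c * ((v 0 + v 1) * (v 2 - 3 * (v 0 - v 1))) = 0 := by linear_combination g0 + g1
    exact (mul_eq_zero.1 this).resolve_left hc0
  -- On M = 0 the gradient of LM² vanishes, so the singular vector would be the node (0, 0, 1),
  -- which is not on that line.
  have e2 : ¬ v 2 - 3 * (v 0 - v 1) = 0 := by
    intro h
    have v2 : v 2 = 3 * (v 0 - v 1) := by linear_combination h
    rw [v2] at g0 g1 g2
    have p1 : v 0 * v 1 = 0 := (mul_eq_zero.1 (show c * (v 0 * v 1) = 0 by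
      linear_combination g2)).resolve_left hc0
    have p2 : v 0 ^ 2 + v 1 ^ 2 = 0 := (mul_eq_zero.1 (show c * (v 0 ^ 2 + v 1 ^ 2) = 0 by
      linear_combination -g0 / 3 + c * p1)).resolve_left hc0
    have p3 : v 0 = 0 ∧ v 1 = 0 := by
      rcases mul_eq_zero.1 p1 with h | h
      · exact ⟨h, by simpa [h] using p2⟩
      · exact ⟨by simpa [h] using p2, h⟩
    exact hv (by ext i; fin_cases i <;> simp [p3.1, p3.2, v2])
  have e3 : v 1 = -v 0 := by linear_combination (mul_eq_zero.1 e1).resolve_right e2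
  rw [e3] at g0 g1 g2 e2
  have f3 : -c * v 0 ^ 2 + k * (v 2 - 6 * v 0) * (3 * v 2 - 2 * v 0) = 0 := by
    linear_combination g2
  have f1 : -c * (v 0 * (v 2 + 3 * v 0)) + k * (v 2 - 6 * v 0) * (-5 * v 2 - 18 * v 0) = 0 := by
    linear_combination g0
  have f4 : (k * (v 2 - 6 * v 0)) * (v 2 + 2 * v 0) ^ 2 = 0 := by
    linear_combination (f3 * (v 2 + 3 * v 0) - f1 * v 0) / 3
  have f5 : v 2 = -2 * v 0 := by
    rcases mul_eq_zero.1 f4 with h | h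
    · rcases mul_eq_zero.1 h with h | h
      · exact absurd h hk
      · exact absurd (by linear_combination h) e2
    · have : v 2 + 2 * v 0 = 0 := by simpa using h
      linear_combination this
  rw [f5] at f3
  have v0 : v 0 ≠ 0 := by
    intro v0
    exact hv (by ext i; fin_cases i <;> simp [v0, e3, f5])
  have f6 : c = 64 * k := by
    have : (c - 64 * k) * v 0 ^ 2 = 0 := by linear_combination -f3
    have := (mul_eq_zero.1 this).resolve_right (pow_ne_zero _ v0)
    linear_combination this
  -- For c = 64k the singular vector is a multiple of (1, -1, -2), the point with parameter -1.
  rw [nodalParam_apply, hc, f6] at hi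
  fin_cases i <;> simp [nodalForm, pderiv_X] at hi <;> apply hi <;> ring

/-- A singular vector of a member of the pencil of the first pair determines the member. -/
theorem tangent_pencil_singular {v : Fin 3 → ℂ} (hv : v ≠ 0) {m : ℂ}
    (hg : ∀ i, eval v (pderiv i (tangentCubic₁ + C m * (tangentLine * osculatingConic))) = 0) :
    m = 0 ∨ m = -2 ∨ m = -4 := by
  have g0 := hg 0
  have g1 := hg 1
  have g2 := hg 2
  simp [tangentCubic₁, tangentLine, osculatingConic, pderiv_X] at g0 g1 g2
  generalize h0 : v 0 = x at *
  generalize h1 : v 1 = y at *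
  generalize h2 : v 2 = z at *
  have hz : z ≠ 0 := by
    rintro rfl
    have hx : x = 0 := by
      have : x ^ 2 = 0 := by linear_combination g1 / 2
      simpa using this
    have hy : y = 0 := by
      subst hx
      have : y ^ 2 = 0 := by linear_combination -g2
      simpa using this
    exact hv (by ext i; fin_cases i <;> simp [h0, h1, h2, hx, hy])
  obtain ⟨a, rfl⟩ : ∃ a, x = a * z := ⟨x / z, by field_simp⟩
  obtain ⟨b, rfl⟩ : ∃ b, y = b * z := ⟨y / z, by field_simp⟩
  have k1 : b = a ^ 2 + m * (1 + a) := by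
    have : z ^ 2 * (b - (a ^ 2 + m * (1 + a))) = 0 := by linear_combination -g1 / 2
    linear_combination (mul_eq_zero.1 this).resolve_left (pow_ne_zero _ hz)
  have k0 : z ^ 2 * (4 * a * b - 2 * a + m * (1 + 2 * b - 4 * a ^ 2 - 8 * a * (a + 1))) = 0 := by
    linear_combination g0
  have k2 : z ^ 2 * (-b ^ 2 - a ^ 2 + m * (1 + 2 * b - 4 * a ^ 2 + 2 * (a + 1) * (1 + b))) = 0 := by
    linear_combination g2
  replace k0 := (mul_eq_zero.1 k0).resolve_left (pow_ne_zero _ hz)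
  replace k2 := (mul_eq_zero.1 k2).resolve_left (pow_ne_zero _ hz)
  subst k1
  -- With b eliminated, `d0` and `d1` say that a is a double root of (a + 1)(a - m - 1)(a² - ma -
  -- m). The linear factors coincide for m = -2, the quadratic has a double root for m = 0 and m =
  -- -4, and at the roots of the linear factors the quadratic takes the value 1.
  have d1 : (a - m - 1) * (a ^ 2 - m * a - m) + (a + 1) * (a ^ 2 - m * a - m) +
      (a + 1) * (a - m - 1) * (2 * a - m) = 0 := by linear_combination k0
  have d0 : (a + 1) * (a - m - 1) * (a ^ 2 - m * a - m) = 0 := by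
    linear_combination (k2 + a * k0) / 3
  rcases mul_eq_zero.1 d0 with h | h
  · rcases mul_eq_zero.1 h with h | h
    · have ha : a = -1 := by linear_combination h
      subst ha
      right; left
      linear_combination -d1
    · have ha : a = m + 1 := by linear_combination h
      subst ha
      right; left
      linear_combination d1
  · have d2 : (a + 1) * (a - m - 1) * (2 * a - m) = 0 := by
      linear_combination d1 - (2 * a - m) * h
    rcases mul_eq_zero.1 d2 with h' | h'
    · rcases mul_eq_zero.1 h' with h' | h'
      · have ha : a = -1 := by linear_combination h'
        subst ha
        exfalso
        norm_num at h
      · have ha : a = m + 1 := by linear_combination h'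
        subst ha
        exfalso
        ring_nf at h
        norm_num at h
    · have hm : m = 2 * a := by linear_combination -h'
      subst hm
      have : a * (a + 2) = 0 := by linear_combination -h
      rcases mul_eq_zero.1 this with h | h
      · left; linear_combination 2 * h
      · right; right; linear_combination 2 * h

/-- Keeping `ε` symbolic treats both square roots of -1 at once; the matrix `B` depends on it, the
normal form does not. -/
theorem MeetsNodalTwice.projEquiv {G : Form} {ε : ℂ} (hε : ε ^ 2 = -1)
    (h : MeetsNodalTwice G ε (-1)) :
    ∃ B : Matrix.GeneralLinearGroup (Fin 3) ℂ, ∃ c d : ℂ, c ≠ 0 ∧ d ≠ 0 ∧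
      substitute (B : Matrix (Fin 3) (Fin 3) ℂ) nodalForm = C c * tangentCubic₁ ∧
      substitute (B : Matrix (Fin 3) (Fin 3) ℂ) G = C d * tangentCubic₂ := by
  obtain ⟨h1, h2, h3, k, hk, h4⟩ := h
  have hε0 : ε ≠ 0 := by
    rintro rfl
    norm_num at hε
  have hq : IsHomogeneous (X 2 ^ 2 + C 6 * (X 0 * X 2) + C (-6) * (X 1 * X 2) + C 21 * X 0 ^ 2 +
      C 22 * (X 0 * X 1) + C 21 * X 1 ^ 2 : Form) 2 := by
    refine .add (.add (.add (.add (.add ?_ ?_) ?_) ?_) ?_) ?_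
    · exact isHomogeneous_X_pow 2 2
    · exact ((isHomogeneous_X ℂ 0).mul (isHomogeneous_X ℂ 2)).C_mul _
    · exact ((isHomogeneous_X ℂ 1).mul (isHomogeneous_X ℂ 2)).C_mul _
    · exact (isHomogeneous_X_pow 0 2).C_mul _
    · exact ((isHomogeneous_X ℂ 0).mul (isHomogeneous_X ℂ 1)).C_mul _
    · exact (isHomogeneous_X_pow 1 2).C_mul _
  -- By ε² = -1 the line pulls back to (u - ε)²(u + 1); the conic pulls back to (u + 1)⁶.
  obtain ⟨c, hc⟩ := exists_pencil_of_restriction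
    (R := C k * ((C (1 - 2 * ε) * X 0 + C (-(1 + 2 * ε)) * X 1 + C 1 * X 2) *
      (X 2 ^ 2 + C 6 * (X 0 * X 2) + C (-6) * (X 1 * X 2) + C 21 * X 0 ^ 2 +
      C 22 * (X 0 * X 1) + C 21 * X 1 ^ 2))) h1.1
    (((isHomogeneous_linear _ _ _).mul hq).C_mul k) fun u => by
      rw [h4, nodalParam_apply]
      simp only [map_add, map_mul, map_pow, eval_C, eval_X, Matrix.cons_val]
      linear_combination k * (u + 1) ^ 7 * hε
  have hc0 : c ≠ 0 := by
    rintro rfl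
    refine not_irreducible_mul (F := (C (1 - 2 * ε) * X 0 + C (-(1 + 2 * ε)) * X 1 + C 1 * X 2))
      (G := C k * (X 2 ^ 2 + C 6 * (X 0 * X 2) + C (-6) * (X 1 * X 2) + C 21 * X 0 ^ 2 +
      C 22 * (X 0 * X 1) + C 21 * X 1 ^ 2)) (by simp) (by simp) ?_
    convert h1.2 using 1
    rw [hc, map_zero]; ring
  let B := Matrix.GeneralLinearGroup.mkOfDetNeZero
    (!![ε / 2, 1 / 2, 0; ε / 2, -1 / 2, 0; 0, -1, 2] : Matrix (Fin 3) (Fin 3) ℂ) (by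
      have : (!![ε / 2, 1 / 2, 0; ε / 2, -1 / 2, 0; 0, -1, 2] : Matrix (Fin 3) (Fin 3) ℂ).det =
        -ε := by simp [Matrix.det_fin_three]; ring
      rw [this]
      exact neg_ne_zero.2 hε0)
  have hB : (B : Matrix (Fin 3) (Fin 3) ℂ) =
    !![ε / 2, 1 / 2, 0; ε / 2, -1 / 2, 0; 0, -1, 2] := rfl
  have hN : substitute (B : Matrix (Fin 3) (Fin 3) ℂ) nodalForm =
      C (1 / 2) * tangentCubic₁ := by
    refine MvPolynomial.funext fun v => ?_
    rw [eval_substitute, hB, mulVec_three]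
    simp [nodalForm, tangentCubic₁]
    linear_combination (v 0 ^ 2 * (v 2 / 2 - v 1)) * hε
  obtain ⟨m, hm, hm0⟩ : ∃ m : ℂ, substitute (B : Matrix (Fin 3) (Fin 3) ℂ) G =
      C (c / 2) * (tangentCubic₁ + C m * (tangentLine * osculatingConic)) ∧ m ≠ 0 := by
    refine ⟨16 * k / c, MvPolynomial.funext fun v => ?_,
      div_ne_zero (mul_ne_zero (by norm_num) hk) hc0⟩
    have hL : (1 - 2 * ε) * (ε / 2 * v 0 + 1 / 2 * v 1) +
        -(1 + 2 * ε) * (ε / 2 * v 0 + -1 / 2 * v 1) + (-v 1 + 2 * v 2) = 2 * (v 0 + v 2) := by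
      linear_combination (-2 * v 0) * hε
    have hQ : (-v 1 + 2 * v 2) ^ 2 + 6 * ((ε / 2 * v 0 + 1 / 2 * v 1) * (-v 1 + 2 * v 2)) +
        -6 * ((ε / 2 * v 0 + -1 / 2 * v 1) * (-v 1 + 2 * v 2)) +
        21 * (ε / 2 * v 0 + 1 / 2 * v 1) ^ 2 +
        22 * ((ε / 2 * v 0 + 1 / 2 * v 1) * (ε / 2 * v 0 + -1 / 2 * v 1)) +
        21 * (ε / 2 * v 0 + -1 / 2 * v 1) ^ 2 =
          4 * (v 2 ^ 2 + 2 * v 1 * v 2 - 4 * v 0 ^ 2) := by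
      linear_combination (16 * v 0 ^ 2) * hε
    have hN' := congrArg (eval v) hN
    rw [eval_substitute] at hN'
    rw [eval_substitute, hc, map_add, map_mul, hN', hB, mulVec_three]
    simp only [tangentLine, osculatingConic, map_add, map_sub, map_mul, map_pow, eval_C, eval_X,
      Matrix.cons_val, zero_mul, add_zero, zero_add, neg_mul, one_mul] at hL hQ ⊢
    rw [hL, hQ]
    field_simp
    ring
  have hc1 : c / 2 ≠ 0 := div_ne_zero hc0 (by norm_num)
  have hm4 : m = -4 := by
    obtain ⟨v, hv, hg⟩ := h2.substitute B
    rw [hm] at hg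
    rcases tangent_pencil_singular (m := m) hv fun i => by
      simpa [pderiv_C_mul, hc0] using hg i with h | h | h
    · exact absurd h hm0
    -- The member m = -2 is singular at (1, -1, -1), which `B` sends to a multiple of the tangency
    -- point, where `G` is smooth.
    · exfalso
      have hs : IsSmoothVector (substitute (B : Matrix (Fin 3) (Fin 3) ℂ) G) ![1, -1, -1] := by
        refine IsSmoothVector.substitute B.isUnit ?_
        have hw : (B : Matrix (Fin 3) (Fin 3) ℂ).mulVec ![1, -1, -1] =
            ((1 - ε) / 2) • paramAt nodalParam ε := by
          rw [hB, mulVec_three, nodalParam_apply]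
          ext i
          fin_cases i
          · simp; linear_combination (-(1 - ε) / 2) * hε
          · simp; linear_combination (1 / 2) * hε
          · simp; linear_combination (-(1 - ε) * ε / 2 - 1 / 2) * hε
        rw [hw]
        refine h3.smul h1.1 (div_ne_zero ?_ (by norm_num))
        intro h0
        have : ε = 1 := by linear_combination -h0
        rw [this] at hε
        norm_num at hε
      obtain ⟨-, i, hi⟩ := hs
      rw [hm, h] at hi
      fin_cases i <;> simp [tangentCubic₁, tangentLine, osculatingConic, pderiv_X] at hi <;>
        norm_num at hi
    · exact h
  refine ⟨B, 1 / 2, c / 2, by norm_num, hc1, hN, ?_⟩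
  rw [hm, hm4, tangentCubic₂, map_neg]
  ring

theorem MatchesA.projEquivPairs {D₁ D₂ : Form} {P₁ P' : Plane} (h : MatchesA D₁ D₂ P₁ P') :
    ProjEquivPairs D₁ D₂ tangentCubic₁ tangentCubic₂ := by
  obtain ⟨A, t, s, hA, hG, hst, hts, hs6⟩ := h.exists_parameters
  have hs : (s ^ 3 - 1) * (s ^ 3 + 1) = 0 := by linear_combination hs6
  rcases mul_eq_zero.1 hs with hs | hs
  · exfalso
    have hw : s ^ 3 = 1 := by linear_combination hs
    have hs0 : s ≠ 0 := by
      rintro rfl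
      norm_num at hw
    have hG' := MeetsNodalTwice.scale (t := t / s) (s := 1) hw (by
      rwa [mul_one, mul_div_cancel₀ _ hs0])
    -- After scaling s to 1 the relation t²s = 1 leaves parameter 1, which is excluded as the other
    -- contact point, or -1.
    have h1 : (t / s - 1) * (t / s + 1) = 0 := by
      field_simp
      linear_combination s ^ 2 * hts - t ^ 2 * hw
    have h2 : t / s = -1 := by
      rcases mul_eq_zero.1 h1 with h | h
      · refine absurd ?_ hst
        field_simp at h
        linear_combination -h
      · linear_combination h
    rw [h2] at hG'
    exact not_meetsNodalTwice_flex hG'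
  · have hw : (-s) ^ 3 = 1 := by linear_combination -hs
    have hs0 : s ≠ 0 := by
      rintro rfl
      norm_num at hw
    have hG' := MeetsNodalTwice.scale (t := -t / s) (s := -1) hw (by
      convert hG using 1
      · field_simp
      · ring)
    have hε : (-t / s) ^ 2 = -1 := by
      field_simp
      linear_combination t ^ 2 * hs - s ^ 2 * hts
    obtain ⟨B, c, d, hc, hd, hB, hB'⟩ := hG'.projEquiv hε
    refine ⟨A * nodalScaling (-s) hw * B, c, d, hc, hd, ?_, ?_⟩
    · rw [Units.val_mul, Units.val_mul, ← substitute_substitute, ← substitute_substitute, hA,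
        coe_nodalScaling, substitute_nodalForm_of_cube_eq_one hw, hB]
    · rw [Units.val_mul, Units.val_mul, ← substitute_substitute, ← substitute_substitute, hB']

/-! ### Singularities of type A -/

/-- Dividing by the value at the origin brings the argument of the logarithm close to 1, where the
principal branch is analytic. -/
theorem exists_analytic_root {u : ℂ × ℂ → ℂ} (hu : AnalyticAt ℂ u 0) (h0 : u 0 ≠ 0) {n : ℕ}
    (hn : 0 < n) :
    ∃ r : ℂ × ℂ → ℂ, AnalyticAt ℂ r 0 ∧ r 0 ≠ 0 ∧ ∀ᶠ w in 𝓝 (0 : ℂ × ℂ), r w ^ n = u w := by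
  obtain ⟨ρ, hρ⟩ := IsAlgClosed.exists_pow_nat_eq (u 0) hn
  have hρ0 : ρ ≠ 0 := by
    rintro rfl
    exact h0 (by rw [← hρ, zero_pow hn.ne'])
  have hq : AnalyticAt ℂ (fun w => u w / u 0) 0 := hu.div analyticAt_const h0
  refine ⟨fun w => ρ * Complex.exp (Complex.log (u w / u 0) / n), ?_,
    mul_ne_zero hρ0 (Complex.exp_ne_zero _), ?_⟩
  · exact analyticAt_const.mul ((hq.clog (by simp [h0])).div_const).cexp
  · filter_upwards [hu.continuousAt.eventually_ne h0] with w hw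
    rw [mul_pow, hρ, ← Complex.exp_nat_mul, mul_div_cancel₀ _ (by exact_mod_cast hn.ne'),
      Complex.exp_log (div_ne_zero hw h0), mul_div_cancel₀ _ h0]

/-- A product of two smooth germs `f` and `A f + B x ^ m`, with `A`, `B` units and `x`, `f` local
coordinates, is of type `A` with index `2 m - 1`. -/
theorem isTypeA_mul_mk {F G : Form} {d e m : ℕ} (hF : F.IsHomogeneous d) (hG : G.IsHomogeneous e)
    (hm : 2 ≤ m) {v a b : Fin 3 → ℂ} (hv : v ≠ 0) (hli : LinearIndependent ℂ ![v, a, b])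
    (hFv : eval v F = 0) (hFb : ∑ i, eval v (pderiv i F) * b i ≠ 0) {A B : ℂ × ℂ → ℂ}
    (hA : AnalyticAt ℂ A 0) (hB : AnalyticAt ℂ B 0) (hA0 : A 0 ≠ 0) (hB0 : B 0 ≠ 0)
    (h : ∀ᶠ w in 𝓝 (0 : ℂ × ℂ), eval (v + w.1 • a + w.2 • b) G =
      A w * eval (v + w.1 • a + w.2 • b) F + B w * w.1 ^ m) :
    IsTypeA (2 * m - 1) (F * G) (Projectivization.mk ℂ v hv) := by
  obtain ⟨c, hc⟩ := Projectivization.exists_smul_eq_mk_rep ℂ v hv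
  have hc' : (Projectivization.mk ℂ v hv).rep = (c : ℂ) • v := hc.symm
  set K : ℂ := (c : ℂ) ^ (d + e) with hK
  have hK0 : K ≠ 0 := pow_ne_zero _ c.ne_zero
  let f : ℂ × ℂ → ℂ := fun w => eval (v + w.1 • a + w.2 • b) F
  have hf : AnalyticAt ℂ f 0 := by
    have : ∀ i, AnalyticAt ℂ (fun w : ℂ × ℂ => (v + w.1 • a + w.2 • b) i) 0 := fun i => by
      simp only [Pi.add_apply, Pi.smul_apply, smul_eq_mul]
      exact (analyticAt_const.add (analyticAt_fst.mul analyticAt_const)).add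
        (analyticAt_snd.mul analyticAt_const)
    simpa [f, aeval_eq_eval] using AnalyticAt.aeval_mvPolynomial this F
  have hf0 : f 0 = 0 := by simpa [f] using hFv
  have hf01 : fderiv ℂ f 0 (0, 1) ≠ 0 := by
    have h1 : HasDerivAt (fun s : ℂ => ((0 : ℂ), s)) (0, 1) 0 :=
      (hasDerivAt_const 0 (0 : ℂ)).prodMk (hasDerivAt_id 0)
    have h2 : HasDerivAt (f ∘ fun s : ℂ => ((0 : ℂ), s)) (fderiv ℂ f 0 (0, 1)) 0 :=
      HasFDerivAt.comp_hasDerivAt (0 : ℂ) (by exact hf.differentiableAt.hasFDerivAt) h1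
    have h3 : HasDerivAt (fun s : ℂ => v + s • b) b 0 := by
      simpa using ((hasDerivAt_id (0 : ℂ)).smul_const b).const_add v
    have h4 := hasDerivAt_eval h3 F
    have h5 : (f ∘ fun s : ℂ => ((0 : ℂ), s)) = fun s => eval (v + s • b) F := by
      ext s; simp [f]
    rw [h5] at h2
    rw [h2.unique h4]
    simpa using hFb
  -- Completing the square: f(Af + Bx^m) = A(f + Bx^m/(2A))² - (B²/(4A))x^(2m). The units are
  -- absorbed by the roots `S` and `T`; `K` accounts for the chosen representative of the point.
  obtain ⟨S, hS, hS0, hSp⟩ := exists_analytic_root (u := fun w => K * A w)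
    (analyticAt_const.mul hA) (mul_ne_zero hK0 hA0) (n := 2) (by norm_num)
  obtain ⟨T, hT, hT0, hTp⟩ := exists_analytic_root (u := fun w => K * B w ^ 2 / (4 * A w))
    ((analyticAt_const.mul (hB.pow 2)).div (analyticAt_const.mul hA)
      (mul_ne_zero (by norm_num) hA0))
    (div_ne_zero (mul_ne_zero hK0 (pow_ne_zero _ hB0)) (mul_ne_zero (by norm_num) hA0))
    (n := 2 * m) (by omega)
  have hR : AnalyticAt ℂ (fun w => B w / (2 * A w)) 0 :=
    hB.div (analyticAt_const.mul hA) (mul_ne_zero (by norm_num) hA0)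
  have hx : AnalyticAt ℂ (fun w : ℂ × ℂ => w.1) 0 := analyticAt_fst
  have hy : AnalyticAt ℂ (fun w => f w + B w / (2 * A w) * w.1 ^ m) 0 :=
    hf.add (hR.mul (hx.pow m))
  have dx : HasFDerivAt (fun w : ℂ × ℂ => w.1 * T w) (T 0 • ContinuousLinearMap.fst ℂ ℂ ℂ) 0 := by
    have := (hasFDerivAt_fst (𝕜 := ℂ) (p := (0 : ℂ × ℂ))).mul hT.differentiableAt.hasFDerivAt
    refine this.congr_fderiv ?_
    ext <;> simp
  -- Since m ≥ 2, the correction term has no linear part, so the new y has the differential of f up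
  -- to a unit.
  have dp : HasFDerivAt (fun w : ℂ × ℂ => w.1 ^ m) (0 : ℂ × ℂ →L[ℂ] ℂ) 0 := by
    have := (hasFDerivAt_fst (𝕜 := ℂ) (p := (0 : ℂ × ℂ))).pow m
    refine this.congr_fderiv ?_
    have : m - 1 ≠ 0 := by omega
    ext <;> simp [this]
  have dR : HasFDerivAt (fun w : ℂ × ℂ => B w / (2 * A w) * w.1 ^ m)
      (0 : ℂ × ℂ →L[ℂ] ℂ) 0 := by
    refine (hR.differentiableAt.hasFDerivAt.mul dp).congr_fderiv ?_
    have : m ≠ 0 := by omega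
    ext <;> simp [this]
  have dy : HasFDerivAt (fun w => S w * (f w + B w / (2 * A w) * w.1 ^ m))
      (S 0 • fderiv ℂ f 0) 0 := by
    refine (hS.differentiableAt.hasFDerivAt.mul
      (hf.differentiableAt.hasFDerivAt.add dR)).congr_fderiv ?_
    have : m ≠ 0 := by omega
    ext <;> simp [this, hf0]
  refine ⟨(c : ℂ) • a, (c : ℂ) • b, ?_, fun w => w.1 * T w,
    fun w => S w * (f w + B w / (2 * A w) * w.1 ^ m), hx.mul hT, hS.mul hy, by simp,
    by simp [hf0, show m ≠ 0 by omega], ?_, ?_⟩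
  · rw [hc']
    have := hli.units_smul fun _ => c
    have e : (fun _ : Fin 3 => c) • ![v, a, b] = ![(c : ℂ) • v, (c : ℂ) • a, (c : ℂ) • b] := by
      ext i : 1
      fin_cases i <;> rfl
    rwa [e] at this
  · rw [dx.fderiv, dy.fderiv, LinearIndependent.pair_iff]
    intro s t hst
    have h1 := DFunLike.congr_fun hst ((0 : ℂ), (1 : ℂ))
    have ht : t = 0 := by simpa [hS0, hf01] using h1
    have h2 := DFunLike.congr_fun hst ((1 : ℂ), (0 : ℂ))
    exact ⟨by simpa [ht, hT0] using h2, ht⟩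
  · filter_upwards [h, hSp, hTp, hA.continuousAt.eventually_ne hA0] with w hw hSw hTw hAw
    have e1 : (Projectivization.mk ℂ v hv).rep + w.1 • (c : ℂ) • a + w.2 • (c : ℂ) • b =
        (c : ℂ) • (v + w.1 • a + w.2 • b) := by
      rw [hc', smul_add, smul_add, smul_comm w.1, smul_comm w.2]
    have e2 : 2 * m - 1 + 1 = 2 * m := by omega
    rw [e1, eval_smul_of_isHomogeneous (hF.mul hG), ← hK, map_mul, hw, e2, mul_pow, mul_pow, hSw,
      hTw, pow_mul' w.1 2 m]
    change K * (f w * (A w * f w + _)) = _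
    field_simp
    ring

/-! ### Points given by homogeneous coordinates -/

theorem exists_rep_mk {v : Fin 3 → ℂ} (hv : v ≠ 0) :
    ∃ c : ℂ, c ≠ 0 ∧ (Projectivization.mk ℂ v hv).rep = c • v := by
  obtain ⟨c, hc⟩ := Projectivization.exists_smul_eq_mk_rep ℂ v hv
  exact ⟨c, c.ne_zero, hc.symm⟩

theorem onCurve_mk_iff {F : Form} {n : ℕ} (hF : F.IsHomogeneous n) {v : Fin 3 → ℂ} (hv : v ≠ 0) :
    OnCurve F (Projectivization.mk ℂ v hv) ↔ eval v F = 0 := by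
  obtain ⟨c, hc, h⟩ := exists_rep_mk hv
  rw [OnCurve, h, eval_smul_of_isHomogeneous hF, mul_eq_zero]
  exact or_iff_right (pow_ne_zero _ hc)

/-- The kernel vector bounds the rank above and a nonzero 2 × 2 minor bounds it below. -/
theorem rank_eq_two {M : Matrix (Fin 3) (Fin 3) ℂ} {v : Fin 3 → ℂ} (hv : v ≠ 0)
    (h : M.mulVec v = 0) {r c : Fin 2 → Fin 3} (hrc : (M.submatrix r c).det ≠ 0) : M.rank = 2 := by
  apply le_antisymm
  · have h1 := LinearMap.finrank_range_add_finrank_ker M.mulVecLin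
    have h2 : 1 ≤ Module.finrank ℂ (LinearMap.ker M.mulVecLin) :=
      Submodule.one_le_finrank_iff.2 ((Submodule.ne_bot_iff _).2 ⟨v, h, hv⟩)
    rw [Module.finrank_fin_fun] at h1
    change Module.finrank ℂ (LinearMap.range M.mulVecLin) ≤ 2
    omega
  · have := Matrix.rank_submatrix_le M r c
    rwa [Matrix.rank_of_det_ne_zero hrc, Fintype.card_fin] at this

theorem isNode_mk {F : Form} (hF : F.IsHomogeneous 3) {v : Fin 3 → ℂ} (hv : v ≠ 0)
    (hg : ∀ i, eval v (pderiv i F) = 0) {r c : Fin 2 → Fin 3}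
    (hrc : ((Matrix.of fun i j => eval v (pderiv i (pderiv j F))).submatrix r c).det ≠ 0) :
    IsNode F (Projectivization.mk ℂ v hv) := by
  obtain ⟨a, ha, h⟩ := exists_rep_mk hv
  have h0 : eval v F = 0 := by
    have := sum_eval_pderiv_mul hF v
    simpa [hg] using this
  refine ⟨⟨(onCurve_mk_iff hF hv).2 h0, fun i => ?_⟩, ?_⟩
  · rw [h, eval_smul_of_isHomogeneous hF.pderiv, hg, mul_zero]
  · have hH : hessian F (Projectivization.mk ℂ v hv) =
        a • Matrix.of fun i j => eval v (pderiv i (pderiv j F)) := by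
      ext i j
      simp [hessian, h, eval_smul_of_isHomogeneous (hF.pderiv (i := j)).pderiv]
    rw [hH]
    refine rank_eq_two hv ?_ (r := r) (c := c) ?_
    · rw [Matrix.smul_mulVec]
      ext i
      have := sum_eval_pderiv_mul (hF.pderiv (i := i)) v
      rw [hg, mul_zero] at this
      simp only [Matrix.mulVec, dotProduct, Matrix.of_apply, Pi.smul_apply, Pi.zero_apply]
      simp only [pderiv_comm i _ F, this, smul_zero]
    · rw [Matrix.submatrix_smul, Pi.smul_apply, Pi.smul_apply, Matrix.det_smul]
      exact mul_ne_zero (pow_ne_zero _ ha) hrc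

theorem gradientForm_smul {F : Form} {n : ℕ} (hF : F.IsHomogeneous n) (a : ℂ) (v : Fin 3 → ℂ) :
    gradientForm F (a • v) = C (a ^ (n - 1)) * gradientForm F v := by
  simp only [gradientForm, eval_smul_of_isHomogeneous hF.pderiv, map_mul, Finset.mul_sum, mul_assoc]

/-- The tangent line in homogeneous coordinates. -/
theorem exists_tangentForm_eq {F : Form} {n : ℕ} (hF : F.IsHomogeneous n) {v : Fin 3 → ℂ}
    (hv : v ≠ 0) {L : Form} {k : ℂ} (hk : k ≠ 0) (hL : gradientForm F v = C k * L) :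
    ∃ c : ℂ, c ≠ 0 ∧ tangentForm F (Projectivization.mk ℂ v hv) = C c * L := by
  obtain ⟨a, ha, h⟩ := exists_rep_mk hv
  refine ⟨a ^ (n - 1) * k, mul_ne_zero (pow_ne_zero _ ha) hk, ?_⟩
  rw [tangentForm_eq, h, gradientForm_smul hF, hL, map_mul, mul_assoc]

theorem isTangentLine_mk {F : Form} {n : ℕ} (hF : F.IsHomogeneous n) {v : Fin 3 → ℂ} (hv : v ≠ 0)
    (hs : IsSmoothVector F v) {L : Form} {k : ℂ} (hk : k ≠ 0)
    (hL : gradientForm F v = C k * L) : IsTangentLine L F (Projectivization.mk ℂ v hv) := by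
  obtain ⟨a, ha, h⟩ := exists_rep_mk hv
  obtain ⟨c, hc, hcL⟩ := exists_tangentForm_eq hF hv hk hL
  refine ⟨?_, c⁻¹, inv_ne_zero hc, ?_⟩
  · change IsSmoothVector F (Projectivization.mk ℂ v hv).rep
    exact h ▸ hs.smul hF ha
  · rw [hcL, ← mul_assoc, ← map_mul, inv_mul_cancel₀ hc, map_one, one_mul]

theorem isInflection_mk {F : Form} {n : ℕ} (hF : F.IsHomogeneous n) {v : Fin 3 → ℂ} (hv : v ≠ 0)
    (hs : IsSmoothVector F v) {L : Form} {k : ℂ} (hk : k ≠ 0)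
    (hL : gradientForm F v = C k * L) {γ : ℂ → Fin 3 → ℂ} (hγ : IsArc F γ) (h0 : γ 0 = v)
    {g : ℂ → ℂ} (hg : Differentiable ℂ g) (hg0 : g 0 ≠ 0)
    (hLγ : ∀ t, eval (γ t) L = t ^ 3 * g t) : IsInflection F (Projectivization.mk ℂ v hv) := by
  obtain ⟨c, hc, hcL⟩ := exists_tangentForm_eq hF hv hk hL
  refine ⟨3, le_rfl, ?_⟩
  rw [hcL]
  have hp : ∀ i, k * eval v (pderiv i L) = eval v (pderiv i F) := fun i => by
    have := congrArg (fun G => eval v (pderiv i G)) hL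
    simpa [pderiv_gradientForm, pderiv_C_mul] using this.symm
  have hLh : L.IsHomogeneous 1 := by
    have h1 := (isHomogeneous_gradientForm F v).C_mul k⁻¹
    rw [hL, ← mul_assoc, ← map_mul, inv_mul_cancel₀ hk, map_one, one_mul] at h1
    exact h1
  have hLv : eval v L = 0 := by
    have h1 := hLγ 0
    rwa [h0, zero_pow three_ne_zero, zero_mul] at h1
  obtain ⟨-, i, hi⟩ := id hs
  refine hasContactOrder_mk (n := 3) hF (hLh.C_mul c) hv hs
    ⟨by simp [hLv], i, ?_⟩ hγ h0 (g := fun t => c * g t) (hg.const_mul c)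
    (mul_ne_zero hc hg0) fun t => ?_
  · rw [pderiv_C_mul, map_mul, eval_C]
    rw [← hp] at hi
    exact mul_ne_zero hc (right_ne_zero_of_mul hi)
  · rw [map_mul, eval_C, hLγ]
    ring

/-- A polynomial parametrization gives an arc at each immersed point. -/
theorem isArc_param {F : Form} {n : ℕ} (hF : F.IsHomogeneous n) {φ : Fin 3 → Polynomial ℂ}
    (h : ∀ t, eval (paramAt φ t) F = 0) {c t : ℂ} (hc : c ≠ 0)
    (hli : LinearIndependent ℂ ![paramAt φ t, paramAt (fun i => (φ i).derivative) t]) :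
    IsArc F fun s => c • paramAt φ (t + s) := by
  refine ⟨analyticAt_paramAt φ c t, ?_, Filter.Eventually.of_forall fun s => ?_⟩
  · rw [(hasDerivAt_paramAt φ c t 0).deriv, add_zero]
    simpa only [add_zero] using linearIndependent_pair_smul hc hli
  · rw [eval_smul_of_isHomogeneous hF, h, mul_zero]

theorem linearIndependent_pair_of_minor {v w : Fin 3 → ℂ} {i j : Fin 3}
    (h : v i * w j - v j * w i ≠ 0) : LinearIndependent ℂ ![v, w] := by
  rw [LinearIndependent.pair_iff]
  intro s t hst
  have hi : s * v i + t * w i = 0 := congrFun hst i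
  have hj : s * v j + t * w j = 0 := congrFun hst j
  constructor
  · refine (mul_eq_zero.1 (show s * (v i * w j - v j * w i) = 0 by
      linear_combination w j * hi - w i * hj)).resolve_right h
  · refine (mul_eq_zero.1 (show t * (v i * w j - v j * w i) = 0 by
      linear_combination v i * hj - v j * hi)).resolve_right h

theorem linearIndependent_triple_of_det {u v w : Fin 3 → ℂ}
    (h : (Matrix.of ![u, v, w]).det ≠ 0) : LinearIndependent ℂ ![u, v, w] :=
  Matrix.linearIndependent_rows_of_det_ne_zero h

/-- A form that is linear in one variable is irreducible if its two coefficients are relatively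
prime. -/
theorem irreducible_of_linear (i : Fin 3) {f g : Form} (hf0 : f ≠ 0)
    (hf : f ∈ supported ℂ {i}ᶜ) (hg : g ∈ supported ℂ {i}ᶜ) (h : IsRelPrime f g) :
    Irreducible (f * X i + g) :=
  irreducible_mul_X_add f g i hf0 (fun hi => mem_supported.1 hf hi rfl)
    (fun hi => mem_supported.1 hg hi rfl) h

theorem C_mem_supported (s : Set (Fin 3)) (a : ℂ) : (C a : Form) ∈ supported ℂ s :=
  (supported ℂ s).algebraMap_mem a

theorem isRelPrime_C {a : ℂ} (ha : a ≠ 0) (F : Form) : IsRelPrime F (C a) :=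
  ((isUnit_iff_ne_zero.2 ha).map C).isRelPrime_right

theorem isRelPrime_X {F : Form} {i : Fin 3} {v : Fin 3 → ℂ} (hv : v i = 0) (h : eval v F ≠ 0) :
    IsRelPrime F (X i) := by
  refine IsRelPrime.symm ((X_prime (i := i)).irreducible.isRelPrime_iff_not_dvd.2 ?_)
  rintro ⟨G, rfl⟩
  simp [hv] at h

/-! ### Existence of the pair with contact order nine -/

theorem isHomogeneous_X_pow_three (i : Fin 3) (n : ℕ) : (X i ^ n : Form).IsHomogeneous n := by
  simpa using (isHomogeneous_X ℂ i).pow n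

theorem isHomogeneous_flexCubic₁ : flexCubic₁.IsHomogeneous 3 :=
  (((isHomogeneous_X_pow_three 0 2).mul (isHomogeneous_X ℂ 2)).sub
    ((isHomogeneous_X_pow_three 1 3).C_mul 2)).sub
    (((isHomogeneous_X_pow_three 1 2).C_mul 9).mul (isHomogeneous_X ℂ 2))

theorem isHomogeneous_flexCubic₂ : flexCubic₂.IsHomogeneous 3 :=
  isHomogeneous_flexCubic₁.add ((isHomogeneous_X_pow_three 2 3).C_mul 27)

theorem eval_flexCubic₁ (v : Fin 3 → ℂ) :
    eval v flexCubic₁ = v 0 ^ 2 * v 2 - 2 * v 1 ^ 3 - 9 * v 1 ^ 2 * v 2 := by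
  simp [flexCubic₁]

theorem eval_flexCubic₂ (v : Fin 3 → ℂ) :
    eval v flexCubic₂ = v 0 ^ 2 * v 2 - 2 * v 1 ^ 3 - 9 * v 1 ^ 2 * v 2 + 27 * v 2 ^ 3 := by
  simp [flexCubic₂, flexCubic₁]

theorem isIrreducibleCubic_flexCubic₁ : IsIrreducibleCubic flexCubic₁ := by
  refine ⟨isHomogeneous_flexCubic₁, ?_⟩
  have h0 : (X 0 : Form) ∈ supported ℂ ({2}ᶜ : Set (Fin 3)) := X_mem_supported.2 (by simp)
  have h1 : (X 1 : Form) ∈ supported ℂ ({2}ᶜ : Set (Fin 3)) := X_mem_supported.2 (by simp)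
  have hrel : IsRelPrime (X 0 ^ 2 - C 9 * X 1 ^ 2 : Form) (X 1) :=
    isRelPrime_X (v := ![1, 0, 0]) (by simp) (by simp)
  have h := irreducible_of_linear 2 (f := X 0 ^ 2 - C 9 * X 1 ^ 2) (g := C (-2) * X 1 ^ 3)
    (fun h => by simpa using congrArg (eval ![1, 0, 0]) h)
    (sub_mem (pow_mem h0 2) (mul_mem (C_mem_supported _ _) (pow_mem h1 2)))
    (mul_mem (C_mem_supported _ _) (pow_mem h1 3))
    ((isRelPrime_C (by norm_num) _).mul_right hrel.pow_right)
  convert h using 1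
  rw [flexCubic₁, map_neg]
  ring

/-- A symmetry of the pencil fixing the contact point and its tangent line. It spares a second
irreducibility proof and a second parametrization. -/
theorem linearlyEquivalent_flexCubic : LinearlyEquivalent flexCubic₁ flexCubic₂ :=
  .of_det !![Complex.I, 0, 0; 0, 1, 3; 0, 0, -1] (by simp [Matrix.det_fin_three]) fun v => by
    rw [mulVec_three, eval_flexCubic₁, eval_flexCubic₂]
    simp
    linear_combination (-v 0 ^ 2 * v 2) * Complex.I_sq

theorem isIrreducibleCubic_flexCubic₂ : IsIrreducibleCubic flexCubic₂ :=
  linearlyEquivalent_flexCubic.isIrreducibleCubic isIrreducibleCubic_flexCubic₁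

theorem substitute_flexCubic :
    substitute !![Complex.I, 0, 0; 0, 1, 3; 0, 0, -1] flexCubic₁ = flexCubic₂ := by
  refine MvPolynomial.funext fun v => ?_
  rw [eval_substitute, mulVec_three, eval_flexCubic₁, eval_flexCubic₂]
  simp
  linear_combination (-v 0 ^ 2 * v 2) * Complex.I_sq

theorem pderiv_ofNat (i : Fin 3) (n : ℕ) [n.AtLeastTwo] :
    pderiv i (ofNat(n) : Form) = 0 :=
  (pderiv i : Derivation ℂ Form Form).map_natCast n

theorem isNodalCubic_flexCubic₁ : IsNodalCubic flexCubic₁ := by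
  have hv : (![0, 0, 1] : Fin 3 → ℂ) ≠ 0 := fun h => by simpa using congrFun h 2
  refine ⟨isIrreducibleCubic_flexCubic₁, _, isNode_mk isHomogeneous_flexCubic₁ hv (fun i => ?_)
    (r := ![0, 1]) (c := ![0, 1]) ?_⟩
  · fin_cases i <;> simp [flexCubic₁, pderiv_X]
  · rw [Matrix.det_fin_two]
    simp [flexCubic₁, pderiv_X]

theorem isNodalCubic_flexCubic₂ : IsNodalCubic flexCubic₂ := by
  have hv : (![0, -3, 1] : Fin 3 → ℂ) ≠ 0 := fun h => by simpa using congrFun h 2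
  refine ⟨isIrreducibleCubic_flexCubic₂, _, isNode_mk isHomogeneous_flexCubic₂ hv (fun i => ?_)
    (r := ![0, 1]) (c := ![0, 1]) ?_⟩
  · fin_cases i <;> simp [flexCubic₂, flexCubic₁, pderiv_X] <;> norm_num
  · rw [Matrix.det_fin_two]
    simp [flexCubic₂, flexCubic₁, pderiv_X, pderiv_ofNat]
    norm_num

theorem isSmoothVector_flexCubic₁ : IsSmoothVector flexCubic₁ ![1, 0, 0] :=
  ⟨by simp [eval_flexCubic₁], 2, by simp [flexCubic₁, pderiv_X]⟩

theorem isSmoothVector_flexCubic₂ : IsSmoothVector flexCubic₂ ![1, 0, 0] :=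
  ⟨by simp [eval_flexCubic₂], 2, by simp [flexCubic₂, flexCubic₁, pderiv_X]⟩

theorem gradientForm_flexCubic₁ : gradientForm flexCubic₁ ![1, 0, 0] = C 1 * X 2 := by
  simp [gradientForm, Fin.sum_univ_three, flexCubic₁, pderiv_X]

theorem gradientForm_flexCubic₂ : gradientForm flexCubic₂ ![1, 0, 0] = C 1 * X 2 := by
  simp [gradientForm, Fin.sum_univ_three, flexCubic₂, flexCubic₁, pderiv_X]

/-- A parametrization of the first cubic of the pair with contact order nine. -/
noncomputable def flexParam : Fin 3 → Polynomial ℂ :=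
  -- Intersection with the line y = tx through the node (0, 0, 1).
  ![1 - Polynomial.C 9 * Polynomial.X ^ 2, Polynomial.X - Polynomial.C 9 * Polynomial.X ^ 3,
    Polynomial.C 2 * Polynomial.X ^ 3]

theorem paramAt_flexParam (t : ℂ) :
    paramAt flexParam t = ![1 - 9 * t ^ 2, t - 9 * t ^ 3, 2 * t ^ 3] := by
  ext i; fin_cases i <;> simp [flexParam, paramAt]

theorem isArc_flexParam : IsArc flexCubic₁ fun s => paramAt flexParam s := by
  have h := isArc_param isHomogeneous_flexCubic₁ (φ := flexParam) (c := 1) (t := 0) (fun t => by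
    rw [paramAt_flexParam, eval_flexCubic₁]; simp; ring) one_ne_zero
    (linearIndependent_pair_of_minor (i := 0) (j := 1) (by simp [paramAt, flexParam]))
  simpa using h

/-- The scalar factor makes the transported arc start exactly at (1, 0, 0). -/
theorem isArc_flexParam₂ : IsArc flexCubic₂ fun s =>
    Complex.I • (!![-Complex.I, 0, 0; 0, 1, 3; 0, 0, -1]).mulVec (paramAt flexParam s) := by
  have h := (isArc_flexParam.substitute (A := !![Complex.I, 0, 0; 0, 1, 3; 0, 0, -1])
    (B := !![-Complex.I, 0, 0; 0, 1, 3; 0, 0, -1]) (by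
      ext i j
      fin_cases i <;> fin_cases j <;> simp [Matrix.mul_apply, Fin.sum_univ_three]))
  rw [substitute_flexCubic] at h
  exact h.smul isHomogeneous_flexCubic₂ Complex.I_ne_zero

/-- The common point of the cubics of the pair with contact order nine. -/
noncomputable def flexPoint : Plane :=
  Projectivization.mk ℂ ![1, 0, 0] fun h => by simpa using congrFun h 0

theorem hasContactOrder_flexCubic : HasContactOrder flexCubic₁ flexCubic₂ flexPoint 9 :=
  hasContactOrder_mk (n := 9) isHomogeneous_flexCubic₁ isHomogeneous_flexCubic₂ _
    isSmoothVector_flexCubic₁ isSmoothVector_flexCubic₂ isArc_flexParam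
    (by rw [paramAt_flexParam]; simp) (g := fun _ => 216) (differentiable_const _) (by norm_num)
    fun t => by rw [paramAt_flexParam, eval_flexCubic₂]; simp; ring

theorem isInflection_flexCubic₁ : IsInflection flexCubic₁ flexPoint :=
  isInflection_mk isHomogeneous_flexCubic₁ _ isSmoothVector_flexCubic₁ one_ne_zero
    gradientForm_flexCubic₁ isArc_flexParam (by rw [paramAt_flexParam]; simp) (g := fun _ => 2)
    (differentiable_const _) (by norm_num) fun t => by rw [paramAt_flexParam]; simp; ring

theorem isInflection_flexCubic₂ : IsInflection flexCubic₂ flexPoint :=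
  isInflection_mk isHomogeneous_flexCubic₂ _ isSmoothVector_flexCubic₂ one_ne_zero
    gradientForm_flexCubic₂ isArc_flexParam₂
    (by rw [paramAt_flexParam, mulVec_three]; ext i; fin_cases i <;> simp)
    (g := fun _ => -2 * Complex.I)
    (differentiable_const _) (by simp) fun t => by
      rw [paramAt_flexParam, mulVec_three]; simp; ring

theorem matchesB_flexCubic : MatchesB flexCubic₁ flexCubic₂ flexPoint := by
  obtain ⟨h, p, hp⟩ := isNodalCubic_flexCubic₁
  exact ⟨⟨h, p, hp.1⟩, isNodalCubic_flexCubic₂, hasContactOrder_flexCubic, isInflection_flexCubic₂⟩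

theorem eq_flexVector {v : Fin 3 → ℂ} (h₁ : eval v flexCubic₁ = 0) (h₂ : eval v flexCubic₂ = 0) :
    v = v 0 • ![1, 0, 0] := by
  rw [eval_flexCubic₁] at h₁
  rw [eval_flexCubic₂] at h₂
  have h2 : v 2 = 0 := pow_eq_zero_iff three_ne_zero |>.1
    (show v 2 ^ 3 = 0 by linear_combination (h₂ - h₁) / 27)
  have h1 : v 1 = 0 := pow_eq_zero_iff three_ne_zero |>.1
    (show v 1 ^ 3 = 0 by rw [h2] at h₁; linear_combination -h₁ / 2)
  ext i
  fin_cases i <;> simp [h1, h2]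

theorem isTypeA_flexCubic : IsTypeA 17 (flexCubic₁ * flexCubic₂) flexPoint := by
  let f : ℂ × ℂ → ℂ := fun w => w.2 - 2 * w.1 ^ 3 - 9 * w.1 ^ 2 * w.2
  refine isTypeA_mul_mk (m := 9) isHomogeneous_flexCubic₁ isHomogeneous_flexCubic₂ (by norm_num)
    (a := ![0, 1, 0]) (b := ![0, 0, 1]) _
    (linearIndependent_triple_of_det (by simp [Matrix.det_fin_three]))
    isSmoothVector_flexCubic₁.1 (by simp [Fin.sum_univ_three, flexCubic₁, pderiv_X])
    -- Solving the first equation for z gives z = (f + 2x³)/(1 - 9x²). In the expansion of 27z³ the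
    -- terms divisible by f go into `A`, and the remaining 216x⁹ gives `B`.
    (A := fun w => 1 + 27 * (f w ^ 2 + 6 * f w * w.1 ^ 3 + 12 * w.1 ^ 6) / (1 - 9 * w.1 ^ 2) ^ 3)
    (B := fun w => 216 / (1 - 9 * w.1 ^ 2) ^ 3) ?_ ?_ (by simp [f]) (by simp) ?_
  · have := analyticAt_fst (𝕜 := ℂ) (p := (0 : ℂ × ℂ))
    have := analyticAt_snd (𝕜 := ℂ) (p := (0 : ℂ × ℂ))
    fun_prop (disch := simp)
  · have := analyticAt_fst (𝕜 := ℂ) (p := (0 : ℂ × ℂ))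
    fun_prop (disch := simp)
  · have hc : ContinuousAt (fun w : ℂ × ℂ => 1 - 9 * w.1 ^ 2) 0 := by fun_prop
    filter_upwards [hc.eventually_ne (by simp : (1 - 9 * (0 : ℂ × ℂ).1 ^ 2 : ℂ) ≠ 0)] with w hw
    have h₁ : eval (![1, 0, 0] + w.1 • ![0, 1, 0] + w.2 • ![0, 0, 1]) flexCubic₁ = f w := by
      rw [eval_flexCubic₁]; simp [f]
    have h₂ : eval (![1, 0, 0] + w.1 • ![0, 1, 0] + w.2 • ![0, 0, 1]) flexCubic₂ =
        f w + 27 * w.2 ^ 3 := by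
      rw [eval_flexCubic₂]; simp [f]
    rw [h₁, h₂]
    have h2 : w.2 = (f w + 2 * w.1 ^ 3) / (1 - 9 * w.1 ^ 2) := by
      rw [eq_div_iff hw]; simp only [f]; ring
    generalize f w = y at h2 ⊢
    rw [h2]
    field_simp
    ring

theorem secondPair_flexCubic : SecondPair flexCubic₁ flexCubic₂ flexPoint := by
  refine ⟨isNodalCubic_flexCubic₁, isNodalCubic_flexCubic₂, ?_, isTypeA_flexCubic,
    isInflection_flexCubic₁, isInflection_flexCubic₂, X 2,
    isTangentLine_mk isHomogeneous_flexCubic₁ _ isSmoothVector_flexCubic₁ one_ne_zero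
      gradientForm_flexCubic₁,
    isTangentLine_mk isHomogeneous_flexCubic₂ _ isSmoothVector_flexCubic₂ one_ne_zero
      gradientForm_flexCubic₂, pow_ne_zero _ (X_ne_zero _), -1 / 27, 1 / 27, ?_⟩
  · ext p
    constructor
    · rintro ⟨h₁, h₂⟩
      have h := eq_flexVector h₁ h₂
      rw [Set.mem_singleton_iff, flexPoint, ← p.mk_rep, Projectivization.mk_eq_mk_iff']
      exact ⟨_, h.symm⟩
    · rintro rfl
      exact ⟨(onCurve_mk_iff isHomogeneous_flexCubic₁ _).2 isSmoothVector_flexCubic₁.1,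
        (onCurve_mk_iff isHomogeneous_flexCubic₂ _).2 isSmoothVector_flexCubic₂.1⟩
  · refine MvPolynomial.funext fun v => ?_
    simp [eval_flexCubic₁, eval_flexCubic₂]
    ring

/-! ### Existence of the pair with contact orders two and seven -/

theorem isHomogeneous_tangentCubic₁ : tangentCubic₁.IsHomogeneous 3 :=
  ((((isHomogeneous_X_pow_three 0 2).C_mul 2).mul (isHomogeneous_X ℂ 1)).sub
    ((isHomogeneous_X_pow_three 1 2).mul (isHomogeneous_X ℂ 2))).sub
    ((isHomogeneous_X_pow_three 0 2).mul (isHomogeneous_X ℂ 2))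

theorem isHomogeneous_tangentLine : tangentLine.IsHomogeneous 1 :=
  (isHomogeneous_X ℂ 0).add (isHomogeneous_X ℂ 2)

theorem isHomogeneous_osculatingConic : osculatingConic.IsHomogeneous 2 :=
  ((isHomogeneous_X_pow_three 2 2).add
    (((isHomogeneous_X ℂ 1).C_mul 2).mul (isHomogeneous_X ℂ 2))).sub
    ((isHomogeneous_X_pow_three 0 2).C_mul 4)

theorem isHomogeneous_tangentCubic₂ : tangentCubic₂.IsHomogeneous 3 :=
  isHomogeneous_tangentCubic₁.sub
    ((isHomogeneous_tangentLine.mul isHomogeneous_osculatingConic).C_mul 4)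

theorem eval_tangentCubic₁ (v : Fin 3 → ℂ) :
    eval v tangentCubic₁ = 2 * v 0 ^ 2 * v 1 - v 1 ^ 2 * v 2 - v 0 ^ 2 * v 2 := by
  simp [tangentCubic₁]

theorem eval_tangentLine (v : Fin 3 → ℂ) : eval v tangentLine = v 0 + v 2 := by
  simp [tangentLine]

theorem eval_osculatingConic (v : Fin 3 → ℂ) :
    eval v osculatingConic = v 2 ^ 2 + 2 * v 1 * v 2 - 4 * v 0 ^ 2 := by
  simp [osculatingConic]

theorem eval_tangentCubic₂ (v : Fin 3 → ℂ) :
    eval v tangentCubic₂ = 2 * v 0 ^ 2 * v 1 - v 1 ^ 2 * v 2 - v 0 ^ 2 * v 2 -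
      4 * ((v 0 + v 2) * (v 2 ^ 2 + 2 * v 1 * v 2 - 4 * v 0 ^ 2)) := by
  simp [tangentCubic₂, eval_tangentCubic₁, eval_tangentLine, eval_osculatingConic]

theorem isIrreducibleCubic_tangentCubic₁ : IsIrreducibleCubic tangentCubic₁ := by
  refine ⟨isHomogeneous_tangentCubic₁, ?_⟩
  have h0 : (X 0 : Form) ∈ supported ℂ ({2}ᶜ : Set (Fin 3)) := X_mem_supported.2 (by simp)
  have h1 : (X 1 : Form) ∈ supported ℂ ({2}ᶜ : Set (Fin 3)) := X_mem_supported.2 (by simp)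
  have hr0 : IsRelPrime (-(X 1 ^ 2 + X 0 ^ 2) : Form) (X 0) :=
    isRelPrime_X (v := ![0, 1, 0]) (by simp) (by simp)
  have hr1 : IsRelPrime (-(X 1 ^ 2 + X 0 ^ 2) : Form) (X 1) :=
    isRelPrime_X (v := ![1, 0, 0]) (by simp) (by simp)
  have h := irreducible_of_linear 2 (f := -(X 1 ^ 2 + X 0 ^ 2)) (g := C 2 * X 0 ^ 2 * X 1)
    (fun h => by simpa using congrArg (eval ![1, 0, 0]) h)
    (neg_mem (add_mem (pow_mem h1 2) (pow_mem h0 2)))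
    (mul_mem (mul_mem (C_mem_supported _ _) (pow_mem h0 2)) h1)
    (((isRelPrime_C two_ne_zero _).mul_right hr0.pow_right).mul_right hr1)
  convert h using 1
  rw [tangentCubic₁]
  ring

theorem isIrreducibleConic_osculatingConic : IsIrreducibleConic osculatingConic := by
  refine ⟨isHomogeneous_osculatingConic, ?_⟩
  have h0 : (X 0 : Form) ∈ supported ℂ ({1}ᶜ : Set (Fin 3)) := X_mem_supported.2 (by simp)
  have h2 : (X 2 : Form) ∈ supported ℂ ({1}ᶜ : Set (Fin 3)) := X_mem_supported.2 (by simp)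
  have hr : IsRelPrime (X 2 ^ 2 - C 4 * X 0 ^ 2 : Form) (X 2) :=
    isRelPrime_X (v := ![1, 0, 0]) (by simp) (by simp)
  have h := irreducible_of_linear 1 (f := C 2 * X 2) (g := X 2 ^ 2 - C 4 * X 0 ^ 2)
    (fun h => by simpa using congrArg (eval ![0, 0, 1]) h)
    (mul_mem (C_mem_supported _ _) h2)
    (sub_mem (pow_mem h2 2) (mul_mem (C_mem_supported _ _) (pow_mem h0 2)))
    ((isRelPrime_C two_ne_zero _).mul_right hr).symm
  convert h using 1
  rw [osculatingConic]
  ring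

/-- The projective involution that exchanges the cubics of the pair with contact orders two and
seven. -/
def tangentInvolution : Matrix (Fin 3) (Fin 3) ℂ := !![-1, 0, -2; 8, 1, 8; 0, 0, 1]

theorem tangentInvolution_mul_self : tangentInvolution * tangentInvolution = 1 := by
  ext i j
  fin_cases i <;> fin_cases j <;>
    simp [tangentInvolution, Matrix.mul_apply, Fin.sum_univ_three] <;> norm_num

theorem tangentInvolution_mulVec (v : Fin 3 → ℂ) :
    tangentInvolution.mulVec v =
      ![-v 0 - 2 * v 2, 8 * v 0 + v 1 + 8 * v 2, v 2] := by
  rw [tangentInvolution, mulVec_three]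
  ext i
  fin_cases i
  · simp; ring
  · simp
  · simp

theorem eval_mulVec_tangentCubic₁ (v : Fin 3 → ℂ) :
    eval (tangentInvolution.mulVec v) tangentCubic₁ = eval v tangentCubic₂ := by
  rw [tangentInvolution_mulVec, eval_tangentCubic₁, eval_tangentCubic₂]
  simp
  ring

theorem substitute_tangentCubic₁ : substitute tangentInvolution tangentCubic₁ = tangentCubic₂ :=
  MvPolynomial.funext fun v => by rw [eval_substitute, eval_mulVec_tangentCubic₁]

theorem isIrreducibleCubic_tangentCubic₂ : IsIrreducibleCubic tangentCubic₂ :=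
  (LinearlyEquivalent.of_det tangentInvolution
    (by simp [tangentInvolution, Matrix.det_fin_three])
    eval_mulVec_tangentCubic₁).isIrreducibleCubic isIrreducibleCubic_tangentCubic₁

theorem isNodalCubic_tangentCubic₁ : IsNodalCubic tangentCubic₁ := by
  have hv : (![0, 0, 1] : Fin 3 → ℂ) ≠ 0 := fun h => by simpa using congrFun h 2
  refine ⟨isIrreducibleCubic_tangentCubic₁, _, isNode_mk isHomogeneous_tangentCubic₁ hv
    (fun i => ?_) (r := ![0, 1]) (c := ![0, 1]) ?_⟩
  · fin_cases i <;> simp [tangentCubic₁, pderiv_X]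
  · rw [Matrix.det_fin_two]
    simp [tangentCubic₁, pderiv_X, pderiv_ofNat]

theorem isNodalCubic_tangentCubic₂ : IsNodalCubic tangentCubic₂ := by
  have hv : (![-2, 8, 1] : Fin 3 → ℂ) ≠ 0 := fun h => by simpa using congrFun h 2
  refine ⟨isIrreducibleCubic_tangentCubic₂, _, isNode_mk isHomogeneous_tangentCubic₂ hv
    (fun i => ?_) (r := ![0, 1]) (c := ![0, 1]) ?_⟩
  · fin_cases i <;>
      simp [tangentCubic₂, tangentCubic₁, tangentLine, osculatingConic, pderiv_X] <;> norm_num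
  · rw [Matrix.det_fin_two]
    simp [tangentCubic₂, tangentCubic₁, tangentLine, osculatingConic, pderiv_X, pderiv_ofNat]
    norm_num

theorem isSmoothVector_tangentCubic₁ : IsSmoothVector tangentCubic₁ ![0, 1, 0] :=
  ⟨by simp [eval_tangentCubic₁], 2, by simp [tangentCubic₁, pderiv_X]⟩

theorem isSmoothVector_tangentCubic₂ : IsSmoothVector tangentCubic₂ ![0, 1, 0] :=
  ⟨by simp [eval_tangentCubic₂], 2,
    by simp [tangentCubic₂, tangentCubic₁, tangentLine, osculatingConic, pderiv_X]⟩

theorem isSmoothVector_osculatingConic : IsSmoothVector osculatingConic ![0, 1, 0] :=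
  ⟨by simp [eval_osculatingConic], 2, by simp [osculatingConic, pderiv_X]⟩

theorem isSmoothVector_tangentCubic₁' : IsSmoothVector tangentCubic₁ ![1, -1, -1] :=
  ⟨by simp [eval_tangentCubic₁]; norm_num, 2, by simp [tangentCubic₁, pderiv_X]; norm_num⟩

theorem isSmoothVector_tangentCubic₂' : IsSmoothVector tangentCubic₂ ![1, -1, -1] :=
  ⟨by simp [eval_tangentCubic₂]; norm_num, 2,
    by simp [tangentCubic₂, tangentCubic₁, tangentLine, osculatingConic, pderiv_X]; norm_num⟩

theorem gradientForm_tangentCubic₁ :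
    gradientForm tangentCubic₁ ![1, -1, -1] = C (-2) * tangentLine := by
  refine MvPolynomial.funext fun v => ?_
  simp [gradientForm, Fin.sum_univ_three, tangentCubic₁, tangentLine, pderiv_X]
  ring

theorem gradientForm_tangentCubic₂ :
    gradientForm tangentCubic₂ ![1, -1, -1] = C 2 * tangentLine := by
  refine MvPolynomial.funext fun v => ?_
  simp [gradientForm, Fin.sum_univ_three, tangentCubic₂, tangentCubic₁, tangentLine,
    osculatingConic, pderiv_X]
  ring

/-- A parametrization of the first cubic of the pair with contact orders two and seven. -/
noncomputable def tangentParam : Fin 3 → Polynomial ℂ :=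
  -- Intersection with the line x = ty through the node (0, 0, 1). The parameter 0 is the contact
  -- point and -1 the tangency point.
  ![Polynomial.X + Polynomial.X ^ 3, 1 + Polynomial.X ^ 2, Polynomial.C 2 * Polynomial.X ^ 2]

theorem paramAt_tangentParam (t : ℂ) :
    paramAt tangentParam t = ![t + t ^ 3, 1 + t ^ 2, 2 * t ^ 2] := by
  ext i; fin_cases i <;> simp [tangentParam, paramAt]

theorem eval_tangentParam (t : ℂ) : eval (paramAt tangentParam t) tangentCubic₁ = 0 := by
  rw [paramAt_tangentParam, eval_tangentCubic₁]; simp; ring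

theorem isArc_tangentParam : IsArc tangentCubic₁ fun s => paramAt tangentParam s := by
  have h := isArc_param isHomogeneous_tangentCubic₁ (c := 1) (t := 0) eval_tangentParam one_ne_zero
    (linearIndependent_pair_of_minor (i := 1) (j := 0) (by simp [paramAt, tangentParam]))
  simpa using h

theorem isArc_tangentParam' :
    IsArc tangentCubic₁ fun s => (-1 / 2 : ℂ) • paramAt tangentParam (-1 + s) :=
  isArc_param isHomogeneous_tangentCubic₁ eval_tangentParam (by norm_num)
    (linearIndependent_pair_of_minor (i := 0) (j := 1) (by
      simp [paramAt, tangentParam]; norm_num))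

theorem isArc_tangentParam₂ :
    IsArc tangentCubic₂ fun s => tangentInvolution.mulVec (paramAt tangentParam s) := by
  have h := isArc_tangentParam.substitute tangentInvolution_mul_self
  rwa [substitute_tangentCubic₁] at h

/-- The point with contact order seven. -/
noncomputable def contactPoint : Plane :=
  Projectivization.mk ℂ ![0, 1, 0] fun h => by simpa using congrFun h 1

/-- The point with contact order two. -/
noncomputable def tangencyPoint : Plane :=
  Projectivization.mk ℂ ![1, -1, -1] fun h => by simpa using congrFun h 0

theorem hasContactOrder_contactPoint :
    HasContactOrder tangentCubic₁ tangentCubic₂ contactPoint 7 :=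
  hasContactOrder_mk (n := 7) isHomogeneous_tangentCubic₁ isHomogeneous_tangentCubic₂ _
    isSmoothVector_tangentCubic₁ isSmoothVector_tangentCubic₂ isArc_tangentParam
    -- The line pulls back to t(1 + t)² and the conic to -4t⁶.
    (by rw [paramAt_tangentParam]; simp) (g := fun t => 16 * (1 + t) ^ 2) (by fun_prop)
    (by norm_num) fun t => by rw [paramAt_tangentParam, eval_tangentCubic₂]; simp; ring

theorem hasContactOrder_tangencyPoint :
    HasContactOrder tangentCubic₁ tangentCubic₂ tangencyPoint 2 :=
  hasContactOrder_mk (n := 2) isHomogeneous_tangentCubic₁ isHomogeneous_tangentCubic₂ _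
    isSmoothVector_tangentCubic₁' isSmoothVector_tangentCubic₂' isArc_tangentParam'
    (by rw [paramAt_tangentParam]; ext i; fin_cases i <;> norm_num)
    (g := fun t => -2 * (t - 1) ^ 7) (by fun_prop)
    (by norm_num) fun t => by rw [paramAt_tangentParam, eval_tangentCubic₂]; simp; ring

theorem hasContactOrder_osculatingConic₁ :
    HasContactOrder tangentCubic₁ osculatingConic contactPoint 6 :=
  hasContactOrder_mk (n := 6) isHomogeneous_tangentCubic₁ isHomogeneous_osculatingConic _
    isSmoothVector_tangentCubic₁ isSmoothVector_osculatingConic isArc_tangentParam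
    (by rw [paramAt_tangentParam]; simp) (g := fun _ => -4) (differentiable_const _)
    (by norm_num) fun t => by rw [paramAt_tangentParam, eval_osculatingConic]; simp; ring

/-- The involution fixes the contact point and preserves the conic, so the contact order carries
over from the first cubic. -/
theorem hasContactOrder_osculatingConic₂ :
    HasContactOrder tangentCubic₂ osculatingConic contactPoint 6 :=
  hasContactOrder_mk (n := 6) isHomogeneous_tangentCubic₂ isHomogeneous_osculatingConic _
    isSmoothVector_tangentCubic₂ isSmoothVector_osculatingConic isArc_tangentParam₂
    (by rw [paramAt_tangentParam, tangentInvolution_mulVec]; simp) (g := fun _ => -4)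
    (differentiable_const _) (by norm_num) fun t => by
      rw [paramAt_tangentParam, tangentInvolution_mulVec, eval_osculatingConic]; simp; ring

theorem onCurve_tangentLine_contactPoint : OnCurve tangentLine contactPoint :=
  (onCurve_mk_iff isHomogeneous_tangentLine _).2 (by simp [eval_tangentLine])

theorem matchesA_tangentCubic : MatchesA tangentCubic₁ tangentCubic₂ contactPoint tangencyPoint := by
  obtain ⟨h, p, hp⟩ := isNodalCubic_tangentCubic₁
  refine ⟨⟨h, p, hp.1⟩, isNodalCubic_tangentCubic₂, hasContactOrder_tangencyPoint,
    hasContactOrder_contactPoint, ?_⟩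
  have hv : (![1, -1, -1] : Fin 3 → ℂ) ≠ 0 := fun h => by simpa using congrFun h 0
  obtain ⟨c, -, hc⟩ :=
    exists_tangentForm_eq isHomogeneous_tangentCubic₂ hv two_ne_zero gradientForm_tangentCubic₂
  have h0 : eval contactPoint.rep tangentLine = 0 := onCurve_tangentLine_contactPoint
  rw [tangencyPoint, hc, OnCurve, map_mul, h0, mul_zero]

theorem eq_contactVector_or_tangencyVector {v : Fin 3 → ℂ} (h₁ : eval v tangentCubic₁ = 0)
    (h₂ : eval v tangentCubic₂ = 0) : v = v 1 • ![0, 1, 0] ∨ v = v 0 • ![1, -1, -1] := by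
  rw [eval_tangentCubic₁] at h₁
  rw [eval_tangentCubic₂] at h₂
  have h : (v 0 + v 2) * (v 2 ^ 2 + 2 * v 1 * v 2 - 4 * v 0 ^ 2) = 0 := by
    linear_combination (h₁ - h₂) / 4
  have key : v 0 = 0 → v 2 = 0 → v = v 1 • ![0, 1, 0] := fun h0 h2 => by
    ext i
    fin_cases i <;> simp [h0, h2]
  rcases mul_eq_zero.1 h with h | h
  · have h2 : v 2 = -v 0 := by linear_combination h
    have h' : v 0 * (v 1 + v 0) ^ 2 = 0 := by rw [h2] at h₁; linear_combination h₁
    rcases mul_eq_zero.1 h' with h0 | h0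
    · exact Or.inl (key h0 (by rw [h2, h0, neg_zero]))
    · have h1 : v 1 = -v 0 := by linear_combination pow_eq_zero_iff two_ne_zero |>.1 h0
      right
      ext i
      fin_cases i <;> simp [h1, h2]
  -- Modulo the conic the first cubic is a multiple of z³, so the conic meets it only where z = 0.
  · have h2 : v 2 = 0 := pow_eq_zero_iff three_ne_zero |>.1
      (show v 2 ^ 3 = 0 by linear_combination (-4) * h₁ + (v 2 - 2 * v 1) * h)
    have h0 : v 0 = 0 := pow_eq_zero_iff two_ne_zero |>.1
      (show v 0 ^ 2 = 0 by rw [h2] at h; linear_combination (-1 / 4) * h)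
    exact Or.inl (key h0 h2)

theorem isTypeA_contactPoint : IsTypeA 13 (tangentCubic₁ * tangentCubic₂) contactPoint := by
  let p : ℂ × ℂ → ℂ := fun w => 2 * w.1 ^ 2 / (1 + w.1 ^ 2)
  let K : ℂ × ℂ → ℂ := fun w => (w.2 ^ 2 + w.2 * p w + p w ^ 2) + (2 + w.1) * (w.2 + p w) +
    (2 * w.1 - 4 * w.1 ^ 2)
  refine isTypeA_mul_mk (m := 7) isHomogeneous_tangentCubic₁ isHomogeneous_tangentCubic₂
    (by norm_num) (a := ![1, 0, 0]) (b := ![0, 0, 1]) _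
    (linearIndependent_triple_of_det (by simp [Matrix.det_fin_three]))
    isSmoothVector_tangentCubic₁.1 (by simp [Fin.sum_univ_three, tangentCubic₁, pderiv_X])
    -- With y = 1 the first cubic is z = p. `K` is the divided difference in z of line times conic
    -- between z and p; the value at z = p gives `B`.
    (A := fun w => 1 + 4 * K w / (1 + w.1 ^ 2))
    (B := fun w => 16 * (1 + w.1) ^ 2 / (1 + w.1 ^ 2) ^ 3) ?_ ?_ (by simp [K, p]) (by simp) ?_
  · have := analyticAt_fst (𝕜 := ℂ) (p := (0 : ℂ × ℂ))
    have := analyticAt_snd (𝕜 := ℂ) (p := (0 : ℂ × ℂ))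
    simp only [K, p]
    fun_prop (disch := simp)
  · have := analyticAt_fst (𝕜 := ℂ) (p := (0 : ℂ × ℂ))
    fun_prop (disch := simp)
  · have hc : ContinuousAt (fun w : ℂ × ℂ => 1 + w.1 ^ 2) 0 := by fun_prop
    filter_upwards [hc.eventually_ne (by simp : (1 + (0 : ℂ × ℂ).1 ^ 2 : ℂ) ≠ 0)] with w hw
    rw [eval_tangentCubic₁, eval_tangentCubic₂]
    simp [K, p]
    field_simp
    ring

theorem isTypeA_tangencyPoint : IsTypeA 3 (tangentCubic₁ * tangentCubic₂) tangencyPoint := by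
  let q : ℂ × ℂ → ℂ := fun w => (-1 + w.2) ^ 2 + 2 * (-1 + w.1) * (-1 + w.2) - 4
  refine isTypeA_mul_mk (m := 2) isHomogeneous_tangentCubic₁ isHomogeneous_tangentCubic₂
    (by norm_num) (a := ![0, 1, 0]) (b := ![0, 0, 1]) _
    (linearIndependent_triple_of_det (by simp [Matrix.det_fin_three]))
    isSmoothVector_tangentCubic₁'.1
    (by simp [Fin.sum_univ_three, tangentCubic₁, pderiv_X]; norm_num)
    -- In this chart the line is the second coordinate and `q` is the conic. The first cubic F gives
    -- w.2 = (w.1² - F)/((-1 + w.1)² + 1), which is substituted into F - 4 w.2 q.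
    (A := fun w => 1 + 4 * q w / ((-1 + w.1) ^ 2 + 1))
    (B := fun w => -4 * q w / ((-1 + w.1) ^ 2 + 1)) ?_ ?_ (by norm_num [q]) (by norm_num [q]) ?_
  · have := analyticAt_fst (𝕜 := ℂ) (p := (0 : ℂ × ℂ))
    have := analyticAt_snd (𝕜 := ℂ) (p := (0 : ℂ × ℂ))
    simp only [q]
    fun_prop (disch := norm_num)
  · have := analyticAt_fst (𝕜 := ℂ) (p := (0 : ℂ × ℂ))
    have := analyticAt_snd (𝕜 := ℂ) (p := (0 : ℂ × ℂ))
    simp only [q]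
    fun_prop (disch := norm_num)
  · have hc : ContinuousAt (fun w : ℂ × ℂ => (-1 + w.1) ^ 2 + 1) 0 := by fun_prop
    filter_upwards [hc.eventually_ne (by norm_num : ((-1 + (0 : ℂ × ℂ).1) ^ 2 + 1 : ℂ) ≠ 0)]
      with w hw
    rw [eval_tangentCubic₁, eval_tangentCubic₂]
    simp [q]
    field_simp
    ring

/-! ### Uniqueness of the osculating conic -/

theorem aeval_tangentParam_quadraticForm (a : ℕ → ℕ → ℂ) :
    aeval tangentParam (quadraticForm a) =
      Polynomial.C (a 2 0) * Polynomial.X ^ 6 +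
      Polynomial.C (a 1 1 + 2 * a 1 0) * Polynomial.X ^ 5 +
      Polynomial.C (2 * a 2 0 + a 0 2 + 2 * a 0 1 + 4 * a 0 0) * Polynomial.X ^ 4 +
      Polynomial.C (2 * a 1 1 + 2 * a 1 0) * Polynomial.X ^ 3 +
      Polynomial.C (a 2 0 + 2 * a 0 2 + 2 * a 0 1) * Polynomial.X ^ 2 +
      Polynomial.C (a 1 1) * Polynomial.X + Polynomial.C (a 0 2) := by
  simp only [quadraticForm, map_add, map_mul, map_pow, aeval_C, aeval_X, tangentParam,
    Polynomial.algebraMap_eq]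
  simp only [Matrix.cons_val, map_ofNat]
  ring

/-- A conic that meets the first cubic in the point of contact order seven with multiplicity six
is the osculating one. -/
theorem eq_osculatingConic_of_pow_six_dvd {Q : Form} (hQ : Q.IsHomogeneous 2)
    (h : Polynomial.X ^ 6 ∣ aeval tangentParam Q) : ∃ c : ℂ, Q = C c * osculatingConic := by
  obtain ⟨a, rfl⟩ := exists_quadraticForm hQ
  have hc := Polynomial.X_pow_dvd_iff.1 h
  rw [aeval_tangentParam_quadraticForm] at hc
  -- These five conditions already leave one conic up to a scalar; the coefficient of t⁵ then
  -- vanishes by itself.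
  have h0 := hc 0 (by norm_num)
  have h1 := hc 1 (by norm_num)
  have h2 := hc 2 (by norm_num)
  have h3 := hc 3 (by norm_num)
  have h4 := hc 4 (by norm_num)
  simp only [Polynomial.coeff_add, Polynomial.coeff_C_mul, Polynomial.coeff_X_pow,
    Polynomial.coeff_X, Polynomial.coeff_C] at h0 h1 h2 h3 h4
  norm_num at h0 h1 h2 h3 h4
  have e10 : a 1 0 = 0 := by linear_combination h3 / 2 - h1
  have e01 : a 0 1 = -a 2 0 / 2 := by linear_combination h2 / 2 - h0
  have e00 : a 0 0 = -a 2 0 / 4 := by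
    linear_combination h4 / 4 - h0 / 4 - e01 / 2
  refine ⟨-a 2 0 / 4, MvPolynomial.funext fun v => ?_⟩
  simp [quadraticForm, osculatingConic, h0, h1, e10, e01, e00]
  ring

/-- Near the contact point y and x² + y² do not vanish, so x / y serves as parameter. -/
theorem IsArc.hasParameter_tangentParam {γ : ℂ → Fin 3 → ℂ} (h : IsArc tangentCubic₁ γ)
    (h0 : γ 0 0 = 0) (h1 : γ 0 1 ≠ 0) : HasParameter tangentParam γ 0 := by
  have a0 := h.analyticAt_apply 0
  have a1 := h.analyticAt_apply 1
  have hτ : AnalyticAt ℂ (fun t => γ t 0 / γ t 1) 0 := a0.div a1 h1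
  have hs : γ 0 1 ^ 2 + γ 0 0 ^ 2 ≠ 0 := by simpa [h0] using h1
  have as : AnalyticAt ℂ (fun t => γ t 1 ^ 2 + γ t 0 ^ 2) 0 := (a1.pow 2).add (a0.pow 2)
  have hμ : AnalyticAt ℂ (fun t => γ t 1 ^ 3 / (γ t 1 ^ 2 + γ t 0 ^ 2)) 0 := (a1.pow 3).div as hs
  have key : HasParameter tangentParam γ (γ 0 0 / γ 0 1) := by
    refine h.hasParameter hμ hτ (div_ne_zero (pow_ne_zero _ h1) hs) ?_
    filter_upwards [h.2.2, eventually_apply_ne_zero a1 h1, as.continuousAt.eventually_ne hs]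
      with t ht ht1 hts
    rw [eval_tangentCubic₁] at ht
    rw [paramAt_tangentParam]
    ext i
    fin_cases i
    · simp; field_simp
    · simp; field_simp
    · simp; field_simp; linear_combination -ht
  rwa [h0, zero_div] at key

theorem eq_osculatingConic {Q : Form} (hQ : Q.IsHomogeneous 2)
    (h : HasContactOrder tangentCubic₁ Q contactPoint 6) :
    ∃ c : ℂ, Q = C c * osculatingConic := by
  obtain ⟨-, -, γ, hγ, h0, ho⟩ := hasContactOrder_iff.1 h
  obtain ⟨c, hc, hrep⟩ := exists_rep_mk (v := ![0, 1, 0]) fun h => by simpa using congrFun h 1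
  change contactPoint.rep = _ at hrep
  rw [hrep] at h0
  have hp := hγ.hasParameter_tangentParam (by simp [h0]) (by simpa [h0] using hc)
  refine eq_osculatingConic_of_pow_six_dvd hQ ?_
  simpa using hp.pow_dvd (n := 6) hQ ho

theorem firstPair_tangentCubic :
    FirstPair tangentCubic₁ tangentCubic₂ contactPoint tangencyPoint := by
  refine ⟨isNodalCubic_tangentCubic₁, isNodalCubic_tangentCubic₂, fun h => ?_, ?_,
    isTypeA_contactPoint, isTypeA_tangencyPoint, tangentLine, osculatingConic,
    isTangentLine_mk isHomogeneous_tangentCubic₁ _ isSmoothVector_tangentCubic₁'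
      (neg_ne_zero.2 two_ne_zero) gradientForm_tangentCubic₁,
    isTangentLine_mk isHomogeneous_tangentCubic₂ _ isSmoothVector_tangentCubic₂'
      two_ne_zero gradientForm_tangentCubic₂, onCurve_tangentLine_contactPoint,
    isIrreducibleConic_osculatingConic, hasContactOrder_osculatingConic₁,
    hasContactOrder_osculatingConic₂, fun Q hQ h _ => eq_osculatingConic hQ.1 h, ?_,
    1 / 4, -1 / 4, ?_⟩
  · obtain ⟨a, ha⟩ := (Projectivization.mk_eq_mk_iff' ..).1 h
    have h1 := congrFun ha 1
    have h0 := congrFun ha 0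
    simp at h0 h1
    simp [h0] at h1
  · ext p
    rw [Set.mem_insert_iff, Set.mem_singleton_iff]
    constructor
    · rintro ⟨h₁, h₂⟩
      refine (eq_contactVector_or_tangencyVector h₁ h₂).imp (fun h => ?_) fun h => ?_
      · rw [contactPoint, ← p.mk_rep, Projectivization.mk_eq_mk_iff']
        exact ⟨_, h.symm⟩
      · rw [tangencyPoint, ← p.mk_rep, Projectivization.mk_eq_mk_iff']
        exact ⟨_, h.symm⟩
    · rintro (rfl | rfl)
      · exact ⟨(onCurve_mk_iff isHomogeneous_tangentCubic₁ _).2 isSmoothVector_tangentCubic₁.1,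
          (onCurve_mk_iff isHomogeneous_tangentCubic₂ _).2 isSmoothVector_tangentCubic₂.1⟩
      · exact ⟨(onCurve_mk_iff isHomogeneous_tangentCubic₁ _).2 isSmoothVector_tangentCubic₁'.1,
          (onCurve_mk_iff isHomogeneous_tangentCubic₂ _).2 isSmoothVector_tangentCubic₂'.1⟩
  · intro h
    have := congrArg (eval ![1, 0, 0]) h
    simp [eval_tangentLine, eval_osculatingConic] at this
  · refine MvPolynomial.funext fun v => ?_
    simp [eval_tangentCubic₁, eval_tangentCubic₂, eval_tangentLine, eval_osculatingConic]
    ring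

/-- The first pair has two common points and the second pair only one. -/
theorem not_projEquivPairs_tangentCubic_flexCubic :
    ¬ ProjEquivPairs tangentCubic₁ tangentCubic₂ flexCubic₁ flexCubic₂ := by
  rintro ⟨A, c, d, hc, hd, h₁, h₂⟩
  have key : ∀ v : Fin 3 → ℂ, eval v tangentCubic₁ = 0 → eval v tangentCubic₂ = 0 →
      ∃ k : ℂ, v = k • (A : Matrix (Fin 3) (Fin 3) ℂ).mulVec ![1, 0, 0] := by
    intro v hv₁ hv₂
    obtain ⟨w, rfl⟩ : ∃ w, v = (A : Matrix (Fin 3) (Fin 3) ℂ).mulVec w :=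
      ⟨_, (mulVec_mulVec_inv A v).symm⟩
    rw [← eval_substitute, h₁, map_mul, eval_C] at hv₁
    rw [← eval_substitute, h₂, map_mul, eval_C] at hv₂
    have := eq_flexVector ((mul_eq_zero.1 hv₁).resolve_left hc)
      ((mul_eq_zero.1 hv₂).resolve_left hd)
    exact ⟨w 0, by rw [← Matrix.mulVec_smul, ← this]⟩
  obtain ⟨k, hk⟩ := key ![0, 1, 0] isSmoothVector_tangentCubic₁.1 isSmoothVector_tangentCubic₂.1
  obtain ⟨l, hl⟩ := key ![1, -1, -1] isSmoothVector_tangentCubic₁'.1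
    isSmoothVector_tangentCubic₂'.1
  have hk0 := congrFun hk 0
  have hk1 := congrFun hk 1
  have hl0 := congrFun hl 0
  rw [Pi.smul_apply, smul_eq_mul] at hk0 hk1 hl0
  generalize ((A : Matrix (Fin 3) (Fin 3) ℂ).mulVec ![1, 0, 0]) = u at hk0 hk1 hl0
  simp at hk0 hk1 hl0
  rcases hk0 with h | h
  · simp [h] at hk1
  · simp [h] at hl0

end PlaneCubics

/-- Projective equivalence of pairs is an equivalence relation, so comparison with one model of each
kind shows that pairs of the same kind are equivalent, and inequivalence of the models separates the
kinds. -/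
theorem proposition1p3 :
    ∃ C₁₁ C₁₂ C₂₁ C₂₂ : PlaneCubics.Form,
      (∃ P₁ P' : PlaneCubics.Plane,
        PlaneCubics.MatchesA C₁₁ C₁₂ P₁ P' ∧ PlaneCubics.FirstPair C₁₁ C₁₂ P₁ P') ∧
      (∃ P : PlaneCubics.Plane,
        PlaneCubics.MatchesB C₂₁ C₂₂ P ∧ PlaneCubics.SecondPair C₂₁ C₂₂ P) ∧
      (∀ (D₁ D₂ : PlaneCubics.Form) (P₁ P' : PlaneCubics.Plane),
        PlaneCubics.MatchesA D₁ D₂ P₁ P' → PlaneCubics.ProjEquivPairs D₁ D₂ C₁₁ C₁₂) ∧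
      (∀ (D₁ D₂ : PlaneCubics.Form) (P : PlaneCubics.Plane),
        PlaneCubics.MatchesB D₁ D₂ P → PlaneCubics.ProjEquivPairs D₁ D₂ C₂₁ C₂₂) ∧
      ¬ PlaneCubics.ProjEquivPairs C₁₁ C₁₂ C₂₁ C₂₂ :=
  ⟨_, _, _, _, ⟨_, _, PlaneCubics.matchesA_tangentCubic, PlaneCubics.firstPair_tangentCubic⟩,
    ⟨_, PlaneCubics.matchesB_flexCubic, PlaneCubics.secondPair_flexCubic⟩,
    fun _ _ _ _ h => h.projEquivPairs, fun _ _ _ h => h.projEquivPairs,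
    PlaneCubics.not_projEquivPairs_tangentCubic_flexCubic⟩
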